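/- **Setting.** For $\sigma,\sigma'\in\mathbb S^2$, $z\in\mathbb R^3$, $r>0$ and $w=(v_3,\dots,v_N)\in\mathbb R^{3(N-2)}$, $N\ge 2$, and for a function $F$ on $\mathbb R^{3N}$, write $F(z,r,\sigma,w):=F(z+r\sigma,\,z-r\sigma,\,v_3,\dots,v_N)$. For a kernel $B:[0,\infty)\times[-1,1]\to[0,+\infty]$ and a probability density $F$ on $\mathbb R^{3N}$, let $$\mathbb D_B(F):=\int_{(\mathbb S^2)^2\times\mathbb R^3\times(0,\infty)\times\mathbb R^{3(N-2)}}\Big(\sqrt{F(z,r,\sigma',w)}-\sqrt{F(z,r,\sigma,w)}\Big)^2B(r,\sigma\cdot\sigma')\,d\sigma\,d\sigma'\,8r^2\,dz\,dr\,dw\in[0,+\infty],$$ with $0\cdot\infty=0$. A probability measure with a Lebesgue density is identified with its density, and $\mathcal P(X)$ is the set of Borel probability measures on $X$ with the topology of weak convergence (tested on bounded continuous functions). For $F\in\mathcal P(\mathbb R^{3N})$ and $j\le N$, $F^{:j}\in\mathcal P(\mathbb R^{3j})$ is its marginal in the first $j$ velocities $v_1,\dots,v_j\in\mathbb R^3$.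 The Fisher information is $I(F):=\frac1N\int_{\mathbb R^{3N}}\frac{|\nabla F|^2}{F}$, with $\nabla F$ the weak gradient of the density of $F$, the integrand being $0$ where $F=\nabla F=0$, and $I(F):=+\infty$ if there is no density or no weak gradient in $L^1_{\rm loc}$. For $\nu\in\mathcal P(\mathcal P(\mathbb R^3))$ and $j\ge1$, $\nu^j:=\int_{\mathcal P(\mathbb R^3)}\rho^{\otimes j}\,\nu(d\rho)\in\mathcal P(\mathbb R^{3j})$. **Proposition.** Suppose that $B:[0,\infty)\times[-1,1]\to[0,+\infty]$ is lower semicontinuous. 1. *(Lower semicontinuity.)* Let $N\ge2$. If $(F^n)_n$ and $F$ are probability densities on $\mathbb R^{3N}$ and $F^n\rightharpoonup F$ weakly in $\mathcal P(\mathbb R^{3N})$, then $\mathbb D_B(F)\le\liminf_{n\to\infty}\mathbb D_B(F^n)$. 2. *(Superadditivity.)* For all $2\le j\le N$ and every probability density $F$ on $\mathbb R^{3N}$, $\mathbb D_B(F^{:j})\le\mathbb D_B(F)$. 3. *(Affinity in infinite dimension.)* Let $\nu\in\mathcal P(\mathcal P(\mathbb R^3))$ have finite mean Fisher information and finite mean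 second moment, that is, $\sup_{j\ge1}I(\nu^j)<\infty$ and $\int_{\mathbb R^3}|v|^2\,\nu^1(dv)<\infty$. Then $\nu$-almost every $\rho$ has a Lebesgue density, $\rho\mapsto\mathbb D_B(\rho\otimes\rho)$ is $\nu$-measurable (measurable up to a $\nu$-null set), and the limit below exists in $[0,+\infty]$ with $$\int_{\mathcal P(\mathbb R^3)}\mathbb D_B(\rho\otimes\rho)\,\nu(d\rho)=\lim_{j\to\infty}\mathbb D_B(\nu^j).$$ -/

import Mathlib

open MeasureTheory Set Filter Topology
open scoped ENNReal NNReal ContDiff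

namespace Kac

/-- The velocity space `ℝ³` with its Euclidean norm. -/
abbrev Velocity : Type := EuclideanSpace ℝ (Fin 3)

/-- The space `(ℝ³)ᴺ` of `N` velocities; `volume` is the Lebesgue measure on `ℝ³ᴺ`. -/
abbrev Config (N : ℕ) : Type := Fin N → Velocity

/-- The unit sphere `𝕊²` of `ℝ³`. -/
abbrev Sphere : Type := Metric.sphere (0 : Velocity) 1

/-- The surface measure `dσ` on `𝕊²` (of total mass `4π`). -/
noncomputable def sphereMeasure : Measure Sphere :=
  (volume : Measure Velocity).toSphere

/-- The point `(v₁, v₂, v₃, …, v_N)` of `(ℝ³)ᴺ`, `N = n + 2`, with `v₁ = z + r σ`, `v₂ = z - r σ`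
and with `w = (v₃, …, v_N)`. -/
noncomputable def collisionPoint {n : ℕ} (z : Velocity) (r : ℝ) (σ : Sphere) (w : Config n) :
    Config (n + 2) :=
  Fin.cons (z + r • (σ : Velocity)) (Fin.cons (z - r • (σ : Velocity)) w)

/-- The square-root entropy production of a density `f` on `(ℝ³)ᴺ`, `N = n + 2`:
`∫ (√f(z,r,σ',w) - √f(z,r,σ,w))² B(r, σ·σ') 8 r² dσ dσ' dz dr dw` over
`𝕊² × 𝕊² × ℝ³ × (0,∞) × (ℝ³)ⁿ`, a number of `[0,∞]`. -/
noncomputable def densityEntropyProduction (B : ℝ → ℝ → ℝ≥0∞) {n : ℕ}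
    (f : Config (n + 2) → ℝ) : ℝ≥0∞ :=
  ∫⁻ p : Sphere × Sphere × Velocity × ℝ × Config n,
      (match p with
        | (σ, σ', z, r, w) =>
          ENNReal.ofReal
              ((Real.sqrt (f (collisionPoint z r σ' w)) -
                Real.sqrt (f (collisionPoint z r σ w))) ^ 2)
            * B r (inner ℝ (σ : Velocity) (σ' : Velocity))
            * ENNReal.ofReal (8 * r ^ 2))
    ∂(sphereMeasure.prod (sphereMeasure.prod
        ((volume : Measure Velocity).prod
          (((volume : Measure ℝ).restrict (Ioi 0)).prod (volume : Measure (Config n))))))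

/-- The Lebesgue density of a measure on `(ℝ³)ᴺ`. -/
noncomputable def density {N : ℕ} (F : Measure (Config N)) : Config N → ℝ :=
  fun v => (F.rnDeriv volume v).toReal

open scoped Classical in
/-- The square-root entropy production `𝔻_B(F)` of a measure on `(ℝ³)ᴺ`, `N = n + 2`, with a
Lebesgue density (and `+∞` if there is no density). -/
noncomputable def entropyProduction (B : ℝ → ℝ → ℝ≥0∞) {n : ℕ}
    (F : Measure (Config (n + 2))) : ℝ≥0∞ :=
  if F ≪ volume then densityEntropyProduction B (density F) else ⊤

/-- The law `F^{:j}` of the first `j` of `N` velocities. -/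
noncomputable def firstMarginal {N j : ℕ} (h : j ≤ N) (F : Measure (Config N)) :
    Measure (Config j) :=
  F.map (fun v i => v (Fin.castLE h i))

/-- `g` is the weak gradient of the locally integrable function `f` on `(ℝ³)ᴺ`: `g v i k` is
the weak derivative of `f` at `v` in the `k`-th component of the `i`-th velocity. -/
def HasWeakGradient {N : ℕ} (f : Config N → ℝ) (g : Config N → Config N) : Prop :=
  LocallyIntegrable f volume ∧ LocallyIntegrable g volume ∧
    ∀ φ : Config N → ℝ, ContDiff ℝ ∞ φ → HasCompactSupport φ →
      ∀ (i : Fin N) (k : Fin 3),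
        ∫ v, f v * fderiv ℝ φ v (Pi.single i (EuclideanSpace.single k 1)) =
          - ∫ v, g v i k * φ v

open scoped Classical in
/-- The normalized Fisher information `I(F) = N⁻¹ ∫ |∇f|² / f` of a measure on `(ℝ³)ᴺ` with a
density `f` that has a weak gradient, `+∞` if there is no density or no weak gradient. The weak
gradient is unique up to null sets, so the infimum runs over versions of a single function. -/
noncomputable def fisherInformation {N : ℕ} (F : Measure (Config N)) : ℝ≥0∞ :=
  if F ≪ volume then
    ⨅ (g : Config N → Config N) (_ : HasWeakGradient (density F) g),
      (N : ℝ≥0∞)⁻¹ * ∫⁻ v, (∑ i, ‖g v i‖ₑ ^ 2) / ENNReal.ofReal (density F v)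
  else ⊤

/-- The product `ρ^{⊗ j}`. -/
noncomputable def tensorPower (j : ℕ) (ρ : ProbabilityMeasure Velocity) : Measure (Config j) :=
  Measure.pi fun _ : Fin j => (ρ : Measure Velocity)

instance (j : ℕ) (ρ : ProbabilityMeasure Velocity) : IsProbabilityMeasure (tensorPower j ρ) := by
  unfold tensorPower; infer_instance

/-- Measurability of `ρ ↦ ρ^{⊗ j}`, so that the mixture below is the genuine integral. -/
theorem measurable_tensorPower (j : ℕ) : Measurable (tensorPower j) := by
  refine Measurable.measure_of_isPiSystem_of_isProbabilityMeasure
    generateFrom_pi.symm isPiSystem_pi ?_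
  rintro _ ⟨s, hs, rfl⟩
  simp only [tensorPower, Measure.pi_pi]
  refine Finset.measurable_prod _ fun i _ => ?_
  have hsi : MeasurableSet (s i) := hs i (mem_univ i)
  exact (Measure.measurable_coe hsi).comp measurable_subtype_coe

/-- The mixture `ν^j = ∫ ρ^{⊗ j} ν(dρ)`. -/
noncomputable def mixture (ν : Measure (ProbabilityMeasure Velocity)) (j : ℕ) :
    Measure (Config j) :=
  ν.bind (tensorPower j)

theorem mixture_apply (ν : Measure (ProbabilityMeasure Velocity)) (j : ℕ) {s : Set (Config j)}
    (hs : MeasurableSet s) : mixture ν j s = ∫⁻ ρ, tensorPower j ρ s ∂ν :=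
  Measure.bind_apply hs (measurable_tensorPower j).aemeasurable

end Kac

namespace Kac

/-! Everything rests on the dual formula `(√b - √a)² = sup_u (a + b - e^u a - e^{-u} b)`, the
supremum over real `u`. Integrated, it presents the entropy production, for a bounded kernel, as a
supremum of functionals that are linear in the density, one for each bounded dual function `u` of
the collision variables. Two changes of variables make these functionals usable: `(σ, z, r) ↦ (z +
rσ, z - rσ)` carries `8 r² dσ dz dr` to Lebesgue measure, and exchanging `σ` and `σ'` turns
post-collisional terms into pre-collisional ones.

Lower semicontinuity. The kernel is approximated from below by bounded continuous kernels that
vanish near `r = 0`, and `u` may be taken continuous. Each linear functional is then the integral of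
a bounded continuous function against `F`, hence weakly continuous (`entropyProduction_le_liminf`).

Superadditivity. `(√b - √a)²` is jointly convex and homogeneous of degree one, so Jensen's
inequality holds for integrals over any parameter (`production_lintegral_le`). The parameter is here
a velocity that is integrated out.

Affinity. With `ρ` as the parameter, the same inequality gives `𝔻(ν^j) ≤ ∫ 𝔻(ρ^{⊗j}) dν`, and the
spectator velocities factor out, so `𝔻(ρ^{⊗j}) = 𝔻(ρ ⊗ ρ)`. Conversely, a near-optimal dual function
`u(ρ, x)` for the right side depends on `ρ`, which `ν^j` does not see. But the spectators are a
sample of `ρ`, and by the law of large numbers a large sample almost determines `ρ`: `u(ρ, x)` is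
`L¹`-close to some `v(x, w)`, an admissible dual function for `ν^j`
(`eventually_lt_production_mixtureDensity`).

The Fisher information serves to produce densities. Its bound and exchangeability control the effect
of translating one velocity, uniformly in `j`. Sample approximation carries the control over to the
joint law of `(ρ, v)`, which is therefore absolutely continuous with respect to `ν ⊗ dv`. This
yields densities of almost all `ρ` that are jointly measurable in `(ρ, v)`. -/

/-! ### Collision coordinates as a measure-preserving change of variables -/

instance : IsFiniteMeasure sphereMeasure := by
  unfold sphereMeasure; infer_instance

/-- The radial measure `8 r² dr` on `(0,∞)`. -/
noncomputable def radialMeasure : Measure ℝ :=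
  ((volume : Measure ℝ).restrict (Ioi 0)).withDensity fun r => ENNReal.ofReal (8 * r ^ 2)

instance : SFinite radialMeasure := by unfold radialMeasure; infer_instance

/-- The coordinates `(σ, σ', z, r)` of a pair of collisions. -/
abbrev CollisionCoord : Type := Sphere × Sphere × Velocity × ℝ

instance : SFinite sphereMeasure := inferInstance

/-- The measure `8 r² dσ dz dr` on the coordinates `(σ, z, r)` of a pair of velocities. -/
noncomputable def pairMeasure : Measure (Sphere × Velocity × ℝ) :=
  sphereMeasure.prod ((volume : Measure Velocity).prod radialMeasure)

instance : SFinite pairMeasure := by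
  have : SFinite ((volume : Measure Velocity).prod radialMeasure) := inferInstance
  unfold pairMeasure; infer_instance

/-- The measure `8 r² dσ dσ' dz dr`. -/
noncomputable def collisionMeasure : Measure CollisionCoord :=
  sphereMeasure.prod pairMeasure

instance : SFinite collisionMeasure := by unfold collisionMeasure; infer_instance

/-- Polar coordinates. The factor `8` is left over from the weight `8 r²`; it is the Jacobian of `y
↦ 2y` and is absorbed by `lintegral_sub_smul`. -/
theorem lintegral_sphere_radial {g : Velocity → ℝ≥0∞} (hg : Measurable g) :
    ∫⁻ p : Sphere × ℝ, g (p.2 • (p.1 : Velocity)) ∂(sphereMeasure.prod radialMeasure) =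
      8 * ∫⁻ y, g y := by
  have h1 : ∫⁻ y, g y = ∫⁻ y : ({0}ᶜ : Set Velocity), g y ∂((volume : Measure Velocity).comap (↑)) := by
    rw [lintegral_subtype_comap (measurableSet_singleton _).compl, restrict_compl_singleton]
  have hd : Module.finrank ℝ Velocity - 1 = 2 := by simp
  have mp := (volume : Measure Velocity).measurePreserving_homeomorphUnitSphereProd
  rw [hd] at mp
  have hm : Measurable fun p : Sphere × ℝ => g (p.2 • (p.1 : Velocity)) := by fun_prop
  have h2 : ∫⁻ y : ({0}ᶜ : Set Velocity), g y ∂((volume : Measure Velocity).comap (↑)) =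
      ∫⁻ p : Sphere × Ioi (0 : ℝ), g ((p.2 : ℝ) • (p.1 : Velocity))
        ∂(sphereMeasure.prod (Measure.volumeIoiPow 2)) := by
    rw [sphereMeasure, ← mp.lintegral_comp (by fun_prop)]
    refine lintegral_congr fun y => ?_
    congr 1
    simp only [homeomorphUnitSphereProd_apply_snd_coe, homeomorphUnitSphereProd_apply_fst_coe]
    rw [smul_inv_smul₀ (norm_ne_zero_iff.2 y.2)]
  rw [h1, h2, lintegral_prod _ hm.aemeasurable, lintegral_prod
    (fun p : Sphere × Ioi (0 : ℝ) => g ((p.2 : ℝ) • (p.1 : Velocity))) (by fun_prop),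
    ← lintegral_const_mul _ (by
      refine Measurable.lintegral_prod_right' (f := fun p : Sphere × Ioi (0:ℝ) => g ((p.2 : ℝ) • (p.1 : Velocity))) ?_
      fun_prop)]
  refine lintegral_congr fun σ => ?_
  rw [radialMeasure, lintegral_withDensity_eq_lintegral_mul _ (by fun_prop) (by fun_prop),
    Measure.volumeIoiPow, lintegral_withDensity_eq_lintegral_mul _ (by fun_prop) (by fun_prop)]
  rw [← lintegral_const_mul _ (by fun_prop)]
  simp only [Pi.mul_apply]
  rw [lintegral_subtype_comap measurableSet_Ioi
    (fun r : ℝ => 8 * (ENNReal.ofReal (r ^ 2) * g (r • (σ : Velocity))))]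
  refine lintegral_congr fun r => ?_
  rw [ENNReal.ofReal_mul (by norm_num), mul_assoc]
  simp

theorem lintegral_sub_smul (g : Velocity → ℝ≥0∞) (hg : Measurable g) (a : Velocity) :
    8 * ∫⁻ y, g (a - (2 : ℝ) • y) = ∫⁻ y, g y := by
  rw [← lintegral_sub_left_eq_self (μ := (volume : Measure Velocity)) g a]
  have hm : Measurable fun y => g (a - y) := by fun_prop
  have := lintegral_map (μ := (volume : Measure Velocity)) hm (measurable_const_smul (2 : ℝ))
  rw [← this, Measure.map_addHaar_smul _ two_ne_zero, lintegral_smul_measure]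
  simp only [smul_eq_mul, finrank_euclideanSpace, Fintype.card_fin]
  rw [← mul_assoc]
  rw [abs_of_pos (by positivity), ENNReal.ofReal_inv_of_pos (by positivity)]
  norm_num
  rw [ENNReal.mul_inv_cancel (by simp) (by simp), one_mul]

/-- The two velocities with coordinates `(σ, z, r)`. -/
noncomputable def pairPoint (x : Sphere × Velocity × ℝ) : Velocity × Velocity :=
  (x.2.1 + x.2.2 • (x.1 : Velocity), x.2.1 - x.2.2 • (x.1 : Velocity))

theorem continuous_pairPoint : Continuous pairPoint := by unfold pairPoint; fun_prop

theorem measurable_pairPoint : Measurable pairPoint := continuous_pairPoint.measurable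

/-- In terms of `y = rσ`, which is half of the relative velocity, the map is `(z, y) ↦ (z + y, z -
y)`, with Jacobian `2³`. This is where the normalization `8 r²` comes from. -/
theorem measurePreserving_pairPoint :
    MeasurePreserving pairPoint pairMeasure ((volume : Measure Velocity).prod volume) := by
  refine ⟨measurable_pairPoint, Measure.ext_of_lintegral _ fun g hg => ?_⟩
  rw [lintegral_map hg measurable_pairPoint]
  let e : (Sphere × ℝ) × Velocity ≃ᵐ Sphere × Velocity × ℝ :=
    MeasurableEquiv.prodAssoc.trans ((MeasurableEquiv.refl _).prodCongr MeasurableEquiv.prodComm)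
  have he : MeasurePreserving e ((sphereMeasure.prod radialMeasure).prod volume) pairMeasure :=
    ((MeasurePreserving.id sphereMeasure).prod Measure.measurePreserving_swap).comp
      (measurePreserving_prodAssoc sphereMeasure radialMeasure volume)
  have hgm : Measurable fun q : Velocity × Velocity => g (q.2 + q.1, q.2 - q.1) := by fun_prop
  rw [← he.lintegral_comp (f := fun x => g (pairPoint x)) (hg.comp measurable_pairPoint)]
  calc ∫⁻ p : (Sphere × ℝ) × Velocity, g (pairPoint (e p)) ∂((sphereMeasure.prod radialMeasure).prod volume)
      = ∫⁻ p : Sphere × ℝ, (∫⁻ z, g (z + p.2 • (p.1 : Velocity), z - p.2 • (p.1 : Velocity)))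
          ∂(sphereMeasure.prod radialMeasure) :=
        lintegral_prod _ ((hg.comp measurable_pairPoint).comp e.measurable).aemeasurable
    _ = 8 * ∫⁻ y, ∫⁻ z, g (z + y, z - y) :=
        lintegral_sphere_radial (g := fun y => ∫⁻ z, g (z + y, z - y)) hgm.lintegral_prod_right'
    _ = 8 * ∫⁻ y : Velocity, ∫⁻ z : Velocity, g (z, z - (2 : ℝ) • y) := by
        congr 1
        refine lintegral_congr fun y => ?_
        rw [← lintegral_add_right_eq_self (μ := (volume : Measure Velocity))
          (fun z => g (z, z - (2 : ℝ) • y)) y]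
        refine lintegral_congr fun z => ?_
        rw [two_smul]
        congr 2
        abel
    _ = 8 * ∫⁻ z : Velocity, ∫⁻ y : Velocity, g (z, z - (2 : ℝ) • y) := by
        rw [lintegral_lintegral_swap (by fun_prop)]
    _ = ∫⁻ z, ∫⁻ y, g (z, y) := by
        rw [← lintegral_const_mul _ (by
          refine Measurable.lintegral_prod_right'
            (f := fun p : Velocity × Velocity => g (p.1, p.1 - (2 : ℝ) • p.2)) ?_
          fun_prop)]
        exact lintegral_congr fun z => lintegral_sub_smul (fun y => g (z, y)) (by fun_prop) z
    _ = _ := (lintegral_prod _ hg.aemeasurable).symm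

/-- `(v₁, v₂, w) ↦ (v₁, v₂, w)` as a map into configurations. -/
def consPair {n : ℕ} (p : (Velocity × Velocity) × Config n) : Config (n + 2) :=
  Fin.cons p.1.1 (Fin.cons p.1.2 p.2)

theorem measurePreserving_cons (μ : Measure Velocity) [SigmaFinite μ] (n : ℕ) :
    MeasurePreserving (fun p : Velocity × Config n => (Fin.cons p.1 p.2 : Config (n + 1)))
      (μ.prod (Measure.pi fun _ => μ)) (Measure.pi fun _ => μ) := by
  have := (measurePreserving_piFinSuccAbove (fun _ : Fin (n + 1) => μ) 0).symm
  convert! this using 1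
  ext p
  simp [MeasurableEquiv.piFinSuccAbove]

theorem measurePreserving_snoc (μ : Measure Velocity) [SigmaFinite μ] (n : ℕ) :
    MeasurePreserving (fun p : Velocity × Config n => (Fin.snoc p.2 p.1 : Config (n + 1)))
      (μ.prod (Measure.pi fun _ => μ)) (Measure.pi fun _ => μ) := by
  have := (measurePreserving_piFinSuccAbove (fun _ : Fin (n + 1) => μ) (Fin.last n)).symm
  convert! this using 1
  ext p
  simp [MeasurableEquiv.piFinSuccAbove, Fin.snocEquiv]

theorem measurePreserving_consPair (μ : Measure Velocity) [SigmaFinite μ] (n : ℕ) :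
    MeasurePreserving (consPair (n := n))
      ((μ.prod μ).prod (Measure.pi fun _ => μ)) (Measure.pi fun _ => μ) :=
  (measurePreserving_cons μ (n + 1)).comp
    (((MeasurePreserving.id μ).prod (measurePreserving_cons μ n)).comp
      (measurePreserving_prodAssoc μ μ _))

/-! ### The entropy production as an integral over collision coordinates -/

/-- The configuration before the collision. -/
noncomputable def preCollision {n : ℕ} (p : CollisionCoord × Config n) : Config (n + 2) :=
  consPair (pairPoint (p.1.1, p.1.2.2), p.2)

/-- The configuration after the collision. -/
noncomputable def postCollision {n : ℕ} (p : CollisionCoord × Config n) : Config (n + 2) :=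
  consPair (pairPoint p.1.2, p.2)

/-- Exchange of the two collision directions. -/
def swapDirections (x : CollisionCoord) : CollisionCoord := (x.2.1, x.1, x.2.2)

theorem measurePreserving_swapDirections :
    MeasurePreserving swapDirections collisionMeasure collisionMeasure := by
  have : SFinite ((volume : Measure Velocity).prod radialMeasure) := inferInstance
  have h := (measurePreserving_prodAssoc sphereMeasure sphereMeasure
    ((volume : Measure Velocity).prod radialMeasure))
  exact h.comp (((Measure.measurePreserving_swap).prod (MeasurePreserving.id _)).comp h.symm)

/-- The direction that the configuration does not use is kept as a separate coordinate, so the image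
is a product measure; forgetting it would multiply Lebesgue measure by the area of the sphere. -/
theorem measurePreserving_postCollision (n : ℕ) :
    MeasurePreserving (fun p : CollisionCoord × Config n => (p.1.1, postCollision p))
      (collisionMeasure.prod volume) (sphereMeasure.prod volume) :=
  ((MeasurePreserving.id sphereMeasure).prod
    ((measurePreserving_consPair volume n).comp
      (measurePreserving_pairPoint.prod (MeasurePreserving.id volume)))).comp
    (measurePreserving_prodAssoc sphereMeasure pairMeasure volume)

theorem measurePreserving_preCollision (n : ℕ) :
    MeasurePreserving (fun p : CollisionCoord × Config n => (p.1.2.1, preCollision p))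
      (collisionMeasure.prod volume) (sphereMeasure.prod volume) :=
  (measurePreserving_postCollision n).comp
    (measurePreserving_swapDirections.prod (MeasurePreserving.id volume))

/-- The value `B(r, σ·σ')` of a collision kernel. -/
noncomputable def collisionWeight (B : ℝ → ℝ → ℝ≥0∞) (x : CollisionCoord) : ℝ≥0∞ :=
  B x.2.2.2 (inner ℝ (x.1 : Velocity) (x.2.1 : Velocity))

theorem measurable_collisionWeight {B : ℝ → ℝ → ℝ≥0∞} (hB : Measurable (Function.uncurry B)) :
    Measurable (collisionWeight B) := by
  have h : Measurable fun x : CollisionCoord =>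
      (x.2.2.2, inner ℝ (x.1 : Velocity) (x.2.1 : Velocity)) := by fun_prop
  exact hB.comp h

/-- The squared difference of square roots. -/
noncomputable def sqrtDiff (a b : ℝ) : ℝ≥0∞ := ENNReal.ofReal ((√b - √a) ^ 2)

theorem measurable_sqrtDiff : Measurable (Function.uncurry sqrtDiff) := by
  unfold sqrtDiff Function.uncurry; fun_prop

theorem measurable_preCollision {n : ℕ} : Measurable (preCollision (n := n)) :=
  measurable_snd.comp (measurePreserving_preCollision n).measurable

theorem measurable_postCollision {n : ℕ} : Measurable (postCollision (n := n)) :=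
  measurable_snd.comp (measurePreserving_postCollision n).measurable

/-- The entropy production of a density in the coordinates `((σ, σ', z, r), w)`. -/
noncomputable def production (b : CollisionCoord → ℝ≥0∞) {n : ℕ} (f : Config (n + 2) → ℝ) :
    ℝ≥0∞ :=
  ∫⁻ p : CollisionCoord × Config n,
    sqrtDiff (f (preCollision p)) (f (postCollision p)) * b p.1 ∂(collisionMeasure.prod volume)

theorem measurable_production_integrand {b : CollisionCoord → ℝ≥0∞} (hb : Measurable b) {n : ℕ}
    {f : Config (n + 2) → ℝ} (hf : Measurable f) :
    Measurable fun p : CollisionCoord × Config n =>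
      sqrtDiff (f (preCollision p)) (f (postCollision p)) * b p.1 :=
  (measurable_sqrtDiff.comp ((hf.comp measurable_preCollision).prodMk
    (hf.comp measurable_postCollision))).mul (hb.comp measurable_fst)

theorem densityEntropyProduction_eq {B : ℝ → ℝ → ℝ≥0∞} (hB : Measurable (Function.uncurry B))
    {n : ℕ} {f : Config (n + 2) → ℝ} (hf : Measurable f) :
    densityEntropyProduction B f = production (collisionWeight B) f := by
  have s1 : SFinite (radialMeasure.prod (volume : Measure (Config n))) := inferInstance
  have s2 : SFinite ((volume : Measure Velocity).prod radialMeasure) := inferInstance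
  have s3 : SFinite ((volume : Measure Velocity).prod
    (radialMeasure.prod (volume : Measure (Config n)))) := inferInstance
  have h1 := measurePreserving_prodAssoc sphereMeasure pairMeasure (volume : Measure (Config n))
  have h2 := (MeasurePreserving.id sphereMeasure).prod (measurePreserving_prodAssoc sphereMeasure
    ((volume : Measure Velocity).prod radialMeasure) (volume : Measure (Config n)))
  have h3 := (MeasurePreserving.id sphereMeasure).prod ((MeasurePreserving.id sphereMeasure).prod
    (measurePreserving_prodAssoc (volume : Measure Velocity) radialMeasure
      (volume : Measure (Config n))))
  have hmp := (h3.comp h2).comp h1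
  have hw : sphereMeasure.prod (sphereMeasure.prod ((volume : Measure Velocity).prod
      (radialMeasure.prod (volume : Measure (Config n))))) =
      (sphereMeasure.prod (sphereMeasure.prod ((volume : Measure Velocity).prod
        (((volume : Measure ℝ).restrict (Ioi 0)).prod (volume : Measure (Config n)))))).withDensity
        (fun p => ENNReal.ofReal (8 * p.2.2.2.1 ^ 2)) := by
    rw [radialMeasure, prod_withDensity_left (by fun_prop), prod_withDensity_right (by fun_prop),
      prod_withDensity_right (by fun_prop), prod_withDensity_right (by fun_prop)]
  let e : Sphere × Sphere × Velocity × ℝ × Config n → CollisionCoord × Config n :=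
    fun p => ((p.1, p.2.1, p.2.2.1, p.2.2.2.1), p.2.2.2.2)
  have he : Measurable e := by fun_prop
  have hg : Measurable fun p => sqrtDiff (f (preCollision (e p))) (f (postCollision (e p))) *
      collisionWeight B (e p).1 :=
    (measurable_production_integrand (measurable_collisionWeight hB) hf).comp he
  have key : production (collisionWeight B) f = ∫⁻ p,
      sqrtDiff (f (preCollision (e p))) (f (postCollision (e p))) * collisionWeight B (e p).1
        ∂(sphereMeasure.prod (sphereMeasure.prod ((volume : Measure Velocity).prod
      (radialMeasure.prod (volume : Measure (Config n)))))) := by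
    rw [production, ← hmp.lintegral_comp hg]
    rfl
  rw [key, hw, lintegral_withDensity_eq_lintegral_mul _ (by fun_prop) hg]
  refine lintegral_congr fun p => ?_
  rw [Pi.mul_apply, mul_comm]
  rfl

theorem quasiMeasurePreserving_preCollision (n : ℕ) :
    Measure.QuasiMeasurePreserving (preCollision (n := n)) (collisionMeasure.prod volume) volume :=
  Measure.quasiMeasurePreserving_snd.comp
    (measurePreserving_preCollision n).quasiMeasurePreserving

theorem quasiMeasurePreserving_postCollision (n : ℕ) :
    Measure.QuasiMeasurePreserving (postCollision (n := n)) (collisionMeasure.prod volume) volume :=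
  Measure.quasiMeasurePreserving_snd.comp
    (measurePreserving_postCollision n).quasiMeasurePreserving

theorem production_congr (b : CollisionCoord → ℝ≥0∞) {n : ℕ} {f g : Config (n + 2) → ℝ}
    (h : f =ᵐ[volume] g) : production b f = production b g := by
  refine lintegral_congr_ae ?_
  filter_upwards [(quasiMeasurePreserving_preCollision n).ae h,
    (quasiMeasurePreserving_postCollision n).ae h] with p h1 h2
  rw [h1, h2]

theorem measurable_density {N : ℕ} (F : Measure (Config N)) : Measurable (density F) :=
  (Measure.measurable_rnDeriv F volume).ennreal_toReal

theorem entropyProduction_eq {B : ℝ → ℝ → ℝ≥0∞} (hB : Measurable (Function.uncurry B)) {n : ℕ}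
    {F : Measure (Config (n + 2))} (hF : F ≪ volume) :
    entropyProduction B F = production (collisionWeight B) (density F) := by
  rw [entropyProduction, if_pos hF, densityEntropyProduction_eq hB (measurable_density F)]

theorem entropyProduction_withDensity {B : ℝ → ℝ → ℝ≥0∞} (hB : Measurable (Function.uncurry B))
    {n : ℕ} {f : Config (n + 2) → ℝ≥0∞} (hf : Measurable f) :
    entropyProduction B (volume.withDensity f) =
      production (collisionWeight B) fun v => (f v).toReal := by
  rw [entropyProduction_eq hB (withDensity_absolutelyContinuous _ _)]
  refine production_congr _ ?_
  filter_upwards [Measure.rnDeriv_withDensity (volume : Measure (Config (n + 2))) hf] with v hv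
  rw [density, hv]

/-! ### Reduction to kernels lower semicontinuous on the whole plane -/

/-- The kernel continued from `[0,∞) × [-1,1]` to the plane by projection. -/
noncomputable def extendKernel (B : ℝ → ℝ → ℝ≥0∞) (r c : ℝ) : ℝ≥0∞ :=
  B (max r 0) (max (-1) (min 1 c))

theorem lowerSemicontinuous_extendKernel {B : ℝ → ℝ → ℝ≥0∞}
    (hB : LowerSemicontinuousOn (Function.uncurry B) (Ici (0 : ℝ) ×ˢ Icc (-1 : ℝ) 1)) :
    LowerSemicontinuous (Function.uncurry (extendKernel B)) := by
  have h : Continuous fun p : ℝ × ℝ => (max p.1 0, max (-1) (min 1 p.2)) := by fun_prop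
  rw [← lowerSemicontinuousOn_univ_iff]
  exact hB.comp h.continuousOn fun p _ => by
    simp only [mem_prod, mem_Ici, mem_Icc]
    exact ⟨le_max_right _ _, le_max_left _ _, max_le (by norm_num) (min_le_left _ _)⟩

/-- Almost every `r` is positive and unit vectors have inner product in `[-1, 1]`, where the
projection is the identity. Hence the results need only be proved for kernels defined, and
semicontinuous or measurable, on the plane. -/
theorem densityEntropyProduction_extendKernel (B : ℝ → ℝ → ℝ≥0∞) {n : ℕ}
    (f : Config (n + 2) → ℝ) :
    densityEntropyProduction (extendKernel B) f = densityEntropyProduction B f := by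
  have hr : ∀ᵐ p : Sphere × Sphere × Velocity × ℝ × Config n ∂(sphereMeasure.prod
      (sphereMeasure.prod ((volume : Measure Velocity).prod
      (((volume : Measure ℝ).restrict (Ioi 0)).prod (volume : Measure (Config n)))))),
      0 < p.2.2.2.1 := by
    have h0 : ∀ᵐ r ∂((volume : Measure ℝ).restrict (Ioi 0)), 0 < r := ae_restrict_mem measurableSet_Ioi
    exact (((Measure.quasiMeasurePreserving_fst.comp Measure.quasiMeasurePreserving_snd).comp
      Measure.quasiMeasurePreserving_snd).comp Measure.quasiMeasurePreserving_snd).ae h0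
  refine lintegral_congr_ae ?_
  filter_upwards [hr] with ⟨σ, σ', z, r, w⟩ h
  have hc := abs_le.1 (abs_real_inner_le_norm (σ : Velocity) (σ' : Velocity))
  simp only [norm_eq_of_mem_sphere, mul_one] at hc
  simp only [extendKernel]
  rw [max_eq_left (le_of_lt h), min_eq_right hc.2, max_eq_right hc.1]

theorem entropyProduction_extendKernel (B : ℝ → ℝ → ℝ≥0∞) {n : ℕ}
    (F : Measure (Config (n + 2))) :
    entropyProduction (extendKernel B) F = entropyProduction B F := by
  simp only [entropyProduction, densityEntropyProduction_extendKernel]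

/-! ### Duality for the squared difference of square roots -/

/-- The function `e^u a + e^{-u} b`, dual to `sqrtDiff a b`. -/
noncomputable def expPair (u a b : ℝ) : ℝ≥0∞ := ENNReal.ofReal (Real.exp u * a + Real.exp (-u) * b)

theorem measurable_expPair {Ω : Type*} [MeasurableSpace Ω] {u a b : Ω → ℝ} (hu : Measurable u)
    (ha : Measurable a) (hb : Measurable b) : Measurable fun x => expPair (u x) (a x) (b x) := by
  unfold expPair; fun_prop

theorem measurable_sqrtDiff_comp {Ω : Type*} [MeasurableSpace Ω] {a b : Ω → ℝ}
    (ha : Measurable a) (hb : Measurable b) : Measurable fun x => sqrtDiff (a x) (b x) := by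
  unfold sqrtDiff; fun_prop

/-- This is `e^u a + e^{-u} b ≥ 2 √a √b`, the easy half of the duality. It is written additively
because subtraction in `[0,∞]` truncates. -/
theorem ofReal_add_le_sqrtDiff_add_expPair (u : ℝ) {a b : ℝ} (ha : 0 ≤ a) (hb : 0 ≤ b) :
    ENNReal.ofReal (a + b) ≤ sqrtDiff a b + expPair u a b := by
  rw [sqrtDiff, expPair, ← ENNReal.ofReal_add (by positivity) (by positivity)]
  refine ENNReal.ofReal_le_ofReal ?_
  have h1 := Real.sq_sqrt ha
  have h2 := Real.sq_sqrt hb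
  have h3 : Real.exp (u / 2) ^ 2 = Real.exp u := by rw [← Real.exp_nat_mul]; congr 1; push_cast; ring
  have h4 : Real.exp (-u / 2) ^ 2 = Real.exp (-u) := by
    rw [← Real.exp_nat_mul]; congr 1; push_cast; ring
  have h5 : Real.exp (u / 2) * Real.exp (-u / 2) = 1 := by
    rw [← Real.exp_add, ← Real.exp_zero]; congr 1; ring
  have h6 := sq_nonneg (Real.exp (u / 2) * √a - Real.exp (-u / 2) * √b)
  have h7 : (Real.exp (u / 2) * √a - Real.exp (-u / 2) * √b) ^ 2 =
      Real.exp u * a + Real.exp (-u) * b - 2 * (√a * √b) := by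
    rw [← h3, ← h4]
    linear_combination (Real.exp (u / 2) ^ 2) * h1 + (Real.exp (-u / 2) ^ 2) * h2
      - 2 * √a * √b * h5
  nlinarith

/-- The near-optimal dual variable. -/
noncomputable def dualVar (ε a b : ℝ) : ℝ :=
  Real.log √(b + ε * (a + b)) - Real.log √(a + ε * (a + b))

theorem measurable_dualVar (ε : ℝ) {Ω : Type*} [MeasurableSpace Ω] {a b : Ω → ℝ}
    (ha : Measurable a) (hb : Measurable b) : Measurable fun x => dualVar ε (a x) (b x) := by
  unfold dualVar; fun_prop

/-- The optimal `u = log √(b/a)` degenerates when `a` or `b` vanishes. With `t = ε (a + b)`, `p² = a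
+ t` and `q² = b + t`, the choice `u = log (q/p)` is exactly optimal for `(p², q²)`. Returning to
`(a, b)` removes `t (q/p + p/q) ≥ 2t`, which pays for the excess `2t` of `p² + q²` over `a + b`. -/
theorem expPair_dualVar_add_sqrtDiff_le {ε a b : ℝ} (hε : 0 < ε) (ha : 0 ≤ a) (hb : 0 ≤ b) :
    expPair (dualVar ε a b) a b + sqrtDiff (a + ε * (a + b)) (b + ε * (a + b)) ≤
      ENNReal.ofReal (a + b) := by
  rw [sqrtDiff, expPair, ← ENNReal.ofReal_add (by positivity) (by positivity)]
  refine ENNReal.ofReal_le_ofReal ?_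
  rcases (add_nonneg ha hb).eq_or_lt with hs | hs
  · have ha' : a = 0 := by linarith
    have hb' : b = 0 := by linarith
    simp [ha', hb']
  set t := ε * (a + b) with ht
  have ht0 : 0 < t := by positivity
  have hp : 0 < √(a + t) := by positivity
  have hq : 0 < √(b + t) := by positivity
  have hp2 := Real.sq_sqrt (by positivity : 0 ≤ a + t)
  have hq2 := Real.sq_sqrt (by positivity : 0 ≤ b + t)
  rw [dualVar, ← ht, neg_sub, Real.exp_sub, Real.exp_sub, Real.exp_log hp, Real.exp_log hq]
  set p := √(a + t)
  set q := √(b + t)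
  have e1 : a = p ^ 2 - t := by linarith
  have e2 : b = q ^ 2 - t := by linarith
  have h2 : 2 ≤ q / p + p / q := by
    rw [div_add_div _ _ hp.ne' hq.ne', le_div_iff₀ (by positivity)]
    nlinarith [sq_nonneg (p - q)]
  have e3 : q / p * a + p / q * b = 2 * (p * q) - t * (q / p + p / q) := by
    rw [e1, e2]; field_simp; ring
  rw [e3]
  nlinarith

/-- Both shifted values lie between `ε (a + b)` and `(1 + ε) (a + b)`, so the scale `a + b` cancels
in the difference of logarithms. -/
theorem exists_abs_dualVar_le {ε : ℝ} (hε : 0 < ε) :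
    ∃ K : ℝ, 0 ≤ K ∧ ∀ a b : ℝ, 0 ≤ a → 0 ≤ b → |dualVar ε a b| ≤ K := by
  have key : ∀ a b : ℝ, 0 ≤ a → 0 ≤ b → 0 < a + b →
      dualVar ε a b ≤ Real.log √(1 + ε) - Real.log √ε := by
    intro a b ha hb hs
    have h1 : Real.log √(b + ε * (a + b)) ≤ Real.log √(1 + ε) + Real.log √(a + b) := by
      rw [← Real.log_mul (by positivity) (by positivity), ← Real.sqrt_mul (by positivity)]
      refine Real.log_le_log (by positivity) (Real.sqrt_le_sqrt ?_)
      nlinarith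
    have h2 : Real.log √ε + Real.log √(a + b) ≤ Real.log √(a + ε * (a + b)) := by
      rw [← Real.log_mul (by positivity) (by positivity), ← Real.sqrt_mul (by positivity)]
      refine Real.log_le_log (by positivity) (Real.sqrt_le_sqrt ?_)
      nlinarith
    rw [dualVar]
    linarith
  have hanti : ∀ a b : ℝ, dualVar ε a b = - dualVar ε b a := by
    intro a b; simp only [dualVar, add_comm b a]; ring
  have hK : 0 ≤ Real.log √(1 + ε) - Real.log √ε := by
    have := Real.log_le_log (by positivity : 0 < √ε)
      (Real.sqrt_le_sqrt (by linarith : ε ≤ 1 + ε))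
    linarith
  refine ⟨_, hK, fun a b ha hb => ?_⟩
  rcases (add_nonneg ha hb).eq_or_lt with hs | hs
  · have ha' : a = 0 := by linarith
    have hb' : b = 0 := by linarith
    simpa [ha', hb', dualVar] using hK
  · refine abs_le.2 ⟨?_, key a b ha hb hs⟩
    rw [hanti]
    exact neg_le_neg (key b a hb ha (by linarith))

/-- The tangent to the exponential at `v` lies below its graph, so the error involves only `e^v ≤
e^K` and `u` needs no bound. This measures the cost of replacing a dual variable in `L¹` with weight
`a + b`. -/
theorem expPair_le_add {K u v a b : ℝ} (hv : |v| ≤ K) (ha : 0 ≤ a) (hb : 0 ≤ b) :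
    expPair v a b ≤ expPair u a b +
      ENNReal.ofReal (Real.exp K) * (ENNReal.ofReal (a + b) * ENNReal.ofReal |u - v|) := by
  rw [expPair, expPair, ← ENNReal.ofReal_mul (by positivity), ← ENNReal.ofReal_mul (by positivity),
    ← ENNReal.ofReal_add (by positivity) (by positivity)]
  refine ENNReal.ofReal_le_ofReal ?_
  have key : ∀ x y : ℝ, |y| ≤ K → Real.exp y ≤ Real.exp x + Real.exp K * |x - y| := by
    intro x y hy
    have h1 : Real.exp y * (x - y + 1) ≤ Real.exp x := by
      have := mul_le_mul_of_nonneg_left (Real.add_one_le_exp (x - y)) (Real.exp_pos y).le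
      rwa [← Real.exp_add, add_sub_cancel] at this
    have h2 : Real.exp y ≤ Real.exp K := Real.exp_le_exp.2 (le_of_abs_le hy)
    have h3 : Real.exp y * (y - x) ≤ Real.exp K * |x - y| := by
      refine (mul_le_mul_of_nonneg_left ((le_abs_self _).trans_eq (abs_sub_comm y x))
        (Real.exp_pos y).le).trans ?_
      gcongr
    nlinarith
  have h1 := mul_le_mul_of_nonneg_right (key u v hv) ha
  have h2 := mul_le_mul_of_nonneg_right (key (-u) (-v) (by rwa [abs_neg])) hb
  have h3 : |-u - -v| = |u - v| := by rw [abs_sub_comm]; congr 1; ring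
  rw [h3] at h2
  nlinarith

section Duality

variable {Ω : Type*} [MeasurableSpace Ω] {μ : Measure Ω} {a b : Ω → ℝ}

theorem lintegral_add_le_sqrtDiff_add_expPair (ha : Measurable a) (hb : Measurable b)
    (ha0 : ∀ x, 0 ≤ a x) (hb0 : ∀ x, 0 ≤ b x) (u : Ω → ℝ) :
    ∫⁻ x, ENNReal.ofReal (a x + b x) ∂μ ≤
      ∫⁻ x, sqrtDiff (a x) (b x) ∂μ + ∫⁻ x, expPair (u x) (a x) (b x) ∂μ := by
  rw [← lintegral_add_left (measurable_sqrtDiff_comp ha hb)]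
  exact lintegral_mono fun x => ofReal_add_le_sqrtDiff_add_expPair (u x) (ha0 x) (hb0 x)

theorem tendsto_sqrtDiff_shift (a b : ℝ) :
    Tendsto (fun n : ℕ => sqrtDiff (a + (1 / ((n : ℝ) + 1)) * (a + b))
      (b + (1 / ((n : ℝ) + 1)) * (a + b))) atTop (𝓝 (sqrtDiff a b)) := by
  have hc : Continuous fun t : ℝ => sqrtDiff (a + t * (a + b)) (b + t * (a + b)) := by
    unfold sqrtDiff
    exact ENNReal.continuous_ofReal.comp (by fun_prop)
  have := (hc.tendsto 0).comp tendsto_one_div_add_atTop_nhds_zero_nat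
  simpa [Function.comp_def] using this

/-- The hard half of the duality, with a bounded maximizer: Fatou's lemma as `ε = 1/(n+1)` tends to
`0`, then `dualVar` for a single `n`. Finite total mass allows the strict inequality to survive
adding the `expPair` integral. -/
theorem exists_dual_lt (ha : Measurable a) (hb : Measurable b)
    (ha0 : ∀ x, 0 ≤ a x) (hb0 : ∀ x, 0 ≤ b x)
    (hfin : ∫⁻ x, ENNReal.ofReal (a x + b x) ∂μ ≠ ⊤) {C : ℝ≥0∞}
    (hC : C < ∫⁻ x, sqrtDiff (a x) (b x) ∂μ) :
    ∃ (K : ℝ) (u : Ω → ℝ), 0 ≤ K ∧ Measurable u ∧ (∀ x, |u x| ≤ K) ∧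
      C + ∫⁻ x, expPair (u x) (a x) (b x) ∂μ < ∫⁻ x, ENNReal.ofReal (a x + b x) ∂μ := by
  have hF : ∫⁻ x, sqrtDiff (a x) (b x) ∂μ ≤ liminf (fun n : ℕ =>
      ∫⁻ x, sqrtDiff (a x + (1 / ((n : ℝ) + 1)) * (a x + b x))
        (b x + (1 / ((n : ℝ) + 1)) * (a x + b x)) ∂μ) atTop := by
    refine le_trans (lintegral_mono fun x => ?_) (lintegral_liminf_le fun n =>
      measurable_sqrtDiff_comp (by fun_prop) (by fun_prop))
    exact (tendsto_sqrtDiff_shift (a x) (b x)).liminf_eq.ge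
  obtain ⟨n, hn⟩ := (eventually_lt_of_lt_liminf (hC.trans_le hF)).exists
  have hε : (0 : ℝ) < 1 / ((n : ℝ) + 1) := Nat.one_div_pos_of_nat
  obtain ⟨K, hK, hKb⟩ := exists_abs_dualVar_le hε
  refine ⟨K, fun x => dualVar (1 / ((n : ℝ) + 1)) (a x) (b x), hK, measurable_dualVar _ ha hb,
    fun x => hKb _ _ (ha0 x) (hb0 x), ?_⟩
  have hle := lintegral_mono (μ := μ) fun x =>
    expPair_dualVar_add_sqrtDiff_le hε (ha0 x) (hb0 x)
  rw [lintegral_add_left (measurable_expPair (measurable_dualVar _ ha hb) ha hb)] at hle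
  have hfin' := ne_top_of_le_ne_top hfin (le_self_add.trans hle)
  refine lt_of_lt_of_le ?_ hle
  rw [add_comm C]
  exact ENNReal.add_lt_add_left hfin' hn

/-- Jensen's inequality for a supremum of linear functions: take a constant `u` that is nearly
optimal for the integrated pair `(A, B)`, integrate the pointwise inequality for this `u`, and let
`ε` tend to `0`. -/
theorem sqrtDiff_lintegral_le (ha : Measurable a) (hb : Measurable b)
    (ha0 : ∀ x, 0 ≤ a x) (hb0 : ∀ x, 0 ≤ b x)
    (hfa : ∫⁻ x, ENNReal.ofReal (a x) ∂μ ≠ ⊤) (hfb : ∫⁻ x, ENNReal.ofReal (b x) ∂μ ≠ ⊤) :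
    sqrtDiff (∫⁻ x, ENNReal.ofReal (a x) ∂μ).toReal (∫⁻ x, ENNReal.ofReal (b x) ∂μ).toReal ≤
      ∫⁻ x, sqrtDiff (a x) (b x) ∂μ := by
  set A := (∫⁻ x, ENNReal.ofReal (a x) ∂μ).toReal with hA
  set B := (∫⁻ x, ENNReal.ofReal (b x) ∂μ).toReal with hB
  have hA0 : 0 ≤ A := ENNReal.toReal_nonneg
  have hB0 : 0 ≤ B := ENNReal.toReal_nonneg
  have eA : ∫⁻ x, ENNReal.ofReal (a x) ∂μ = ENNReal.ofReal A := (ENNReal.ofReal_toReal hfa).symm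
  have eB : ∫⁻ x, ENNReal.ofReal (b x) ∂μ = ENNReal.ofReal B := (ENNReal.ofReal_toReal hfb).symm
  have lin : ∀ c d : ℝ, 0 ≤ c → 0 ≤ d →
      ∫⁻ x, ENNReal.ofReal (c * a x + d * b x) ∂μ = ENNReal.ofReal (c * A + d * B) := by
    intro c d hc hd
    have : ∀ x, ENNReal.ofReal (c * a x + d * b x) =
        ENNReal.ofReal c * ENNReal.ofReal (a x) + ENNReal.ofReal d * ENNReal.ofReal (b x) := by
      intro x
      have := ha0 x
      have := hb0 x
      rw [ENNReal.ofReal_add (by positivity) (by positivity), ENNReal.ofReal_mul hc,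
        ENNReal.ofReal_mul hd]
    simp_rw [this]
    rw [lintegral_add_left (by fun_prop), lintegral_const_mul _ (by fun_prop),
      lintegral_const_mul _ (by fun_prop), eA, eB, ENNReal.ofReal_add (by positivity)
      (by positivity), ENNReal.ofReal_mul hc, ENNReal.ofReal_mul hd]
  refine le_of_tendsto' (tendsto_sqrtDiff_shift A B) fun n => ?_
  have hε : (0 : ℝ) < 1 / ((n : ℝ) + 1) := Nat.one_div_pos_of_nat
  set u := dualVar (1 / ((n : ℝ) + 1)) A B
  have h1 := expPair_dualVar_add_sqrtDiff_le hε hA0 hB0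
  have h2 := lintegral_add_le_sqrtDiff_add_expPair (μ := μ) ha hb ha0 hb0 fun _ => u
  have h3 : ∫⁻ x, expPair u (a x) (b x) ∂μ = expPair u A B :=
    lin _ _ (Real.exp_pos _).le (Real.exp_pos _).le
  have h4 : ∫⁻ x, ENNReal.ofReal (a x + b x) ∂μ = ENNReal.ofReal (A + B) := by
    simpa using lin 1 1 zero_le_one zero_le_one
  rw [h3, h4, add_comm (∫⁻ x, sqrtDiff (a x) (b x) ∂μ)] at h2
  exact (ENNReal.add_le_add_iff_left (by simp [expPair])).1 (h1.trans h2)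

end Duality

theorem sqrtDiff_mul {c : ℝ} (hc : 0 ≤ c) (a b : ℝ) :
    sqrtDiff (c * a) (c * b) = ENNReal.ofReal c * sqrtDiff a b := by
  rw [sqrtDiff, sqrtDiff, ← ENNReal.ofReal_mul hc, Real.sqrt_mul hc, Real.sqrt_mul hc]
  congr 1
  have := Real.sq_sqrt hc
  linear_combination (√b - √a) ^ 2 * this

/-! ### Approximation of the kernel from below by continuous kernels -/

section LowerSemicontinuous

variable {E : Type*} [PseudoMetricSpace E] {b : E → ℝ≥0∞}

/-- The `k`-Lipschitz regularization of `min b k`. -/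
noncomputable def lipschitzRegularization (b : E → ℝ≥0∞) (k : ℕ) (x : E) : ℝ≥0∞ :=
  ⨅ y, (min (b y) k + k * edist x y)

theorem lipschitzRegularization_le (b : E → ℝ≥0∞) (k : ℕ) (x : E) :
    lipschitzRegularization b k x ≤ min (b x) k :=
  (iInf_le _ x).trans (by simp)

theorem lipschitzRegularization_ne_top (b : E → ℝ≥0∞) (k : ℕ) (x : E) :
    lipschitzRegularization b k x ≠ ⊤ :=
  ne_top_of_le_ne_top (ENNReal.natCast_ne_top k)
    ((lipschitzRegularization_le b k x).trans (min_le_right _ _))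

theorem continuous_lipschitzRegularization (b : E → ℝ≥0∞) (k : ℕ) :
    Continuous fun x => (lipschitzRegularization b k x).toReal := by
  refine (LipschitzWith.of_le_add_mul (K := (k : ℝ≥0)) ?_).continuous
  intro x y
  have h : lipschitzRegularization b k x ≤ lipschitzRegularization b k y + k * edist x y := by
    rw [lipschitzRegularization, lipschitzRegularization, ENNReal.iInf_add]
    refine iInf_mono fun z => ?_
    rw [add_assoc, ← mul_add]
    gcongr
    rw [add_comm]
    exact edist_triangle x y z
  have hfin : (k : ℝ≥0∞) * edist x y ≠ ⊤ :=
    ENNReal.mul_ne_top (ENNReal.natCast_ne_top k) (edist_ne_top x y)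
  have := ENNReal.toReal_mono
    (ENNReal.add_ne_top.2 ⟨lipschitzRegularization_ne_top b k y, hfin⟩) h
  rw [ENNReal.toReal_add (lipschitzRegularization_ne_top b k y) hfin, ENNReal.toReal_mul] at this
  simpa [dist_edist] using this

/-- In a ball of radius `δ` around `x` semicontinuity keeps `b` above `c`; outside it the penalty is
at least `k δ`, which exceeds `c` for large `k`. -/
theorem eventually_le_lipschitzRegularization (hb : LowerSemicontinuous b) {x : E} {c : ℝ≥0∞}
    (hc : c < b x) : ∀ᶠ k : ℕ in atTop, c ≤ lipschitzRegularization b k x := by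
  obtain ⟨δ, hδ, hball⟩ := Metric.eventually_nhds_iff.1 (hb x c hc)
  have hctop : c ≠ ⊤ := hc.ne_top
  have h1 : ∀ᶠ k : ℕ in atTop, c.toReal ≤ k := tendsto_natCast_atTop_atTop.eventually_ge_atTop _
  have h2 : ∀ᶠ k : ℕ in atTop, c.toReal / δ ≤ k := tendsto_natCast_atTop_atTop.eventually_ge_atTop _
  filter_upwards [h1, h2] with k hk1 hk2
  have hk1' : c ≤ k := by
    rw [← ENNReal.ofReal_toReal hctop, ← ENNReal.ofReal_natCast]
    exact ENNReal.ofReal_le_ofReal hk1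
  refine le_iInf fun y => ?_
  by_cases hy : dist y x < δ
  · exact (le_min (hball hy).le hk1').trans le_self_add
  · refine le_trans ?_ le_add_self
    rw [← ENNReal.ofReal_toReal hctop, ← ENNReal.ofReal_natCast, edist_dist,
      ← ENNReal.ofReal_mul (by positivity)]
    refine ENNReal.ofReal_le_ofReal ?_
    rw [div_le_iff₀ hδ] at hk2
    refine hk2.trans ?_
    rw [dist_comm]
    gcongr
    exact not_lt.1 hy

end LowerSemicontinuous

/-- The Lipschitz regularization is multiplied by a cutoff in `r`, equal to `0` for `r ≤ 1/k` and to
`1` for `r ≥ 2/k`. Vanishing near `r = 0` keeps test functions continuous across `v₁ = v₂`, where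
the collision direction is undefined. -/
theorem exists_continuous_approx_kernel {B : ℝ → ℝ → ℝ≥0∞}
    (hB : LowerSemicontinuous (Function.uncurry B)) :
    ∃ β : ℕ → ℝ × ℝ → ℝ, (∀ k, Continuous (β k)) ∧ (∀ k x, 0 ≤ β k x) ∧ (∀ k x, β k x ≤ k) ∧
      (∀ k x, ENNReal.ofReal (β k x) ≤ Function.uncurry B x) ∧
      (∀ k, ∃ δ > 0, ∀ x : ℝ × ℝ, x.1 < δ → β k x = 0) ∧
      ∀ x : ℝ × ℝ, 0 < x.1 →
        Function.uncurry B x ≤ liminf (fun k => ENNReal.ofReal (β k x)) atTop := by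
  set b := Function.uncurry B
  let χ : ℕ → ℝ → ℝ := fun k r => min 1 (max 0 (k * r - 1))
  have hχ0 : ∀ k r, 0 ≤ χ k r := fun k r => le_min zero_le_one (le_max_left _ _)
  have hχ1 : ∀ k r, χ k r ≤ 1 := fun k r => min_le_left _ _
  let β : ℕ → ℝ × ℝ → ℝ := fun k x => (lipschitzRegularization b k x).toReal * χ k x.1
  have hβle : ∀ k x, β k x ≤ (lipschitzRegularization b k x).toReal := fun k x =>
    mul_le_of_le_one_right ENNReal.toReal_nonneg (hχ1 k _)
  refine ⟨β, fun k => ?_, fun k x => mul_nonneg ENNReal.toReal_nonneg (hχ0 k _), fun k x => ?_,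
    fun k x => ?_, fun k => ?_, fun x hx => ?_⟩
  · exact (continuous_lipschitzRegularization b k).mul (by fun_prop)
  · refine (hβle k x).trans ?_
    have := ENNReal.toReal_mono (ENNReal.natCast_ne_top k)
      ((lipschitzRegularization_le b k x).trans (min_le_right _ _))
    simpa using this
  · refine (ENNReal.ofReal_le_ofReal (hβle k x)).trans ?_
    rw [ENNReal.ofReal_toReal (lipschitzRegularization_ne_top b k x)]
    exact (lipschitzRegularization_le b k x).trans (min_le_left _ _)
  -- The radius `1/(k+1)` instead of `1/k` covers `k = 0`.
  · refine ⟨1 / ((k : ℝ) + 1), Nat.one_div_pos_of_nat, fun x hx => ?_⟩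
    have : (k : ℝ) * x.1 - 1 ≤ 0 := by
      rw [lt_div_iff₀ (by positivity)] at hx
      rcases le_total x.1 0 with h | h
      · nlinarith [(Nat.cast_nonneg k : (0 : ℝ) ≤ k)]
      · nlinarith
    simp [β, χ, max_eq_left this]
  · refine le_of_forall_lt fun c hc => ?_
    obtain ⟨c', hcc', hc'⟩ := exists_between hc
    refine hcc'.trans_le (le_liminf_of_le (by isBoundedDefault) ?_)
    have h1 : ∀ᶠ k : ℕ in atTop, 2 / x.1 ≤ k := tendsto_natCast_atTop_atTop.eventually_ge_atTop _
    filter_upwards [eventually_le_lipschitzRegularization hB hc', h1] with k hk hk1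
    rw [div_le_iff₀ hx] at hk1
    have : χ k x.1 = 1 := by
      refine min_eq_left (le_max_of_le_right (by linarith))
    simp only [β, this, mul_one]
    rwa [ENNReal.ofReal_toReal (lipschitzRegularization_ne_top b k x)]

/-! ### Inverse collision coordinates and weak continuity of the dual functionals -/

/-- The direction `(v₁ - v₂) / |v₁ - v₂|`, with a fixed value on the diagonal. -/
noncomputable def direction (y : Velocity) : Sphere :=
  if h : y = 0 then ⟨EuclideanSpace.single 0 1, by simp⟩
  else ⟨‖y‖⁻¹ • y, by simp [norm_smul, h]⟩

theorem continuousAt_direction {y : Velocity} (hy : y ≠ 0) : ContinuousAt direction y := by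
  refine Topology.IsInducing.subtypeVal.continuousAt_iff.2 ?_
  have h : ContinuousAt (fun x : Velocity => ‖x‖⁻¹ • x) y :=
    (continuousAt_id.norm.inv₀ (norm_ne_zero_iff.2 hy)).smul continuousAt_id
  refine h.congr ?_
  filter_upwards [isOpen_ne.mem_nhds hy] with x hx
  have hx' : x ≠ 0 := hx
  simp [direction, hx']

theorem measurable_direction : Measurable direction :=
  measurable_of_continuousOn_compl_singleton 0 fun _ hy =>
    (continuousAt_direction hy).continuousWithinAt

theorem direction_smul {r : ℝ} (hr : 0 < r) (σ : Sphere) : direction (r • (σ : Velocity)) = σ := by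
  have h : r • (σ : Velocity) ≠ 0 := by
    rw [← norm_pos_iff, norm_smul]; simp [hr.ne']
  ext1
  rw [direction, dif_neg h]
  simp [norm_smul, abs_of_pos hr, smul_smul, hr.ne']

/-- The inverse of the collision coordinates, with a given outgoing direction `σ'`. -/
noncomputable def collisionCoord {n : ℕ} (σ' : Sphere) (v : Config (n + 2)) :
    CollisionCoord × Config n :=
  ((direction (v 0 - v 1), σ', (2⁻¹ : ℝ) • (v 0 + v 1), 2⁻¹ * ‖v 0 - v 1‖), fun i => v i.succ.succ)

theorem collisionCoord_preCollision {n : ℕ} (p : CollisionCoord × Config n) (hp : 0 < p.1.2.2.2) :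
    collisionCoord p.1.2.1 (preCollision p) = p := by
  obtain ⟨⟨σ, σ', z, r⟩, w⟩ := p
  have h : z + r • (σ : Velocity) - (z - r • (σ : Velocity)) = (2 * r) • (σ : Velocity) := by
    rw [two_mul, add_smul]; abel
  have h2 : z + r • (σ : Velocity) + (z - r • (σ : Velocity)) = (2 : ℝ) • z := by
    rw [two_smul]; abel
  have hr : (0 : ℝ) < r := hp
  simp only [collisionCoord, preCollision, consPair, pairPoint, Fin.cons_zero, Fin.cons_one,
    Fin.cons_succ, h, h2]
  rw [direction_smul (by positivity), norm_smul]
  simp [abs_of_pos hr]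

/-- The only discontinuity of the inverse coordinates is the direction at `v₁ = v₂`, and near that
set `r < δ`, so `Φ` vanishes there. -/
theorem continuous_comp_collisionCoord {n : ℕ} {Φ : CollisionCoord × Config n → ℝ}
    (hΦ : Continuous Φ) {δ : ℝ} (hδ : 0 < δ) (hzero : ∀ p, p.1.2.2.2 < δ → Φ p = 0)
    (σ' : Sphere) : Continuous fun v => Φ (collisionCoord σ' v) := by
  refine continuous_iff_continuousAt.2 fun v => ?_
  by_cases hv : v 0 - v 1 = 0
  · have hc : Continuous fun v : Config (n + 2) => 2⁻¹ * ‖v 0 - v 1‖ := by fun_prop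
    have : ∀ᶠ y in 𝓝 v, 2⁻¹ * ‖y 0 - y 1‖ < δ := by
      refine hc.continuousAt.eventually_lt_const ?_
      simpa [hv] using hδ
    refine ContinuousAt.congr (f := fun _ => (0 : ℝ)) continuousAt_const ?_
    filter_upwards [this] with y hy using (hzero _ hy).symm
  · refine hΦ.continuousAt.comp ?_
    have h1 : ContinuousAt (fun v : Config (n + 2) => direction (v 0 - v 1)) v :=
      (continuousAt_direction hv).comp (f := fun v : Config (n + 2) => v 0 - v 1) (by fun_prop)
    have h2 : Continuous fun v : Config (n + 2) =>
        (σ', (2⁻¹ : ℝ) • (v 0 + v 1), 2⁻¹ * ‖v 0 - v 1‖) := by fun_prop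
    have h3 : Continuous fun v : Config (n + 2) => fun i : Fin n => v i.succ.succ := by fun_prop
    exact (h1.prodMk h2.continuousAt).prodMk h3.continuousAt

theorem measurable_collisionCoord {n : ℕ} :
    Measurable fun q : Sphere × Config (n + 2) => collisionCoord q.1 q.2 := by
  have h1 : Measurable fun q : Sphere × Config (n + 2) => direction (q.2 0 - q.2 1) :=
    measurable_direction.comp (by fun_prop)
  unfold collisionCoord
  fun_prop

theorem ae_radius_pos (n : ℕ) :
    ∀ᵐ p : CollisionCoord × Config n ∂(collisionMeasure.prod volume), 0 < p.1.2.2.2 := by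
  have h0 : ∀ᵐ r ∂radialMeasure, 0 < r :=
    (withDensity_absolutelyContinuous _ _).ae_le (ae_restrict_mem measurableSet_Ioi)
  have : SFinite ((volume : Measure Velocity).prod radialMeasure) := inferInstance
  have h1 : ∀ᵐ x ∂collisionMeasure, 0 < x.2.2.2 :=
    ((Measure.quasiMeasurePreserving_snd.comp Measure.quasiMeasurePreserving_snd).comp
      Measure.quasiMeasurePreserving_snd).ae h0
  exact Measure.quasiMeasurePreserving_fst.ae h1

theorem lintegral_ofReal_density_mul {N : ℕ} {F : Measure (Config N)} [IsFiniteMeasure F]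
    (hF : F ≪ volume) {g : Config N → ℝ≥0∞} (hg : Measurable g) :
    ∫⁻ v, ENNReal.ofReal (density F v) * g v = ∫⁻ v, g v ∂F := by
  conv_rhs => rw [← Measure.withDensity_rnDeriv_eq F volume hF]
  rw [lintegral_withDensity_eq_lintegral_mul _ (Measure.measurable_rnDeriv _ _) hg]
  refine lintegral_congr_ae ?_
  filter_upwards [Measure.rnDeriv_ne_top F volume] with v hv
  simp [density, ENNReal.ofReal_toReal hv]

/-- Undoing the change of variables turns an integral involving the density of `F` into one against
the measure `F`, with the free direction `σ'` averaged. In this form weak convergence applies. -/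
theorem lintegral_density_preCollision_mul {n : ℕ} {F : Measure (Config (n + 2))}
    [IsFiniteMeasure F] (hF : F ≪ volume) {Φ : CollisionCoord × Config n → ℝ≥0∞}
    (hΦ : Measurable Φ) :
    ∫⁻ p, ENNReal.ofReal (density F (preCollision p)) * Φ p ∂(collisionMeasure.prod volume) =
      ∫⁻ v, ∫⁻ σ', Φ (collisionCoord σ' v) ∂sphereMeasure ∂F := by
  have hΦ' : Measurable fun q : Sphere × Config (n + 2) => Φ (collisionCoord q.1 q.2) :=
    hΦ.comp measurable_collisionCoord
  have hd : Measurable fun q : Sphere × Config (n + 2) => density F q.2 :=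
    (measurable_density F).comp measurable_snd
  have hh : Measurable fun q : Sphere × Config (n + 2) =>
      ENNReal.ofReal (density F q.2) * Φ (collisionCoord q.1 q.2) :=
    hd.ennreal_ofReal.mul hΦ'
  calc _ = ∫⁻ p : CollisionCoord × Config n, ENNReal.ofReal (density F (preCollision p)) *
        Φ (collisionCoord p.1.2.1 (preCollision p)) ∂(collisionMeasure.prod volume) := by
        refine lintegral_congr_ae ?_
        filter_upwards [ae_radius_pos n] with p hp
        rw [collisionCoord_preCollision p hp]
    _ = ∫⁻ q, ENNReal.ofReal (density F q.2) * Φ (collisionCoord q.1 q.2)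
          ∂(sphereMeasure.prod volume) :=
        (measurePreserving_preCollision n).lintegral_comp hh
    _ = ∫⁻ v, ENNReal.ofReal (density F v) * ∫⁻ σ', Φ (collisionCoord σ' v) ∂sphereMeasure := by
        rw [lintegral_prod_symm _ hh.aemeasurable]
        refine lintegral_congr fun v => ?_
        have hv : Measurable fun σ' => Φ (collisionCoord σ' v) := hΦ'.comp measurable_prodMk_right
        dsimp only
        exact lintegral_const_mul _ hv
    _ = _ := lintegral_ofReal_density_mul hF hΦ'.lintegral_prod_left'

theorem tendsto_lintegral_preCollision {n : ℕ} {F : ℕ → ProbabilityMeasure (Config (n + 2))}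
    {F' : ProbabilityMeasure (Config (n + 2))}
    (hF : ∀ k, (F k : Measure (Config (n + 2))) ≪ volume)
    (hF' : (F' : Measure (Config (n + 2))) ≪ volume) (hlim : Tendsto F atTop (𝓝 F'))
    {Φ : CollisionCoord × Config n → ℝ} (hΦ : Continuous Φ) (hΦ0 : ∀ p, 0 ≤ Φ p) {M : ℝ}
    (hM : ∀ p, Φ p ≤ M) {δ : ℝ} (hδ : 0 < δ) (hzero : ∀ p, p.1.2.2.2 < δ → Φ p = 0) :
    Tendsto (fun k => ∫⁻ p, ENNReal.ofReal (density (F k) (preCollision p)) *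
        ENNReal.ofReal (Φ p) ∂(collisionMeasure.prod volume)) atTop
      (𝓝 (∫⁻ p, ENNReal.ofReal (density F' (preCollision p)) *
        ENNReal.ofReal (Φ p) ∂(collisionMeasure.prod volume))) := by
  have hm : Measurable fun p => ENNReal.ofReal (Φ p) := hΦ.measurable.ennreal_ofReal
  simp_rw [fun k => lintegral_density_preCollision_mul (hF k) hm]
  rw [lintegral_density_preCollision_mul hF' hm]
  have hc := continuous_comp_collisionCoord hΦ hδ hzero
  have hbound : ∀ p, ‖Φ p‖ ≤ M := fun p => by rw [Real.norm_of_nonneg (hΦ0 p)]; exact hM p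
  have hmeas : ∀ v, Measurable fun σ' => Φ (collisionCoord σ' v) := fun v =>
    hΦ.measurable.comp (measurable_collisionCoord.comp (measurable_prodMk_right (y := v)))
  let G : Config (n + 2) → ℝ := fun v => ∫ σ', Φ (collisionCoord σ' v) ∂sphereMeasure
  -- Averaging over `σ'` preserves continuity because `Φ` is bounded and the sphere has finite
  -- measure, so `G` is an admissible test function.
  have hG : Continuous G := continuous_of_dominated
    (fun v => (hmeas v).aestronglyMeasurable)
    (fun v => ae_of_all _ fun σ' => hbound _) (integrable_const M) (ae_of_all _ hc)
  have hG0 : ∀ v, 0 ≤ G v := fun v => integral_nonneg fun σ' => hΦ0 _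
  have hGM : ∀ v, G v ≤ M * sphereMeasure.real univ := fun v =>
    (le_abs_self _).trans (norm_integral_le_of_norm_le_const (ae_of_all _ fun σ' => hbound _))
  have hGeq : ∀ v, ∫⁻ σ', ENNReal.ofReal (Φ (collisionCoord σ' v)) ∂sphereMeasure =
      ((G v).toNNReal : ℝ≥0∞) := fun v => by
    refine (ofReal_integral_eq_lintegral_ofReal ?_ (ae_of_all _ fun σ' => hΦ0 _)).symm
    exact (integrable_const M).mono' (hmeas v).aestronglyMeasurable
      (ae_of_all _ fun σ' => hbound _)
  let Gb : BoundedContinuousFunction (Config (n + 2)) ℝ≥0 :=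
    BoundedContinuousFunction.mkOfBound ⟨fun v => (G v).toNNReal,
      continuous_real_toNNReal.comp hG⟩ (M * sphereMeasure.real univ) fun v w => by
        have h1 := hG0 v
        have h2 := hG0 w
        have h3 := hGM v
        have h4 := hGM w
        simp only [ContinuousMap.coe_mk, NNReal.dist_eq, Real.coe_toNNReal _ h1,
          Real.coe_toNNReal _ h2]
        exact abs_le.2 ⟨by linarith, by linarith⟩
  simp_rw [hGeq]
  exact (ProbabilityMeasure.tendsto_iff_forall_lintegral_tendsto.1 hlim) Gb

theorem lintegral_comp_swapDirections {n : ℕ} {f : Config (n + 2) → ℝ≥0∞}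
    {Φ : CollisionCoord × Config n → ℝ≥0∞} (hf : Measurable f) (hΦ : Measurable Φ) :
    ∫⁻ p, f (preCollision p) * Φ (swapDirections p.1, p.2) ∂(collisionMeasure.prod volume) =
      ∫⁻ p, f (postCollision p) * Φ p ∂(collisionMeasure.prod volume) :=
  (measurePreserving_swapDirections.prod
    (MeasurePreserving.id (volume : Measure (Config n)))).lintegral_comp
    (f := fun p => f (postCollision p) * Φ p)
    ((hf.comp measurable_postCollision).mul hΦ)

theorem continuous_swapDirections : Continuous swapDirections := by
  unfold swapDirections; fun_prop

/-- The value of a continuous kernel. -/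
noncomputable def realWeight (β : ℝ × ℝ → ℝ) (x : CollisionCoord) : ℝ :=
  β (x.2.2.2, inner ℝ (x.1 : Velocity) (x.2.1 : Velocity))

theorem continuous_realWeight {β : ℝ × ℝ → ℝ} (hβ : Continuous β) : Continuous (realWeight β) := by
  unfold realWeight; fun_prop

theorem realWeight_swapDirections (β : ℝ × ℝ → ℝ) (x : CollisionCoord) :
    realWeight β (swapDirections x) = realWeight β x := by
  simp only [realWeight, swapDirections]
  rw [real_inner_comm]

/-- Exchanging `σ` and `σ'` preserves the measure and the kernel, so the post-collisional half is
also an integral of the density at the pre-collisional point, with `u` exchanged. Both halves then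
fall under `tendsto_lintegral_preCollision`. -/
theorem tendsto_lintegral_expPair {n : ℕ} {F : ℕ → ProbabilityMeasure (Config (n + 2))}
    {F' : ProbabilityMeasure (Config (n + 2))}
    (hF : ∀ k, (F k : Measure (Config (n + 2))) ≪ volume)
    (hF' : (F' : Measure (Config (n + 2))) ≪ volume) (hlim : Tendsto F atTop (𝓝 F'))
    {u : CollisionCoord × Config n → ℝ} (hu : Continuous u) {K : ℝ} (huK : ∀ p, |u p| ≤ K)
    {β : ℝ × ℝ → ℝ} (hβ : Continuous β) (hβ0 : ∀ x, 0 ≤ β x) {M : ℝ} (hM : ∀ x, β x ≤ M)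
    {δ : ℝ} (hδ : 0 < δ) (hzero : ∀ x : ℝ × ℝ, x.1 < δ → β x = 0) :
    Tendsto (fun k => ∫⁻ p, expPair (u p) (density (F k) (preCollision p) * realWeight β p.1)
        (density (F k) (postCollision p) * realWeight β p.1) ∂(collisionMeasure.prod volume)) atTop
      (𝓝 (∫⁻ p, expPair (u p) (density F' (preCollision p) * realWeight β p.1)
        (density F' (postCollision p) * realWeight β p.1) ∂(collisionMeasure.prod volume))) := by
  let Φ₁ : CollisionCoord × Config n → ℝ := fun p => Real.exp (u p) * realWeight β p.1
  let Φ₂ : CollisionCoord × Config n → ℝ := fun p =>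
    Real.exp (-u (swapDirections p.1, p.2)) * realWeight β p.1
  have hw := continuous_realWeight hβ
  have hsw := continuous_swapDirections
  have h1 : Continuous Φ₁ := by fun_prop
  have h2 : Continuous Φ₂ := by fun_prop
  have hexp : ∀ (t : ℝ) (x : CollisionCoord), |t| ≤ K →
      Real.exp t * realWeight β x ≤ Real.exp K * M := fun t x ht =>
    mul_le_mul (Real.exp_le_exp.2 (le_of_abs_le ht)) (hM _) (hβ0 _) (Real.exp_pos _).le
  have l1 := tendsto_lintegral_preCollision hF hF' hlim h1
    (fun p => mul_nonneg (Real.exp_pos _).le (hβ0 _)) (fun p => hexp _ p.1 (huK p)) hδ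
    (fun p hp => by simp only [Φ₁, realWeight]; rw [hzero _ hp, mul_zero])
  have l2 := tendsto_lintegral_preCollision hF hF' hlim h2
    (fun p => mul_nonneg (Real.exp_pos _).le (hβ0 _))
    (fun p => hexp _ p.1 (by rw [abs_neg]; exact huK _)) hδ
    (fun p hp => by simp only [Φ₂, realWeight]; rw [hzero _ hp, mul_zero])
  have key : ∀ G : Measure (Config (n + 2)),
      ∫⁻ p, expPair (u p) (density G (preCollision p) * realWeight β p.1)
        (density G (postCollision p) * realWeight β p.1) ∂(collisionMeasure.prod volume) =
      ∫⁻ p, ENNReal.ofReal (density G (preCollision p)) * ENNReal.ofReal (Φ₁ p)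
        ∂(collisionMeasure.prod volume) +
      ∫⁻ p, ENNReal.ofReal (density G (preCollision p)) * ENNReal.ofReal (Φ₂ p)
        ∂(collisionMeasure.prod volume) := by
    intro G
    have hd : Measurable fun v => ENNReal.ofReal (density G v) :=
      (measurable_density G).ennreal_ofReal
    have hg0 : ∀ v, 0 ≤ density G v := fun v => ENNReal.toReal_nonneg
    have hc3 : Continuous fun p : CollisionCoord × Config n =>
        Real.exp (-u p) * realWeight β p.1 := by fun_prop
    have hsw2 := lintegral_comp_swapDirections hd hc3.measurable.ennreal_ofReal
    simp only [realWeight_swapDirections] at hsw2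
    have hm1 : Measurable fun p : CollisionCoord × Config n =>
        ENNReal.ofReal (density G (preCollision p)) * ENNReal.ofReal (Φ₁ p) :=
      (hd.comp measurable_preCollision).mul h1.measurable.ennreal_ofReal
    simp only [Φ₂]
    rw [hsw2, ← lintegral_add_left hm1]
    refine lintegral_congr fun p => ?_
    have hβp : 0 ≤ realWeight β p.1 := hβ0 _
    rw [expPair, ENNReal.ofReal_add (by have := hg0 (preCollision p); positivity)
      (by have := hg0 (postCollision p); positivity),
      ← ENNReal.ofReal_mul (hg0 _), ← ENNReal.ofReal_mul (hg0 _)]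
    simp only [Φ₁]
    congr 2 <;> ring
  simp_rw [key]
  exact l1.add l2

theorem lintegral_density_collision_ne_top {n : ℕ} {F : Measure (Config (n + 2))}
    [IsFiniteMeasure F] (hF : F ≪ volume) {β : ℝ × ℝ → ℝ} (hβ : Continuous β) {M : ℝ}
    (hβ0 : ∀ x, 0 ≤ β x) (hM : ∀ x, β x ≤ M) :
    ∫⁻ p : CollisionCoord × Config n, ENNReal.ofReal (density F (preCollision p) *
      realWeight β p.1 + density F (postCollision p) * realWeight β p.1)
      ∂(collisionMeasure.prod volume) ≠ ⊤ := by
  have hd : Measurable fun v => ENNReal.ofReal (density F v) :=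
    (measurable_density F).ennreal_ofReal
  have hw : Measurable fun p : CollisionCoord × Config n => ENNReal.ofReal (realWeight β p.1) :=
    ((continuous_realWeight hβ).measurable.comp measurable_fst).ennreal_ofReal
  have hg0 : ∀ v, 0 ≤ density F v := fun v => ENNReal.toReal_nonneg
  have h1 : ∫⁻ p : CollisionCoord × Config n, ENNReal.ofReal (density F (preCollision p)) *
      ENNReal.ofReal (realWeight β p.1) ∂(collisionMeasure.prod volume) ≠ ⊤ := by
    rw [lintegral_density_preCollision_mul hF hw]
    refine ne_top_of_le_ne_top (b := ENNReal.ofReal M * sphereMeasure univ * F univ) ?_ ?_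
    · exact ENNReal.mul_ne_top (ENNReal.mul_ne_top ENNReal.ofReal_ne_top (measure_ne_top _ _))
        (measure_ne_top _ _)
    · rw [← lintegral_const]
      refine lintegral_mono fun v => ?_
      rw [← lintegral_const]
      exact lintegral_mono fun σ' => ENNReal.ofReal_le_ofReal (hM _)
  have h2 := lintegral_comp_swapDirections (n := n) hd hw
  simp only [realWeight_swapDirections] at h2
  have h3 : ∀ p : CollisionCoord × Config n, ENNReal.ofReal (density F (preCollision p) *
      realWeight β p.1 + density F (postCollision p) * realWeight β p.1) =
      ENNReal.ofReal (density F (preCollision p)) * ENNReal.ofReal (realWeight β p.1) +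
      ENNReal.ofReal (density F (postCollision p)) * ENNReal.ofReal (realWeight β p.1) := by
    intro p
    have hβp : 0 ≤ realWeight β p.1 := hβ0 _
    rw [ENNReal.ofReal_add (mul_nonneg (hg0 _) hβp) (mul_nonneg (hg0 _) hβp),
      ENNReal.ofReal_mul (hg0 _), ENNReal.ofReal_mul (hg0 _)]
  have hm1 : Measurable fun p : CollisionCoord × Config n =>
      ENNReal.ofReal (density F (preCollision p)) * ENNReal.ofReal (realWeight β p.1) :=
    (hd.comp measurable_preCollision).mul hw
  simp_rw [h3]
  rw [lintegral_add_left hm1, ← h2]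
  exact ENNReal.add_ne_top.2 ⟨h1, h1⟩

/-- The projection of the line to `[-K, K]`. -/
def clamp (K x : ℝ) : ℝ := max (-K) (min K x)

theorem abs_clamp_le {K : ℝ} (hK : 0 ≤ K) (x : ℝ) : |clamp K x| ≤ K :=
  abs_le.2 ⟨le_max_left _ _, max_le (by linarith) (min_le_left _ _)⟩

theorem abs_sub_clamp_le {K u : ℝ} (hu : |u| ≤ K) (x : ℝ) : |u - clamp K x| ≤ |u - x| := by
  obtain ⟨h2, h3⟩ := abs_le.1 hu
  unfold clamp
  rcases le_total K x with hg | hg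
  · rw [min_eq_left hg, max_eq_right (by linarith), abs_of_nonpos (by linarith),
      abs_of_nonpos (by linarith)]
    linarith
  · rw [min_eq_right hg]
    rcases le_total (-K) x with hg' | hg'
    · rw [max_eq_right hg']
    · rw [max_eq_left hg', abs_of_nonneg (by linarith), abs_of_nonneg (by linarith)]
      linarith

/-- Bounded measurable dual variables may be replaced by continuous ones. -/
theorem exists_continuous_dual_lt {Ω : Type*} [TopologicalSpace Ω] [MeasurableSpace Ω]
    [BorelSpace Ω] [TopologicalSpace.PseudoMetrizableSpace Ω] {μ : Measure Ω} {a b : Ω → ℝ}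
    (ha : Measurable a) (hb : Measurable b) (ha0 : ∀ x, 0 ≤ a x) (hb0 : ∀ x, 0 ≤ b x)
    (hfin : ∫⁻ x, ENNReal.ofReal (a x + b x) ∂μ ≠ ⊤) {C : ℝ≥0∞}
    (hC : C < ∫⁻ x, sqrtDiff (a x) (b x) ∂μ) :
    ∃ (K : ℝ) (u : Ω → ℝ), Continuous u ∧ (∀ x, |u x| ≤ K) ∧
      C + ∫⁻ x, expPair (u x) (a x) (b x) ∂μ < ∫⁻ x, ENNReal.ofReal (a x + b x) ∂μ := by
  obtain ⟨K, u, hK, hu, huK, hlt⟩ := exists_dual_lt ha hb ha0 hb0 hfin hC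
  -- The error in `expPair_le_add` carries the weight `a + b`, so the approximation is made in `L¹`
  -- of this finite measure.
  let θ := μ.withDensity fun x => ENNReal.ofReal (a x + b x)
  have : IsFiniteMeasure θ := isFiniteMeasure_withDensity hfin
  have hm : Measurable fun x => ENNReal.ofReal (a x + b x) := by fun_prop
  obtain ⟨η, hη, hηlt⟩ := ENNReal.lt_iff_exists_add_pos_lt.1 hlt
  have hK' : 0 < Real.exp K := Real.exp_pos K
  -- The tolerance `e^{-K} η` cancels the factor `e^K` of `expPair_le_add`.
  have hε : ENNReal.ofReal (Real.exp (-K)) * (η : ℝ≥0∞) ≠ 0 :=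
    mul_ne_zero (by simpa using Real.exp_pos _) (by simpa using hη.ne')
  have hint : Integrable u θ := (integrable_const K).mono' hu.aestronglyMeasurable
    (ae_of_all _ huK)
  obtain ⟨g, hg, -⟩ := hint.exists_boundedContinuous_lintegral_sub_le hε
  -- Clamping restores the bound `K` and, since `|u| ≤ K`, does not increase the distance to `u`.
  let v : Ω → ℝ := fun x => clamp K (g x)
  have hv : Continuous v := by have := g.continuous; unfold v clamp; fun_prop
  have hvK : ∀ x, |v x| ≤ K := fun x => abs_clamp_le hK _
  have hdist : ∀ x, |u x - v x| ≤ |u x - g x| := fun x => abs_sub_clamp_le (huK x) _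
  refine ⟨K, v, hv, hvK, ?_⟩
  refine lt_of_le_of_lt ?_ hηlt
  rw [add_assoc]
  gcongr
  have hum : Measurable fun x => expPair (u x) (a x) (b x) := measurable_expPair hu ha hb
  calc ∫⁻ x, expPair (v x) (a x) (b x) ∂μ
      ≤ ∫⁻ x, (expPair (u x) (a x) (b x) + ENNReal.ofReal (Real.exp K) *
          (ENNReal.ofReal (a x + b x) * ‖u x - g x‖ₑ)) ∂μ := by
        refine lintegral_mono fun x => (expPair_le_add (u := u x) (hvK x) (ha0 x) (hb0 x)).trans ?_
        gcongr
        rw [← ofReal_norm]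
        exact ENNReal.ofReal_le_ofReal (hdist x)
    _ = ∫⁻ x, expPair (u x) (a x) (b x) ∂μ +
          ENNReal.ofReal (Real.exp K) * ∫⁻ x, ‖u x - g x‖ₑ ∂θ := by
        have hgm := g.continuous.measurable
        have hd : Measurable fun x => ‖u x - g x‖ₑ := by fun_prop
        rw [lintegral_add_left hum, lintegral_const_mul _ (by fun_prop),
          lintegral_withDensity_eq_lintegral_mul _ hm hd]
        rfl
    _ ≤ ∫⁻ x, expPair (u x) (a x) (b x) ∂μ +
          ENNReal.ofReal (Real.exp K) * (ENNReal.ofReal (Real.exp (-K)) * η) := by gcongr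
    _ = _ := by
        rw [← mul_assoc, ← ENNReal.ofReal_mul hK'.le, ← Real.exp_add]
        simp

/-! ### Lower semicontinuity -/

/-- A continuous kernel `β m` and a continuous `u` certify that the production of `F'` exceeds `C'`.
Both sides of this strict inequality are weakly continuous, so the same `u` certifies the bound for
`F k` with `k` large. -/
theorem entropyProduction_le_liminf {B : ℝ → ℝ → ℝ≥0∞}
    (hB : LowerSemicontinuous (Function.uncurry B)) {n : ℕ}
    {F : ℕ → ProbabilityMeasure (Config (n + 2))} {F' : ProbabilityMeasure (Config (n + 2))}
    (hF : ∀ k, (F k : Measure (Config (n + 2))) ≪ volume)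
    (hF' : (F' : Measure (Config (n + 2))) ≪ volume) (hlim : Tendsto F atTop (𝓝 F')) :
    entropyProduction B (F' : Measure (Config (n + 2))) ≤
      liminf (fun k => entropyProduction B (F k : Measure (Config (n + 2)))) atTop := by
  have hBm := hB.measurable
  simp_rw [fun k => entropyProduction_eq hBm (hF k)]
  rw [entropyProduction_eq hBm hF']
  obtain ⟨β, hβc, hβ0, hβk, hβB, hβδ, hβlim⟩ := exists_continuous_approx_kernel hB
  have hd0 : ∀ (G : Measure (Config (n + 2))) v, 0 ≤ density G v :=
    fun G v => ENNReal.toReal_nonneg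
  have hβm : ∀ k, Measurable fun p : CollisionCoord × Config n => realWeight (β k) p.1 :=
    fun k => (continuous_realWeight (hβc k)).measurable.comp measurable_fst
  have ham : ∀ (G : Measure (Config (n + 2))) k, Measurable fun p : CollisionCoord × Config n =>
      density G (preCollision p) * realWeight (β k) p.1 := fun G k =>
    ((measurable_density G).comp measurable_preCollision).mul (hβm k)
  have hbm : ∀ (G : Measure (Config (n + 2))) k, Measurable fun p : CollisionCoord × Config n =>
      density G (postCollision p) * realWeight (β k) p.1 := fun G k =>
    ((measurable_density G).comp measurable_postCollision).mul (hβm k)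
  -- By homogeneity the kernel can be absorbed into the two densities, so the duality needs no
  -- separate weight.
  have hmul : ∀ (G : Measure (Config (n + 2))) k (p : CollisionCoord × Config n),
      sqrtDiff (density G (preCollision p) * realWeight (β k) p.1)
        (density G (postCollision p) * realWeight (β k) p.1) =
      sqrtDiff (density G (preCollision p)) (density G (postCollision p)) *
        ENNReal.ofReal (realWeight (β k) p.1) := by
    intro G k p
    rw [mul_comm (density G _), mul_comm (density G _), sqrtDiff_mul (c := realWeight (β k) p.1) (hβ0 k _), mul_comm]
  refine le_of_forall_lt fun C hC => ?_
  obtain ⟨C', hCC', hC'⟩ := exists_between hC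
  refine hCC'.trans_le (le_liminf_of_le (by isBoundedDefault) ?_)
  have hfatou : production (collisionWeight B) (density (F' : Measure (Config (n + 2)))) ≤
      liminf (fun k => ∫⁻ p : CollisionCoord × Config n,
        sqrtDiff (density F' (preCollision p) * realWeight (β k) p.1)
          (density F' (postCollision p) * realWeight (β k) p.1)
          ∂(collisionMeasure.prod volume)) atTop := by
    refine le_trans (lintegral_mono_ae ?_) (lintegral_liminf_le fun k =>
      measurable_sqrtDiff_comp (ham F' k) (hbm F' k))
    filter_upwards [ae_radius_pos n] with p hp
    simp_rw [hmul]
    rw [ENNReal.liminf_const_mul_of_ne_top (by simp [sqrtDiff])]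
    gcongr
    exact hβlim _ hp
  obtain ⟨m, hm⟩ := (eventually_lt_of_lt_liminf (hC'.trans_le hfatou)).exists
  obtain ⟨δ, hδ, hzero⟩ := hβδ m
  have hw0 : ∀ p : CollisionCoord × Config n, 0 ≤ realWeight (β m) p.1 := fun p => hβ0 m _
  obtain ⟨K, u, hu, huK, hlt⟩ := exists_continuous_dual_lt (ham F' m) (hbm F' m)
    (fun p => mul_nonneg (hd0 _ _) (hw0 p)) (fun p => mul_nonneg (hd0 _ _) (hw0 p))
    (lintegral_density_collision_ne_top hF' (hβc m) (hβ0 m) (hβk m)) hm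
  have l1 := tendsto_lintegral_expPair hF hF' hlim hu huK (hβc m) (hβ0 m) (hβk m) hδ hzero
  -- The total mass `∫ (a + b)` is the dual functional at `u = 0`, so it converges for the same
  -- reason.
  have l2 := tendsto_lintegral_expPair hF hF' hlim (u := fun _ => 0) continuous_const (K := 0)
    (by simp) (hβc m) (hβ0 m) (hβk m) hδ hzero
  simp only [expPair, neg_zero, Real.exp_zero, one_mul] at l2
  filter_upwards [(l1.const_add C').eventually_lt l2 hlt] with k hk
  have hdual := lintegral_add_le_sqrtDiff_add_expPair (μ := collisionMeasure.prod volume)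
    (ham (F k) m) (hbm (F k) m)
    (fun p => mul_nonneg (hd0 _ _) (hw0 p)) (fun p => mul_nonneg (hd0 _ _) (hw0 p)) u
  have hle := lt_of_add_lt_add_right (hk.trans_le hdual)
  refine hle.le.trans ?_
  simp_rw [hmul]
  refine lintegral_mono fun p => ?_
  gcongr
  exact hβB m _

/-! ### Convexity and superadditivity -/

/-- Jensen's inequality at almost every collision, then Tonelli. The parameter space is arbitrary
because the lemma is used twice: for a velocity that is integrated out, and for `ρ` in the mixture.
-/
theorem production_lintegral_le {T : Type*} [MeasurableSpace T] {l : Measure T} [SFinite l]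
    {b : CollisionCoord → ℝ≥0∞} (hb : Measurable b) {n : ℕ} {f : T × Config (n + 2) → ℝ}
    (hf : Measurable f) (hf0 : ∀ q, 0 ≤ f q)
    (hfin : ∫⁻ v, ∫⁻ t, ENNReal.ofReal (f (t, v)) ∂l ≠ ⊤) :
    production b (fun v => (∫⁻ t, ENNReal.ofReal (f (t, v)) ∂l).toReal) ≤
      ∫⁻ t, production b (fun v => f (t, v)) ∂l := by
  have hfo := hf.ennreal_ofReal
  have hg : Measurable fun v => ∫⁻ t, ENNReal.ofReal (f (t, v)) ∂l := hfo.lintegral_prod_left'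
  have hae : ∀ᵐ v, ∫⁻ t, ENNReal.ofReal (f (t, v)) ∂l < ⊤ := ae_lt_top hg hfin
  have hpre : Measurable fun q : T × CollisionCoord × Config n => f (q.1, preCollision q.2) :=
    hf.comp (measurable_fst.prodMk (measurable_preCollision.comp measurable_snd))
  have hpost : Measurable fun q : T × CollisionCoord × Config n => f (q.1, postCollision q.2) :=
    hf.comp (measurable_fst.prodMk (measurable_postCollision.comp measurable_snd))
  have hS : Measurable fun q : T × CollisionCoord × Config n =>
      sqrtDiff (f (q.1, preCollision q.2)) (f (q.1, postCollision q.2)) :=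
    measurable_sqrtDiff_comp hpre hpost
  have hI : Measurable fun q : T × CollisionCoord × Config n =>
      sqrtDiff (f (q.1, preCollision q.2)) (f (q.1, postCollision q.2)) * b q.2.1 :=
    hS.mul (hb.comp (measurable_fst.comp measurable_snd))
  unfold production
  rw [lintegral_lintegral_swap hI.aemeasurable]
  refine lintegral_mono_ae ?_
  filter_upwards [(quasiMeasurePreserving_preCollision n).ae hae,
    (quasiMeasurePreserving_postCollision n).ae hae] with p h1 h2
  have hp : Measurable fun t : T => sqrtDiff (f (t, preCollision p)) (f (t, postCollision p)) :=
    hS.comp (measurable_id.prodMk measurable_const)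
  rw [lintegral_mul_const _ hp]
  gcongr
  exact sqrtDiff_lintegral_le (hpre.comp (measurable_id.prodMk (measurable_const (a := p))))
    (hpost.comp (measurable_id.prodMk (measurable_const (a := p))))
    (fun t => hf0 _) (fun t => hf0 _) h1.ne h2.ne

theorem snoc_preCollision {n : ℕ} (x : CollisionCoord) (w : Config n) (u : Velocity) :
    (Fin.snoc (preCollision (x, w)) u : Config (n + 3)) =
      preCollision (x, (Fin.snoc w u : Config (n + 1))) := by
  simp only [preCollision, consPair]
  rw [Fin.cons_snoc_eq_snoc_cons, Fin.cons_snoc_eq_snoc_cons]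

theorem snoc_postCollision {n : ℕ} (x : CollisionCoord) (w : Config n) (u : Velocity) :
    (Fin.snoc (postCollision (x, w)) u : Config (n + 3)) =
      postCollision (x, (Fin.snoc w u : Config (n + 1))) := by
  simp only [postCollision, consPair]
  rw [Fin.cons_snoc_eq_snoc_cons, Fin.cons_snoc_eq_snoc_cons]

/-- The last velocity is a spectator of the collision, so this is Tonelli's theorem with one more
coordinate in `w`. -/
theorem lintegral_production_snoc {b : CollisionCoord → ℝ≥0∞} (hb : Measurable b) {n : ℕ}
    {f : Config (n + 3) → ℝ} (hf : Measurable f) :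
    ∫⁻ u : Velocity, production b (fun v : Config (n + 2) => f (Fin.snoc v u)) =
      production b f := by
  have hmp : MeasurePreserving
      (fun q : Velocity × CollisionCoord × Config n =>
        (q.2.1, (Fin.snoc q.2.2 q.1 : Config (n + 1))))
      (volume.prod (collisionMeasure.prod volume)) (collisionMeasure.prod volume) :=
    ((MeasurePreserving.id collisionMeasure).prod (measurePreserving_snoc volume n)).comp
      ((measurePreserving_prodAssoc collisionMeasure volume volume).comp
        ((Measure.measurePreserving_swap.prod (MeasurePreserving.id volume)).comp
          (measurePreserving_prodAssoc volume collisionMeasure volume).symm))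
  have hI := measurable_production_integrand hb hf
  have hI' := hI.comp hmp.measurable
  rw [production, ← hmp.lintegral_comp hI]
  refine Eq.trans ?_ (lintegral_prod _ hI'.aemeasurable).symm
  refine lintegral_congr fun u => lintegral_congr fun p => ?_
  simp only [Function.comp_apply]
  rw [← snoc_preCollision, ← snoc_postCollision]

theorem map_init_withDensity {N : ℕ} {f : Config (N + 1) → ℝ≥0∞} (hf : Measurable f) :
    (volume.withDensity f).map (fun v (i : Fin N) => v i.castSucc) =
      volume.withDensity fun v => ∫⁻ u : Velocity, f (Fin.snoc v u) := by
  have hmp := measurePreserving_snoc volume N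
  have hi : Measurable fun (v : Config (N + 1)) (i : Fin N) => v i.castSucc := by fun_prop
  have hfs : Measurable fun q : Velocity × Config N => f (Fin.snoc q.2 q.1) :=
    hf.comp hmp.measurable
  refine Measure.ext_of_lintegral _ fun h hh => ?_
  have hm : Measurable fun v : Config (N + 1) => h fun i => v i.castSucc := hh.comp hi
  have hm2 : Measurable fun q : Velocity × Config N => f (Fin.snoc q.2 q.1) * h q.2 :=
    hfs.mul (hh.comp measurable_snd)
  rw [lintegral_map hh hi, lintegral_withDensity_eq_lintegral_mul _ hf hm,
    lintegral_withDensity_eq_lintegral_mul _ hfs.lintegral_prod_left' hh]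
  calc ∫⁻ v, (f * fun v : Config (N + 1) => h fun i => v i.castSucc) v
      = ∫⁻ q : Velocity × Config N, f (Fin.snoc q.2 q.1) * h q.2 ∂(volume.prod volume) := by
        rw [← volume_pi, ← volume_pi] at hmp
        rw [← hmp.lintegral_comp (hf.mul hm)]
        simp
    _ = ∫⁻ v, ∫⁻ u : Velocity, f (Fin.snoc v u) * h v := lintegral_prod_symm _ hm2.aemeasurable
    _ = _ := lintegral_congr fun v => by
        have : Measurable fun u : Velocity => f (Fin.snoc v u) :=
          hfs.comp (measurable_id.prodMk measurable_const)
        rw [lintegral_mul_const _ this]; rfl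

theorem withDensity_ofReal_density {N : ℕ} {F : Measure (Config N)} [IsFiniteMeasure F]
    (hF : F ≪ volume) : volume.withDensity (fun v => ENNReal.ofReal (density F v)) = F := by
  conv_rhs => rw [← Measure.withDensity_rnDeriv_eq F volume hF]
  refine withDensity_congr_ae ?_
  filter_upwards [Measure.rnDeriv_ne_top F volume] with v hv
  rw [density, ENNReal.ofReal_toReal hv]

theorem firstMarginal_firstMarginal {i j k : ℕ} (h : i ≤ j) (h' : j ≤ k) (F : Measure (Config k)) :
    firstMarginal h (firstMarginal h' F) = firstMarginal (h.trans h') F := by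
  unfold firstMarginal
  rw [Measure.map_map (by fun_prop) (by fun_prop)]
  rfl

theorem absolutelyContinuous_firstMarginal_succ {N : ℕ} {F : Measure (Config (N + 1))}
    [IsFiniteMeasure F] (hF : F ≪ volume) : firstMarginal N.le_succ F ≪ volume := by
  rw [← withDensity_ofReal_density hF]
  exact (Measure.absolutelyContinuous_of_eq (map_init_withDensity
    (measurable_density F).ennreal_ofReal)).trans (withDensity_absolutelyContinuous _ _)

theorem entropyProduction_firstMarginal_succ_le {B : ℝ → ℝ → ℝ≥0∞}
    (hB : Measurable (Function.uncurry B)) {n : ℕ} {F : Measure (Config (n + 3))}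
    [IsFiniteMeasure F] (hF : F ≪ volume) :
    entropyProduction B (firstMarginal (n + 2).le_succ F) ≤ entropyProduction B F := by
  have hd := measurable_density F
  have hmp := measurePreserving_snoc volume (n + 2)
  have hds : Measurable fun q : Velocity × Config (n + 2) => density F (Fin.snoc q.2 q.1) :=
    hd.comp hmp.measurable
  have hmarg : firstMarginal (n + 2).le_succ F = volume.withDensity fun v =>
      ∫⁻ u : Velocity, ENNReal.ofReal (density F (Fin.snoc v u)) := by
    conv_lhs => rw [← withDensity_ofReal_density hF]
    exact map_init_withDensity hd.ennreal_ofReal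
  have hfin : ∫⁻ v, ∫⁻ u : Velocity, ENNReal.ofReal (density F (Fin.snoc v u)) ≠ ⊤ := by
    rw [← setLIntegral_univ, ← withDensity_apply _ MeasurableSet.univ, ← hmarg, firstMarginal,
      Measure.map_apply (by fun_prop) MeasurableSet.univ]
    exact measure_ne_top _ _
  rw [hmarg, entropyProduction_withDensity hB hds.ennreal_ofReal.lintegral_prod_left',
    entropyProduction_eq hB hF]
  refine (production_lintegral_le (measurable_collisionWeight hB) hds
    (fun q => ENNReal.toReal_nonneg) hfin).trans_eq ?_
  exact lintegral_production_snoc (measurable_collisionWeight hB) hd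

theorem entropyProduction_firstMarginal_le {B : ℝ → ℝ → ℝ≥0∞}
    (hB : Measurable (Function.uncurry B)) {m n : ℕ} (h : m + 2 ≤ n + 2)
    (F : Measure (Config (n + 2))) [IsFiniteMeasure F] (hF : F ≪ volume) :
    entropyProduction B (firstMarginal h F) ≤ entropyProduction B F := by
  induction n with
  | zero =>
    obtain rfl : m = 0 := by omega
    have : firstMarginal h F = F := by
      unfold firstMarginal
      exact Measure.map_id
    rw [this]
  | succ n ih =>
    rcases h.eq_or_lt with h' | h'
    · obtain rfl : m = n + 1 := by omega
      have : firstMarginal h F = F := by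
        unfold firstMarginal
        exact Measure.map_id
      rw [this]
    · have h2 : m + 2 ≤ n + 2 := by omega
      have : IsFiniteMeasure (firstMarginal (n + 2).le_succ F) := by
        unfold firstMarginal; infer_instance
      rw [← firstMarginal_firstMarginal h2 (n + 2).le_succ F]
      exact (ih h2 _ (absolutelyContinuous_firstMarginal_succ hF)).trans
        (entropyProduction_firstMarginal_succ_le hB hF)

/-! ### Recovering `ρ` from a large sample -/

open ProbabilityTheory

/-- The number of velocities in `A`, divided by `j`. -/
noncomputable def empirical (A : Set Velocity) {j : ℕ} (w : Config j) : ℝ :=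
  (∑ i, A.indicator (fun _ => (1 : ℝ)) (w i)) / j

theorem measurable_empirical {A : Set Velocity} (hA : MeasurableSet A) (j : ℕ) :
    Measurable (empirical A (j := j)) := by
  have h : Measurable (A.indicator fun _ => (1 : ℝ)) := measurable_const.indicator hA
  unfold empirical
  refine Measurable.div_const (Finset.measurable_sum _ fun i _ => h.comp (measurable_pi_apply i)) _

/-- Chebyshev's inequality for a sum of independent indicators, whose variance is at most `j`. The
bound does not depend on `ρ`, so it can be integrated in `ρ`. -/
theorem tensorPower_deviation_le (ρ : ProbabilityMeasure Velocity) {A : Set Velocity}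
    (hA : MeasurableSet A) {j : ℕ} (hj : 0 < j) {δ : ℝ} (hδ : 0 < δ) :
    tensorPower j ρ {w | δ ≤ |empirical A w - (ρ : Measure Velocity).real A|} ≤
      ENNReal.ofReal (1 / (j * δ ^ 2)) := by
  set X : Velocity → ℝ := A.indicator fun _ => (1 : ℝ) with hX
  have hXm : Measurable X := measurable_const.indicator hA
  have hX01 : ∀ v, X v ∈ Icc (0 : ℝ) 1 := fun v => by
    by_cases h : v ∈ A <;> simp [hX, h]
  have hXL : MemLp X 2 (ρ : Measure Velocity) :=
    memLp_of_bounded (ae_of_all _ hX01) hXm.aestronglyMeasurable 2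
  have hj' : (0 : ℝ) < j := by exact_mod_cast hj
  have hmp : ∀ i : Fin j, MeasurePreserving (Function.eval i) (tensorPower j ρ)
      (ρ : Measure Velocity) := fun i => measurePreserving_eval _ i
  have hL : ∀ i : Fin j, MemLp (fun w : Config j => X (w i)) 2 (tensorPower j ρ) := fun i =>
    hXL.comp_measurePreserving (hmp i)
  have hmean : ∫ w : Config j, ∑ i, X (w i) ∂(tensorPower j ρ) =
      j * (ρ : Measure Velocity).real A := by
    rw [integral_finsetSum _ fun i _ => (hL i).integrable (by norm_num)]
    have : ∀ i : Fin j, ∫ w : Config j, X (w i) ∂(tensorPower j ρ) =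
        (ρ : Measure Velocity).real A := fun i => by
      rw [← integral_indicator_one hA]
      change _ = ∫ v, X v ∂(ρ : Measure Velocity)
      rw [← (hmp i).map_eq,
        integral_map (hmp i).measurable.aemeasurable hXm.aestronglyMeasurable]
    simp [this]
  have hvar : variance (fun w : Config j => ∑ i, X (w i)) (tensorPower j ρ) ≤ j := by
    have h1 := variance_sum_pi (μ := fun _ : Fin j => (ρ : Measure Velocity)) (X := fun _ => X)
      fun _ => hXL
    have h2 : Var[X; (ρ : Measure Velocity)] ≤ 1 :=
      (variance_le_sq_of_bounded (ae_of_all _ hX01) hXm.aemeasurable).trans (by norm_num)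
    have h3 : (fun w : Config j => ∑ i, X (w i)) = ∑ i, fun w : Config j => X (w i) := by
      ext w; simp
    rw [h3, tensorPower, h1]
    simp only [Finset.sum_const, Finset.card_univ, Fintype.card_fin, nsmul_eq_mul]
    nlinarith
  have hsum : MemLp (fun w : Config j => ∑ i, X (w i)) 2 (tensorPower j ρ) :=
    memLp_finsetSum _ fun i _ => hL i
  have hcheb := meas_ge_le_variance_div_sq hsum (mul_pos hj' hδ)
  rw [hmean] at hcheb
  have hset : {w : Config j | δ ≤ |empirical A w - (ρ : Measure Velocity).real A|} ⊆
      {w | j * δ ≤ |∑ i, X (w i) - j * (ρ : Measure Velocity).real A|} := by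
    intro w hw
    have h1 : ∑ i, X (w i) - j * (ρ : Measure Velocity).real A =
        j * (empirical A w - (ρ : Measure Velocity).real A) := by
      rw [empirical, mul_sub, mul_div_cancel₀ _ hj'.ne']
    simp only [mem_ofPred_eq] at hw ⊢
    rw [h1, abs_mul, abs_of_pos hj']
    gcongr
  refine (measure_mono hset).trans (hcheb.trans (ENNReal.ofReal_le_ofReal ?_))
  rw [div_le_div_iff₀ (by positivity) (by positivity)]
  nlinarith [mul_le_mul_of_nonneg_right hvar (by positivity : 0 ≤ (j : ℝ) * δ ^ 2)]

/-- `ρ ↦ ρ^{⊗ j}` as a Markov kernel. -/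
noncomputable def tensorKernel (j : ℕ) : Kernel (ProbabilityMeasure Velocity) (Config j) :=
  ⟨tensorPower j, measurable_tensorPower j⟩

instance (j : ℕ) : IsMarkovKernel (tensorKernel j) :=
  ⟨fun ρ => inferInstanceAs (IsProbabilityMeasure (tensorPower j ρ))⟩

section Coupling

variable {X : Type*} [MeasurableSpace X]

/-- The law of `(ρ, x, w)`, where `(ρ, x)` has law `θ` and `w` is a sample of `ρ` of size `j`. -/
noncomputable def coupling (θ : Measure (ProbabilityMeasure Velocity × X)) (j : ℕ) :
    Measure ((ProbabilityMeasure Velocity × X) × Config j) :=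
  θ ⊗ₘ (tensorKernel j).comap Prod.fst measurable_fst

variable {θ : Measure (ProbabilityMeasure Velocity × X)}

variable (θ) in
/-- The set `S` is almost determined by `x` and a large sample of `ρ`. -/
def SampleApproximable (S : Set (ProbabilityMeasure Velocity × X)) : Prop :=
  ∀ ε : ℝ≥0∞, ε ≠ 0 → ∀ᶠ j in atTop, ∃ T : Set (X × Config j), MeasurableSet T ∧
    coupling θ j {q | ¬(q.1 ∈ S ↔ (q.1.2, q.2) ∈ T)} ≤ ε

theorem SampleApproximable.compl {S : Set (ProbabilityMeasure Velocity × X)}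
    (h : SampleApproximable θ S) : SampleApproximable θ Sᶜ := by
  intro ε hε
  filter_upwards [h ε hε] with j ⟨T, hT, hle⟩
  refine ⟨Tᶜ, hT.compl, ?_⟩
  simpa only [mem_compl_iff, not_iff_not] using hle

theorem SampleApproximable.union {S S' : Set (ProbabilityMeasure Velocity × X)}
    (h : SampleApproximable θ S) (h' : SampleApproximable θ S') :
    SampleApproximable θ (S ∪ S') := by
  intro ε hε
  filter_upwards [h (ε / 2) (by simpa using hε), h' (ε / 2) (by simpa using hε)]
    with j ⟨T, hT, hle⟩ ⟨T', hT', hle'⟩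
  refine ⟨T ∪ T', hT.union hT', ?_⟩
  rw [← ENNReal.add_halves ε]
  refine (measure_mono ?_).trans ((measure_union_le _ _).trans (add_le_add hle hle'))
  intro q
  simp only [mem_ofPred_eq, mem_union]
  tauto

theorem SampleApproximable.empty : SampleApproximable θ (∅ : Set (ProbabilityMeasure Velocity × X)) :=
  fun _ _ => Eventually.of_forall fun _ => ⟨∅, MeasurableSet.empty, by simp⟩

theorem SampleApproximable.preimage_snd {E : Set X} (hE : MeasurableSet E) :
    SampleApproximable θ (Prod.snd ⁻¹' E) :=
  fun _ _ => Eventually.of_forall fun _ => ⟨Prod.fst ⁻¹' E, measurable_fst hE, by simp⟩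

variable [IsFiniteMeasure θ]

theorem measurePreserving_fst_coupling (j : ℕ) :
    MeasurePreserving Prod.fst (coupling θ j) θ :=
  ⟨measurable_fst, Measure.fst_compProd _ _⟩

theorem lintegral_fst_coupling (j : ℕ) {h : ProbabilityMeasure Velocity × X → ℝ≥0∞}
    (hh : AEMeasurable h θ) : ∫⁻ q, h q.1 ∂(coupling θ j) = ∫⁻ y, h y ∂θ := by
  have hmp := measurePreserving_fst_coupling (θ := θ) j
  rw [← lintegral_map' (by rwa [hmp.map_eq]) measurable_fst.aemeasurable, hmp.map_eq]

theorem lintegral_coupling (j : ℕ) {f : (ProbabilityMeasure Velocity × X) × Config j → ℝ≥0∞}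
    (hf : Measurable f) :
    ∫⁻ q, f q ∂(coupling θ j) = ∫⁻ y, ∫⁻ w, f (y, w) ∂(tensorPower j y.1) ∂θ :=
  Measure.lintegral_compProd hf

theorem SampleApproximable.of_approx {S : Set (ProbabilityMeasure Velocity × X)}
    (h : ∀ ε : ℝ≥0∞, ε ≠ 0 → ∃ S', SampleApproximable θ S' ∧
      MeasurableSet {y | ¬(y ∈ S ↔ y ∈ S')} ∧ θ {y | ¬(y ∈ S ↔ y ∈ S')} ≤ ε) :
    SampleApproximable θ S := by
  intro ε hε
  obtain ⟨S', hS', hm, hle'⟩ := h (ε / 2) (by simpa using hε)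
  filter_upwards [hS' (ε / 2) (by simpa using hε)] with j ⟨T, hT, hle⟩
  refine ⟨T, hT, ?_⟩
  rw [← (measurePreserving_fst_coupling (θ := θ) j).measure_preimage hm.nullMeasurableSet] at hle'
  rw [← ENNReal.add_halves ε]
  refine (measure_mono ?_).trans ((measure_union_le _ _).trans (add_le_add hle' hle))
  intro q
  simp only [mem_ofPred_eq, mem_union, mem_preimage]
  tauto

/-- Finite unions are approximable and exhaust the countable union up to small measure, because `θ`
is finite. -/
theorem SampleApproximable.iUnion {S : ℕ → Set (ProbabilityMeasure Velocity × X)}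
    (hS : ∀ n, MeasurableSet (S n)) (h : ∀ n, SampleApproximable θ (S n)) :
    SampleApproximable θ (⋃ n, S n) := by
  have hacc : ∀ n, SampleApproximable θ (accumulate S n) ∧ MeasurableSet (accumulate S n) := by
    intro n
    induction n with
    | zero => simpa [accumulate_zero_nat] using ⟨h 0, hS 0⟩
    | succ n ih =>
      rw [accumulate_succ]
      exact ⟨ih.1.union (h _), ih.2.union (hS _)⟩
  refine SampleApproximable.of_approx fun ε hε => ?_
  have hlim : Tendsto (fun n => θ ((⋃ n, S n) \ accumulate S n)) atTop (𝓝 0) := by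
    have := tendsto_measure_iInter_atTop (μ := θ) (s := fun n => (⋃ n, S n) \ accumulate S n)
      (fun n => ((MeasurableSet.iUnion hS).diff (hacc n).2).nullMeasurableSet)
      (fun m n hmn => sdiff_subset_sdiff_right (monotone_accumulate hmn))
      ⟨0, measure_ne_top _ _⟩
    have he : ⋂ n, ((⋃ n, S n) \ accumulate S n) = ∅ := by
      rw [← sdiff_iUnion, iUnion_accumulate, sdiff_self]
    rwa [he, measure_empty] at this
  obtain ⟨n, hn⟩ := (hlim.eventually_lt_const (pos_iff_ne_zero.2 hε)).exists
  have hset : {y | ¬(y ∈ (⋃ n, S n) ↔ y ∈ accumulate S n)} = (⋃ n, S n) \ accumulate S n := by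
    ext y
    have : y ∈ accumulate S n → y ∈ ⋃ n, S n := fun hy => accumulate_subset_iUnion n hy
    simp only [mem_ofPred_eq, Set.mem_sdiff]
    tauto
  refine ⟨accumulate S n, (hacc n).1, ?_, ?_⟩
  · rw [hset]; exact (MeasurableSet.iUnion hS).diff (hacc n).2
  · rw [hset]; exact hn.le

theorem measurable_measure_fst_apply {A : Set Velocity} (hA : MeasurableSet A) :
    Measurable fun y : ProbabilityMeasure Velocity × X => (y.1 : Measure Velocity) A :=
  ((Measure.measurable_coe hA).comp measurable_subtype_coe).comp measurable_fst

theorem measurable_real_apply {A : Set Velocity} (hA : MeasurableSet A) :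
    Measurable fun y : ProbabilityMeasure Velocity × X => (y.1 : Measure Velocity).real A :=
  (measurable_measure_fst_apply hA).ennreal_toReal

/-- The empirical frequency of `A` is tested against `c - δ`. The test errs only if the frequency
deviates by at least `δ` or if `c - 2δ ≤ ρ(A) < c`. -/
theorem SampleApproximable.real_apply_lt {A : Set Velocity} (hA : MeasurableSet A) (c : ℝ) :
    SampleApproximable θ {y | (y.1 : Measure Velocity).real A < c} := by
  have hr := measurable_real_apply (X := X) hA
  intro ε hε
  -- The uncertain band lies strictly below `c`, so it shrinks to the empty set even when `ρ(A) = c`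
  -- has positive mass.
  let E : ℕ → Set (ProbabilityMeasure Velocity × X) := fun k =>
    {y | c - 2 * (1 / ((k : ℝ) + 1)) ≤ (y.1 : Measure Velocity).real A ∧
      (y.1 : Measure Velocity).real A < c}
  have hE : ∀ k, MeasurableSet (E k) := fun k =>
    (measurableSet_le measurable_const hr).inter (measurableSet_lt hr measurable_const)
  have hlim : Tendsto (fun k => θ (E k)) atTop (𝓝 0) := by
    have h1 := tendsto_measure_iInter_atTop (μ := θ) (s := E) (fun k => (hE k).nullMeasurableSet)
      (fun m n hmn y hy => ⟨by
        have := Nat.one_div_le_one_div (α := ℝ) hmn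
        have := hy.1
        linarith, hy.2⟩) ⟨0, measure_ne_top _ _⟩
    have he : ⋂ k, E k = ∅ := by
      rw [eq_empty_iff_forall_notMem]
      intro y hy
      rw [mem_iInter] at hy
      have hlt : (y.1 : Measure Velocity).real A < c := (hy 0).2
      obtain ⟨k, hk⟩ := exists_nat_one_div_lt (half_pos (sub_pos.2 hlt))
      have := (hy k).1
      linarith
    rwa [he, measure_empty] at h1
  obtain ⟨k, hk⟩ := (hlim.eventually_lt_const
    (pos_iff_ne_zero.2 (by simpa using hε : ε / 2 ≠ 0))).exists
  set δ : ℝ := 1 / ((k : ℝ) + 1) with hδdef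
  have hδ : 0 < δ := Nat.one_div_pos_of_nat
  have hcheb : Tendsto (fun j : ℕ => ENNReal.ofReal (1 / (j * δ ^ 2)) * θ univ) atTop (𝓝 0) := by
    have h1 : Tendsto (fun j : ℕ => 1 / (j * δ ^ 2)) atTop (𝓝 0) :=
      (tendsto_natCast_atTop_atTop.atTop_mul_const (by positivity)).const_div_atTop 1
    have h2 := ENNReal.Tendsto.mul_const (ENNReal.tendsto_ofReal h1)
      (Or.inr (measure_ne_top θ univ))
    simpa using h2
  filter_upwards [hcheb.eventually_lt_const (pos_iff_ne_zero.2 (by simpa using hε : ε / 2 ≠ 0)),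
    eventually_gt_atTop 0] with j hj hj0
  have hem : Measurable fun q : X × Config j => empirical A q.2 :=
    (measurable_empirical hA j).comp measurable_snd
  have hem' : Measurable fun q : (ProbabilityMeasure Velocity × X) × Config j => empirical A q.2 :=
    (measurable_empirical hA j).comp measurable_snd
  have hr' : Measurable fun q : (ProbabilityMeasure Velocity × X) × Config j =>
      (q.1.1 : Measure Velocity).real A := hr.comp measurable_fst
  refine ⟨{q | empirical A q.2 < c - δ}, measurableSet_lt hem measurable_const, ?_⟩
  let D : Set ((ProbabilityMeasure Velocity × X) × Config j) :=
    {q | δ ≤ |empirical A q.2 - (q.1.1 : Measure Velocity).real A|}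
  have hD : MeasurableSet D := measurableSet_le measurable_const
    (continuous_abs.measurable.comp (hem'.sub hr'))
  have hDle : coupling θ j D ≤ ε / 2 := by
    rw [coupling, Measure.compProd_apply hD]
    refine le_trans (lintegral_mono fun y => tensorPower_deviation_le y.1 hA hj0 hδ) ?_
    rw [lintegral_const]
    exact hj.le
  have hEle : coupling θ j (Prod.fst ⁻¹' (E k)) ≤ ε / 2 := by
    rw [(measurePreserving_fst_coupling (θ := θ) j).measure_preimage (hE k).nullMeasurableSet]
    exact hk.le
  rw [← ENNReal.add_halves ε]
  refine (measure_mono ?_).trans ((measure_union_le _ _).trans (add_le_add hEle hDle))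
  intro q hq
  simp only [mem_ofPred_eq] at hq
  simp only [mem_union, mem_preimage, E, D, mem_ofPred_eq, ← hδdef]
  by_contra! hcon
  obtain ⟨h1, h2⟩ := hcon
  rw [abs_lt] at h2
  apply hq
  constructor
  · intro h3
    have := h1.mt (not_le.2 h3)
    linarith
  · intro h3
    linarith

/-- Approximable measurable sets form a σ-algebra. It makes the evaluations `ρ ↦ ρ(A)` and the
coordinate `x` measurable, and these generate the product σ-algebra. -/
theorem SampleApproximable.of_measurableSet {S : Set (ProbabilityMeasure Velocity × X)}
    (hS : MeasurableSet S) : SampleApproximable θ S := by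
  let 𝓖 : MeasurableSpace (ProbabilityMeasure Velocity × X) :=
    { MeasurableSet' := fun S => MeasurableSet S ∧ SampleApproximable θ S
      measurableSet_empty := ⟨MeasurableSet.empty, SampleApproximable.empty⟩
      measurableSet_compl := fun S h => ⟨h.1.compl, h.2.compl⟩
      measurableSet_iUnion := fun S h => ⟨MeasurableSet.iUnion fun n => (h n).1,
        SampleApproximable.iUnion (fun n => (h n).1) fun n => (h n).2⟩ }
  have hle : (Prod.instMeasurableSpace : MeasurableSpace (ProbabilityMeasure Velocity × X)) ≤ 𝓖 := by
    refine sup_le ?_ ?_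
    · have h1 : @Measurable _ _ 𝓖 _ fun y : ProbabilityMeasure Velocity × X =>
          (y.1 : Measure Velocity) := by
        refine @Measure.measurable_of_measurable_coe _ _ _ 𝓖 _ fun A hA => ?_
        refine @measurable_of_Iio _ _ _ _ _ 𝓖 _ _ _ _ fun c => ?_
        refine ⟨measurable_measure_fst_apply hA measurableSet_Iio, ?_⟩
        by_cases hc : c = ⊤
        · have : (fun y : ProbabilityMeasure Velocity × X => (y.1 : Measure Velocity) A) ⁻¹' Iio c =
              ∅ᶜ := by
            ext y; simp [hc, measure_lt_top]
          rw [this]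
          exact SampleApproximable.empty.compl
        · have : (fun y : ProbabilityMeasure Velocity × X => (y.1 : Measure Velocity) A) ⁻¹' Iio c =
              {y | (y.1 : Measure Velocity).real A < c.toReal} := by
            ext y
            simp only [mem_preimage, mem_Iio, mem_ofPred_eq, measureReal_def]
            rw [ENNReal.toReal_lt_toReal (measure_ne_top _ _) hc]
          rw [this]
          exact SampleApproximable.real_apply_lt hA _
      have h2 : @Measurable _ _ 𝓖 _ (Prod.fst : ProbabilityMeasure Velocity × X → _) :=
        @Measurable.subtype_mk _ _ 𝓖 _ _ _ h1 fun y => y.1.2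
      exact h2.comap_le
    · rintro _ ⟨E, hE, rfl⟩
      exact ⟨measurable_snd hE, SampleApproximable.preimage_snd hE⟩
  exact (hle S hS).2

/-- Approximable sets give indicators, then sums and `L¹` limits follow: the first marginal of the
coupling is `θ`, so errors in `L¹(θ)` keep their size for every `j`. -/
theorem eventually_exists_sample_approx_aux {u : ProbabilityMeasure Velocity × X → ℝ}
    (hu : Integrable u θ) : ∀ ε : ℝ≥0∞, ε ≠ 0 → ∀ᶠ j in atTop, ∃ v : X × Config j → ℝ,
      Measurable v ∧ ∫⁻ q, ‖u q.1 - v (q.1.2, q.2)‖ₑ ∂(coupling θ j) ≤ ε := by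
  have hmp := fun j => measurePreserving_fst_coupling (θ := θ) j
  have hπ : ∀ j, Measurable fun q : (ProbabilityMeasure Velocity × X) × Config j =>
      (q.1.2, q.2) := fun j => by fun_prop
  refine Integrable.induction _ ?_ ?_ ?_ ?_ hu
  · intro c S hS _ ε hε
    rcases eq_or_ne c 0 with rfl | hc
    · exact Eventually.of_forall fun j => ⟨0, measurable_zero, by simp⟩
    have hc' : ‖c‖ₑ ≠ 0 := by simpa using hc
    filter_upwards [SampleApproximable.of_measurableSet (θ := θ) hS (ε / ‖c‖ₑ)
      (ENNReal.div_ne_zero.2 ⟨hε, by simp⟩)] with j ⟨T, hT, hle⟩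
    refine ⟨T.indicator fun _ => c, measurable_const.indicator hT, ?_⟩
    let D : Set ((ProbabilityMeasure Velocity × X) × Config j) :=
      {q | ¬(q.1 ∈ S ↔ (q.1.2, q.2) ∈ T)}
    have hD : MeasurableSet D := by
      have h1 : MeasurableSet {q : (ProbabilityMeasure Velocity × X) × Config j | q.1 ∈ S} :=
        measurable_fst hS
      have h2 : MeasurableSet {q : (ProbabilityMeasure Velocity × X) × Config j |
        (q.1.2, q.2) ∈ T} := hπ j hT
      exact (h1.iff h2).compl
    calc _ ≤ ∫⁻ q, D.indicator (fun _ => ‖c‖ₑ) q ∂(coupling θ j) := by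
          refine lintegral_mono fun q => ?_
          by_cases h1 : q.1 ∈ S <;> by_cases h2 : (q.1.2, q.2) ∈ T <;> simp [D, h1, h2]
      _ = ‖c‖ₑ * coupling θ j D := lintegral_indicator_const hD _
      _ ≤ ‖c‖ₑ * (ε / ‖c‖ₑ) := by gcongr
      _ = ε := ENNReal.mul_div_cancel hc' (by simp)
  · intro f g _ hf hg ihf ihg ε hε
    filter_upwards [ihf (ε / 2) (by simpa using hε), ihg (ε / 2) (by simpa using hε)]
      with j ⟨v, hv, hle⟩ ⟨v', hv', hle'⟩
    refine ⟨v + v', hv.add hv', ?_⟩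
    rw [← ENNReal.add_halves ε]
    have hm : AEMeasurable (fun q : (ProbabilityMeasure Velocity × X) × Config j =>
        ‖f q.1 - v (q.1.2, q.2)‖ₑ) (coupling θ j) :=
      ((hf.1.comp_measurePreserving (hmp j)).aemeasurable.sub
        (hv.comp (hπ j)).aemeasurable).enorm
    refine le_trans ?_ (add_le_add hle hle')
    rw [← lintegral_add_left' hm]
    refine lintegral_mono fun q => ?_
    simp only [Pi.add_apply]
    rw [add_sub_add_comm]
    exact enorm_add_le _ _
  · refine isClosed_of_closure_subset fun f hf ε hε => ?_
    have hε2 : ε / 2 ≠ 0 := by simpa using hε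
    obtain ⟨g, hg, hfg⟩ := EMetric.mem_closure_iff.1 hf (ε / 2) (pos_iff_ne_zero.2 hε2)
    filter_upwards [hg (ε / 2) hε2] with j ⟨v, hv, hle⟩
    refine ⟨v, hv, ?_⟩
    rw [Lp.edist_def, eLpNorm_one_eq_lintegral_enorm] at hfg
    have hm : AEMeasurable (fun y => ‖(f - g : ProbabilityMeasure Velocity × X → ℝ) y‖ₑ) θ :=
      ((Lp.aestronglyMeasurable f).sub (Lp.aestronglyMeasurable g)).enorm
    have hfg' : ∫⁻ q, ‖f q.1 - g q.1‖ₑ ∂(coupling θ j) ≤ ε / 2 := by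
      exact (lintegral_fst_coupling j hm).trans_le hfg.le
    have hm' : AEMeasurable (fun q : (ProbabilityMeasure Velocity × X) × Config j =>
        ‖f q.1 - g q.1‖ₑ) (coupling θ j) :=
      hm.comp_quasiMeasurePreserving (hmp j).quasiMeasurePreserving
    rw [← ENNReal.add_halves ε]
    refine le_trans ?_ (add_le_add hfg' hle)
    rw [← lintegral_add_left' hm']
    refine lintegral_mono fun q => ?_
    rw [← sub_add_sub_cancel (f q.1) (g q.1) (v (q.1.2, q.2))]
    exact enorm_add_le _ _
  · intro f g hfg _ ih ε hε
    filter_upwards [ih ε hε] with j ⟨v, hv, hle⟩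
    refine ⟨v, hv, le_trans (le_of_eq ?_) hle⟩
    refine lintegral_congr_ae ?_
    filter_upwards [(hmp j).quasiMeasurePreserving.ae hfg] with q hq
    rw [hq]

theorem eventually_exists_sample_approx {u : ProbabilityMeasure Velocity × X → ℝ}
    (hu : Measurable u) {K : ℝ} (huK : ∀ y, |u y| ≤ K) {ε : ℝ≥0∞} (hε : ε ≠ 0) :
    ∀ᶠ j in atTop, ∃ v : X × Config j → ℝ, Measurable v ∧ (∀ q, |v q| ≤ K) ∧
      ∫⁻ q, ENNReal.ofReal |u q.1 - v (q.1.2, q.2)| ∂(coupling θ j) ≤ ε := by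
  have hint : Integrable u θ := (integrable_const K).mono' hu.aestronglyMeasurable
    (ae_of_all _ huK)
  filter_upwards [eventually_exists_sample_approx_aux hint ε hε] with j ⟨v, hv, hle⟩
  -- A point of the space is needed to know that `K ≥ 0`.
  rcases isEmpty_or_nonempty (ProbabilityMeasure Velocity × X) with he | ⟨⟨y⟩⟩
  · exact ⟨fun _ => 0, measurable_const, fun q => (he.false (diracProba 0, q.1)).elim, by
      simp⟩
  have hK : 0 ≤ K := (abs_nonneg _).trans (huK y)
  refine ⟨fun q => clamp K (v q), by unfold clamp; fun_prop, fun q => abs_clamp_le hK _,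
    le_trans (lintegral_mono fun q => ?_) hle⟩
  rw [← ofReal_norm]
  exact ENNReal.ofReal_le_ofReal (abs_sub_clamp_le (huK _) _)

end Coupling

/-! ### Translation estimates from the Fisher information -/

open scoped Manifold

/-- Regularity of both measures: a compact `K ⊆ A` nearly exhausts `A` for `μ`, an open `U ⊇ K` has
nearly the `ν`-measure of `K`, and a smooth `φ` lies between the two indicators. -/
theorem measure_le_add_of_smooth {E : Type*} [NormedAddCommGroup E] [NormedSpace ℝ E]
    [FiniteDimensional ℝ E] [MeasurableSpace E] [BorelSpace E] {μ ν : Measure E}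
    [IsFiniteMeasure μ] [IsFiniteMeasure ν] {C : ℝ} (hC : 0 ≤ C)
    (h : ∀ φ : E → ℝ, ContDiff ℝ ∞ φ → HasCompactSupport φ → (∀ x, φ x ∈ Icc (0 : ℝ) 1) →
      ∫ x, φ x ∂μ ≤ ∫ x, φ x ∂ν + C) {A : Set E} (hA : MeasurableSet A) :
    μ A ≤ ν A + ENNReal.ofReal C := by
  refine le_of_forall_lt fun r hr => ?_
  obtain ⟨r', hrr', hr'⟩ := exists_between hr
  obtain ⟨K, hKA, hK, hrK⟩ := hA.exists_lt_isCompact_of_ne_top (measure_ne_top μ A) hr'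
  refine hrr'.trans_le (hrK.le.trans ?_)
  refine le_trans ?_ (add_le_add_left (measure_mono hKA : ν K ≤ ν A) _)
  refine ENNReal.le_of_forall_pos_le_add fun ε hε _ => ?_
  obtain ⟨U, hKU, hU, hUε⟩ := K.exists_isOpen_lt_add (measure_ne_top ν K)
    (by simpa using hε.ne' : (ε : ℝ≥0∞) ≠ 0)
  -- Intersecting `U` with a ball makes the support of `φ` compact.
  obtain ⟨R, hR⟩ := hK.isBounded.subset_ball 0
  obtain ⟨φ, hφ, hrange, hsupp, hone⟩ := exists_contMDiff_support_eq_eq_one_iff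
    (n := ⊤) 𝓘(ℝ, E) (hU.inter Metric.isOpen_ball) hK.isClosed (subset_inter hKU hR)
  have hφ' : ContDiff ℝ ∞ φ := contMDiff_iff_contDiff.1 hφ
  have h01 : ∀ x, φ x ∈ Icc (0 : ℝ) 1 := fun x => hrange (mem_range_self x)
  have hcs : HasCompactSupport φ := by
    refine HasCompactSupport.intro (isCompact_closedBall (0 : E) R) fun x hx => ?_
    by_contra hne
    have : x ∈ Function.support φ := hne
    rw [hsupp] at this
    exact hx (Metric.ball_subset_closedBall this.2)
  have hi : ∀ (m : Measure E) [IsFiniteMeasure m], Integrable φ m := fun m _ =>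
    hφ'.continuous.integrable_of_hasCompactSupport hcs
  have h1 : μ.real K ≤ ∫ x, φ x ∂μ := by
    rw [← integral_indicator_one hK.measurableSet]
    refine integral_mono ((integrable_const (1 : ℝ)).indicator hK.measurableSet) (hi μ) fun x => ?_
    by_cases hx : x ∈ K
    · simp [hx, (hone x).1 hx]
    · simpa [hx] using (h01 x).1
  have h2 : ∫ x, φ x ∂ν ≤ ν.real U := by
    rw [← integral_indicator_one hU.measurableSet]
    refine integral_mono (hi ν) ((integrable_const (1 : ℝ)).indicator hU.measurableSet) fun x => ?_
    by_cases hx : x ∈ U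
    · simpa [hx] using (h01 x).2
    · have : φ x = 0 := by
        by_contra hne
        have : x ∈ Function.support φ := hne
        rw [hsupp] at this
        exact hx this.1
      simp [hx, this]
  have h3 : μ.real K ≤ ν.real U + C := h1.trans ((h φ hφ' hcs h01).trans (by linarith))
  have h4 := ENNReal.ofReal_le_ofReal h3
  rw [ENNReal.ofReal_add measureReal_nonneg hC, ofReal_measureReal, ofReal_measureReal] at h4
  refine h4.trans ?_
  rw [add_right_comm]
  gcongr

/-- A pointwise replacement for Cauchy–Schwarz: with `G = |∇f|` and `c = f` of integral `1`, it
bounds the `L¹` norm of the gradient by the Fisher integral plus `1`. It holds at `c = 0` as well,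
where `G² / 0 = ∞` unless `G = 0`. -/
theorem enorm_le_sq_div_add (G c : ℝ≥0∞) : G ≤ G ^ 2 / c + c := by
  rcases le_or_gt G c with h | h
  · exact h.trans le_add_self
  · refine le_trans ?_ le_self_add
    have hc : c ≠ ⊤ := h.ne_top
    rcases eq_or_ne c 0 with rfl | hc0
    · rw [ENNReal.div_zero (by simpa using h.ne')]; exact le_top
    · rw [ENNReal.le_div_iff_mul_le (Or.inl hc0) (Or.inl hc), sq]
      gcongr

section Translation

variable {N : ℕ} {f : Config N → ℝ} {g : Config N → Config N}

/-- Weak gradients are tested along the coordinate directions, so `t` is expanded in its three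
components, each at most `‖t‖`. This accounts for the factor `3`. -/
theorem abs_integral_fderiv_le (hg : HasWeakGradient f g)
    {i : Fin N} (hgi : Integrable fun v => g v i) {φ : Config N → ℝ} (hf : Integrable f)
    (hφ : ContDiff ℝ ∞ φ) (hc : HasCompactSupport φ) (h01 : ∀ x, φ x ∈ Icc (0 : ℝ) 1)
    (t : Velocity) :
    |∫ v, f v * fderiv ℝ φ v (Pi.single i t)| ≤ 3 * ‖t‖ * ∫ v, ‖g v i‖ := by
  have ht : (Pi.single i t : Config N) =
      ∑ k, t k • (Pi.single i (EuclideanSpace.single k (1 : ℝ)) : Config N) := by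
    ext l m
    by_cases hl : l = i
    · subst hl
      simp [Finset.sum_apply]
      simp [Pi.single_apply]
    · simp [Finset.sum_apply, hl]
  have hdc : Continuous (fderiv ℝ φ) := hφ.continuous_fderiv (by simp)
  have hint : ∀ k, Integrable fun v => f v * fderiv ℝ φ v
      (Pi.single i (EuclideanSpace.single k (1 : ℝ)) : Config N) := fun k => by
    obtain ⟨C, hC⟩ := (hc.fderiv_apply (𝕜 := ℝ) (Pi.single i
      (EuclideanSpace.single k (1 : ℝ)) : Config N)).exists_bound_of_continuous (by fun_prop)
    refine (hf.norm.mul_const C).mono' (hf.1.mul (Continuous.aestronglyMeasurable (by fun_prop)))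
      (ae_of_all _ fun v => ?_)
    rw [norm_mul]
    gcongr
    exact hC v
  have hk : ∀ k, |∫ v, f v * fderiv ℝ φ v (Pi.single i (EuclideanSpace.single k 1))| ≤
      ∫ v, ‖g v i‖ := fun k => by
    rw [hg.2.2 φ hφ hc i k, abs_neg]
    refine (norm_integral_le_integral_norm _).trans (integral_mono_of_nonneg
      (ae_of_all _ fun v => norm_nonneg (_ : ℝ)) hgi.norm (ae_of_all _ fun v => ?_))
    dsimp only
    rw [norm_mul, Real.norm_of_nonneg (h01 v).1]
    have := mul_le_mul (PiLp.norm_apply_le (g v i) k) (h01 v).2 (h01 v).1 (norm_nonneg _)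
    simpa using this
  simp_rw [ht, map_sum, map_smul, smul_eq_mul, Finset.mul_sum, mul_left_comm (f _)]
  rw [integral_finsetSum _ fun k _ => (hint k).const_mul _]
  simp_rw [integral_const_mul]
  refine (Finset.abs_sum_le_sum_abs _ _).trans ?_
  calc ∑ k, |t k * ∫ v, f v * fderiv ℝ φ v (Pi.single i (EuclideanSpace.single k 1))|
      ≤ ∑ _k : Fin 3, ‖t‖ * ∫ v, ‖g v i‖ := by
        refine Finset.sum_le_sum fun k _ => ?_
        rw [abs_mul]
        gcongr
        · exact PiLp.norm_apply_le t k
        · exact hk k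
    _ = _ := by simp; ring

/-- Mean value inequality for `s ↦ ∫ f φ(· + s e)` on `[0, 1]`: its derivative at `s` is the
integral just bounded, for the translated test function. -/
theorem abs_integral_translate_sub_le (hg : HasWeakGradient f g)
    {i : Fin N} (hgi : Integrable fun v => g v i) {φ : Config N → ℝ} (hf : Integrable f)
    (hφ : ContDiff ℝ ∞ φ) (hc : HasCompactSupport φ) (h01 : ∀ x, φ x ∈ Icc (0 : ℝ) 1)
    (t : Velocity) :
    |(∫ v, f v * φ (v + Pi.single i t)) - ∫ v, f v * φ v| ≤ 3 * ‖t‖ * ∫ v, ‖g v i‖ := by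
  set e : Config N := Pi.single i t with he
  have hdc : Continuous (fderiv ℝ φ) := hφ.continuous_fderiv (by simp)
  obtain ⟨C, hC⟩ := (hc.fderiv_apply (𝕜 := ℝ) e).exists_bound_of_continuous (by fun_prop)
  have hφc := hφ.continuous
  have hder : ∀ s : ℝ, HasDerivAt (fun s => ∫ v, f v * φ (v + s • e))
      (∫ v, f v * fderiv ℝ φ (v + s • e) e) s := by
    intro s
    refine (hasDerivAt_integral_of_dominated_loc_of_deriv_le (s := univ)
      (bound := fun v => ‖f v‖ * C)
      (F := fun s v => f v * φ (v + s • e)) (F' := fun s v => f v * fderiv ℝ φ (v + s • e) e)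
      univ_mem ?_ ?_ ?_ ?_ ?_ ?_).2
    · exact Eventually.of_forall fun s =>
        hf.1.mul (Continuous.aestronglyMeasurable (by fun_prop))
    · refine hf.norm.mono' (hf.1.mul (Continuous.aestronglyMeasurable (by fun_prop)))
        (ae_of_all _ fun v => ?_)
      rw [norm_mul, Real.norm_of_nonneg (h01 _).1]
      exact mul_le_of_le_one_right (norm_nonneg _) (h01 _).2
    · exact hf.1.mul (Continuous.aestronglyMeasurable (by fun_prop))
    · refine ae_of_all _ fun v s _ => ?_
      rw [norm_mul]
      gcongr
      exact hC _
    · exact hf.norm.mul_const C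
    · refine ae_of_all _ fun v s _ => ?_
      have h1 : HasDerivAt (fun s : ℝ => v + s • e) e s := by
        simpa using ((hasDerivAt_id s).smul_const e).const_add v
      have h2 : HasFDerivAt φ (fderiv ℝ φ (v + s • e)) (v + s • e) :=
        DifferentiableAt.hasFDerivAt (hφ.differentiable (by simp) _)
      exact (h2.comp_hasDerivAt s h1).const_mul (f v)
  have hbound : ∀ s : ℝ, ‖∫ v, f v * fderiv ℝ φ (v + s • e) e‖ ≤ 3 * ‖t‖ * ∫ v, ‖g v i‖ := by
    intro s
    have hφs : ContDiff ℝ ∞ fun v => φ (v + s • e) := hφ.comp (contDiff_id.add contDiff_const)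
    have hcs : HasCompactSupport fun v => φ (v + s • e) :=
      hc.comp_homeomorph (Homeomorph.addRight (s • e))
    have := abs_integral_fderiv_le hg hgi hf hφs hcs (fun v => h01 _) t
    simpa only [fderiv_comp_add_right, Real.norm_eq_abs] using this
  have := norm_image_sub_le_of_norm_deriv_le_segment_01' (fun s _ => (hder s).hasDerivWithinAt)
    fun s _ => hbound s
  simpa using this

end Translation

theorem integrable_density {N : ℕ} (F : Measure (Config N)) [IsFiniteMeasure F] :
    Integrable (density F) :=
  Measure.integrable_toReal_rnDeriv

theorem integral_density_mul {N : ℕ} {F : Measure (Config N)} [IsFiniteMeasure F]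
    (hF : F ≪ volume) (φ : Config N → ℝ) : ∫ v, density F v * φ v = ∫ v, φ v ∂F := by
  have := integral_rnDeriv_smul (μ := F) (ν := volume) hF (f := φ)
  simpa [density, smul_eq_mul, measureReal_def] using this

theorem measure_le_translate_add {N : ℕ} {F : Measure (Config N)} [IsFiniteMeasure F]
    (hF : F ≪ volume) {g : Config N → Config N} (hg : HasWeakGradient (density F) g) {i : Fin N}
    (hgi : Integrable fun v => g v i) (t : Velocity) {E : Set (Config N)} (hE : MeasurableSet E) :
    F E ≤ F {v | v + Pi.single i t ∈ E} + ENNReal.ofReal (3 * ‖t‖) * ∫⁻ v, ‖g v i‖ₑ := by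
  have hτ : Measurable fun v : Config N => v + Pi.single i t := by fun_prop
  have hle := measure_le_add_of_smooth (μ := F) (ν := F.map fun v => v + Pi.single i t)
    (C := 3 * ‖t‖ * ∫ v, ‖g v i‖) (by positivity) ?_ hE
  · rw [Measure.map_apply hτ hE] at hle
    refine hle.trans_eq ?_
    rw [ENNReal.ofReal_mul (by positivity), ofReal_integral_norm_eq_lintegral_enorm hgi]
    rfl
  · intro φ hφ hc h01
    have hφc := hφ.continuous
    rw [integral_map hτ.aemeasurable hφc.aestronglyMeasurable, ← integral_density_mul hF,
      ← integral_density_mul hF]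
    have := abs_le.1 (abs_integral_translate_sub_le hg hgi (integrable_density F) hφ hc h01 t)
    linarith

theorem sum_lintegral_enorm_gradient_le {N : ℕ} {F : Measure (Config N)} [IsProbabilityMeasure F]
    (hF : F ≪ volume) {g : Config N → Config N} (hg : HasWeakGradient (density F) g) :
    ∑ i, ∫⁻ v, ‖g v i‖ₑ ≤
      (∫⁻ v, (∑ i, ‖g v i‖ₑ ^ 2) / ENNReal.ofReal (density F v)) + N := by
  have hd := (measurable_density F).ennreal_ofReal
  have hgm : ∀ i, AEMeasurable (fun v => g v i) volume := fun i =>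
    (measurable_pi_apply i).comp_aemeasurable hg.2.1.aestronglyMeasurable.aemeasurable
  have hone : ∫⁻ v, ENNReal.ofReal (density F v) = 1 := by
    have := lintegral_ofReal_density_mul hF (measurable_const (a := (1 : ℝ≥0∞)))
    simpa using this
  have hsum : ∀ v, (∑ i, ‖g v i‖ₑ ^ 2) / ENNReal.ofReal (density F v) =
      ∑ i, ‖g v i‖ₑ ^ 2 / ENNReal.ofReal (density F v) := fun v => by
    simp only [div_eq_mul_inv, Finset.sum_mul]
  simp_rw [hsum]
  have hq : ∀ i ∈ (Finset.univ : Finset (Fin N)), AEMeasurable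
      (fun v => ‖g v i‖ₑ ^ 2 / ENNReal.ofReal (density F v)) volume := fun i _ =>
    ((hgm i).enorm.pow_const 2).div hd.aemeasurable
  rw [lintegral_finsetSum' _ hq]
  have hN : (N : ℝ≥0∞) = ∑ _i : Fin N, ∫⁻ v, ENNReal.ofReal (density F v) := by simp [hone]
  rw [hN, ← Finset.sum_add_distrib]
  refine Finset.sum_le_sum fun i _ => ?_
  rw [← lintegral_add_right _ hd]
  exact lintegral_mono fun v => enorm_le_sq_div_add _ _

theorem lintegral_mixture (ν : Measure (ProbabilityMeasure Velocity)) (j : ℕ)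
    {h : Config j → ℝ≥0∞} (hh : Measurable h) :
    ∫⁻ v, h v ∂(mixture ν j) = ∫⁻ ρ, ∫⁻ v, h v ∂(tensorPower j ρ) ∂ν :=
  Measure.lintegral_bind (measurable_tensorPower j).aemeasurable hh.aemeasurable

instance (ν : ProbabilityMeasure (ProbabilityMeasure Velocity)) (j : ℕ) :
    IsProbabilityMeasure (mixture (ν : Measure (ProbabilityMeasure Velocity)) j) :=
  ⟨by rw [mixture_apply _ _ MeasurableSet.univ]; simp⟩

theorem map_perm_tensorPower (ρ : ProbabilityMeasure Velocity) {j : ℕ} (e : Equiv.Perm (Fin j)) :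
    (tensorPower j ρ).map (fun v i => v (e i)) = tensorPower j ρ := by
  refine (Measure.pi_eq fun s hs => ?_).symm
  have hm : Measurable fun (v : Config j) i => v (e i) := by fun_prop
  rw [Measure.map_apply hm (MeasurableSet.univ_pi hs)]
  have : (fun (v : Config j) i => v (e i)) ⁻¹' (univ.pi s) = univ.pi fun i => s (e.symm i) := by
    ext v
    simp only [mem_preimage, Set.mem_pi, mem_univ, true_imp_iff]
    exact ⟨fun h i => by simpa using h (e.symm i), fun h i => by simpa using h (e i)⟩
  rw [this, tensorPower, Measure.pi_pi]
  exact Equiv.prod_comp e.symm fun i => (ρ : Measure Velocity) (s i)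

theorem mixture_preimage_perm (ν : Measure (ProbabilityMeasure Velocity)) {j : ℕ}
    (e : Equiv.Perm (Fin j)) {E : Set (Config j)} (hE : MeasurableSet E) :
    mixture ν j {v | (fun i => v (e i)) ∈ E} = mixture ν j E := by
  have hm : Measurable fun (v : Config j) i => v (e i) := by fun_prop
  have hE' : MeasurableSet {v : Config j | (fun i => v (e i)) ∈ E} := hm hE
  rw [mixture_apply _ _ hE, mixture_apply _ _ hE']
  refine lintegral_congr fun ρ => ?_
  conv_rhs => rw [← map_perm_tensorPower ρ e, Measure.map_apply hm hE]
  rfl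

/-- The normalized Fisher information controls the gradients only in sum, by `N (A + 1)`. By
exchangeability, translating velocity `i` instead of velocity `0` gives the same inequality with the
`i`-th gradient; averaging over `i` leaves a constant free of `N`. -/
theorem mixture_le_translate_add (ν : ProbabilityMeasure (ProbabilityMeasure Velocity)) {j : ℕ}
    {A : ℝ≥0∞} (hA : fisherInformation (mixture (ν : Measure (ProbabilityMeasure Velocity)) (j + 1)) < A)
    (t : Velocity) {E : Set (Config (j + 1))} (hE : MeasurableSet E) :
    mixture (ν : Measure (ProbabilityMeasure Velocity)) (j + 1) E ≤
      mixture (ν : Measure (ProbabilityMeasure Velocity)) (j + 1) {v | v + Pi.single 0 t ∈ E} +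
        ENNReal.ofReal (3 * ‖t‖) * (A + 1) := by
  set F := mixture (ν : Measure (ProbabilityMeasure Velocity)) (j + 1) with hFdef
  by_cases hF : F ≪ volume
  swap
  · rw [fisherInformation, if_neg hF] at hA
    exact absurd hA not_top_lt
  rw [fisherInformation, if_pos hF] at hA
  simp only [iInf_lt_iff] at hA
  obtain ⟨g, hg, hlt⟩ := hA
  set N : ℝ≥0∞ := ((j + 1 : ℕ) : ℝ≥0∞) with hN
  have hN0 : N ≠ 0 := by simp [hN]
  have hNt : N ≠ ⊤ := ENNReal.natCast_ne_top _
  set J := ∫⁻ v, (∑ i, ‖g v i‖ₑ ^ 2) / ENNReal.ofReal (density F v)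
  have hJ : J ≤ N * A := by
    have := mul_le_mul_right hlt.le N
    rwa [← mul_assoc, ENNReal.mul_inv_cancel hN0 hNt, one_mul] at this
  have hJt : J ≠ ⊤ := by
    intro h
    rw [h, ENNReal.mul_top (ENNReal.inv_ne_zero.2 hNt)] at hlt
    exact not_top_lt hlt
  have hsum := sum_lintegral_enorm_gradient_le hF hg
  have hgi : ∀ i, Integrable fun v => g v i := by
    intro i
    refine ⟨((measurable_pi_apply i).comp_aemeasurable
      hg.2.1.aestronglyMeasurable.aemeasurable).aestronglyMeasurable, ?_⟩
    refine lt_of_le_of_lt (Finset.single_le_sum (f := fun i => ∫⁻ v, ‖g v i‖ₑ)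
      (fun i _ => zero_le) (Finset.mem_univ i)) (hsum.trans_lt ?_)
    exact ENNReal.add_lt_top.2 ⟨hJt.lt_top, hNt.lt_top⟩
  have key : ∀ i : Fin (j + 1), F E ≤ F {v | v + Pi.single 0 t ∈ E} +
      ENNReal.ofReal (3 * ‖t‖) * ∫⁻ v, ‖g v i‖ₑ := by
    intro i
    have hm : Measurable fun (v : Config (j + 1)) l => v (Equiv.swap 0 i l) := by fun_prop
    have hτ : Measurable fun v : Config (j + 1) => v + Pi.single 0 t := by fun_prop
    -- The estimate for the `i`-th velocity is applied to `E` with coordinates `0` and `i` swapped,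
    -- then the swap is undone by symmetry of the mixture.
    have h1 := measure_le_translate_add hF hg (hgi i) t
      (E := {v | (fun l => v (Equiv.swap 0 i l)) ∈ E}) (hm hE)
    rw [hFdef, mixture_preimage_perm _ _ hE, ← hFdef] at h1
    refine h1.trans_eq ?_
    congr 1
    have hτE : MeasurableSet {v : Config (j + 1) | v + Pi.single 0 t ∈ E} := hτ hE
    rw [hFdef, ← mixture_preimage_perm _ (Equiv.swap 0 i) hτE]
    congr 1
    ext v
    simp only [mem_ofPred_eq]
    have : (fun l => (v + Pi.single i t : Config (j + 1)) (Equiv.swap 0 i l)) =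
        (fun l => v (Equiv.swap 0 i l)) + Pi.single 0 t := by
      funext l
      simp only [Pi.add_apply]
      congr 1
      by_cases hl : l = 0
      · subst hl; simp
      · have : Equiv.swap 0 i l ≠ i := by
          intro h
          apply hl
          have := congrArg (Equiv.swap 0 i) h
          simpa using this
        simp [Pi.single_eq_of_ne hl, Pi.single_eq_of_ne this]
    rw [this]
  have htot : N * F E ≤ N * (F {v | v + Pi.single 0 t ∈ E} +
      ENNReal.ofReal (3 * ‖t‖) * (A + 1)) := by
    have h1 := Finset.sum_le_sum fun i (_ : i ∈ Finset.univ) => key i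
    rw [Finset.sum_add_distrib, ← Finset.mul_sum] at h1
    simp only [Finset.sum_const, Finset.card_univ, Fintype.card_fin, nsmul_eq_mul, ← hN] at h1
    refine h1.trans ?_
    rw [mul_add]
    refine add_le_add le_rfl ?_
    rw [mul_left_comm]
    gcongr
    refine hsum.trans ?_
    rw [mul_add, mul_one]
    gcongr
  exact (ENNReal.mul_le_mul_iff_right hN0 hNt).1 htot

/-! ### Jointly measurable densities -/

/-- The identity `ρ ↦ ρ` as a Markov kernel. -/
noncomputable def velocityKernel : Kernel (ProbabilityMeasure Velocity) Velocity :=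
  ⟨fun ρ => (ρ : Measure Velocity), measurable_subtype_coe⟩

instance : IsMarkovKernel velocityKernel :=
  ⟨fun ρ => inferInstanceAs (IsProbabilityMeasure (ρ : Measure Velocity))⟩

/-- Under `ν^{j+1}`, the first velocity is drawn jointly with `ρ` and the other `j` form a further
sample of `ρ`, which is the situation of `coupling`. -/
theorem lintegral_mixture_succ (ν : Measure (ProbabilityMeasure Velocity)) [SFinite ν] (j : ℕ)
    {h : Config (j + 1) → ℝ≥0∞} (hh : Measurable h) :
    ∫⁻ v, h v ∂(mixture ν (j + 1)) =
      ∫⁻ y, ∫⁻ w, h (Fin.cons y.2 w) ∂(tensorPower j y.1) ∂(ν ⊗ₘ velocityKernel) := by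
  have hcons := fun ρ : ProbabilityMeasure Velocity =>
    measurePreserving_cons (ρ : Measure Velocity) j
  have hm : Measurable fun q : (ProbabilityMeasure Velocity × Velocity) × Config j =>
      h (Fin.cons q.1.2 q.2) :=
    hh.comp ((measurePreserving_cons volume j).measurable.comp
      ((measurable_snd.comp measurable_fst).prodMk measurable_snd))
  have hm' : Measurable fun y : ProbabilityMeasure Velocity × Velocity =>
      ∫⁻ w, h (Fin.cons y.2 w) ∂(tensorPower j y.1) :=
    hm.lintegral_kernel_prod_right' (κ := (tensorKernel j).comap Prod.fst measurable_fst)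
  rw [lintegral_mixture _ _ hh, Measure.lintegral_compProd hm']
  refine lintegral_congr fun ρ => ?_
  have hc : Measurable fun p : Velocity × Config j => h (Fin.cons p.1 p.2) :=
    hh.comp (hcons ρ).measurable
  have h1 : ∫⁻ v, h v ∂(tensorPower (j + 1) ρ) = ∫⁻ p : Velocity × Config j, h (Fin.cons p.1 p.2)
      ∂((ρ : Measure Velocity).prod (tensorPower j ρ)) := ((hcons ρ).lintegral_comp hh).symm
  rw [h1, lintegral_prod _ hc.aemeasurable]
  rfl

/-- Translation of the velocity. -/
def translateVelocity (t : Velocity) (y : ProbabilityMeasure Velocity × Velocity) :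
    ProbabilityMeasure Velocity × Velocity := (y.1, y.2 + t)

theorem measurable_translateVelocity (t : Velocity) : Measurable (translateVelocity t) := by
  unfold translateVelocity; fun_prop

/-- An event about `(ρ, v)` is nearly an event `T` about `v` and a sample of `ρ`, hence an event for
`ν^{j+1}`. There the translation estimate has a constant independent of `j`, and translating `v`
leaves the sample untouched. -/
theorem compProd_le_translate_add (ν : ProbabilityMeasure (ProbabilityMeasure Velocity))
    {A : ℝ≥0∞} (hA : ∀ j, fisherInformation
      (mixture (ν : Measure (ProbabilityMeasure Velocity)) (j + 1)) < A)
    (t : Velocity) {E : Set (ProbabilityMeasure Velocity × Velocity)} (hE : MeasurableSet E) :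
    ((ν : Measure (ProbabilityMeasure Velocity)) ⊗ₘ velocityKernel) E ≤
      ((ν : Measure (ProbabilityMeasure Velocity)) ⊗ₘ velocityKernel) (translateVelocity t ⁻¹' E) +
        ENNReal.ofReal (3 * ‖t‖) * (A + 1) := by
  set θ₀ := (ν : Measure (ProbabilityMeasure Velocity)) ⊗ₘ velocityKernel with hθ₀
  have hτ := measurable_translateVelocity t
  let θ₁ := θ₀.map (translateVelocity t)
  have : IsFiniteMeasure θ₁ := by unfold θ₁; infer_instance
  refine ENNReal.le_of_forall_pos_le_add fun ε hε _ => ?_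
  have hε' : (ε : ℝ≥0∞) / 2 ≠ 0 := by simpa using hε.ne'
  -- Approximating under the sum makes one `T` serve for the law and for its translate.
  obtain ⟨j, T, hT, hle⟩ := (SampleApproximable.of_measurableSet (θ := θ₀ + θ₁) hE _ hε').exists
  have hadd : coupling (θ₀ + θ₁) j = coupling θ₀ j + coupling θ₁ j :=
    Measure.compProd_add_left _ _ _
  rw [hadd, Measure.add_apply] at hle
  have hπ : Measurable fun q : (ProbabilityMeasure Velocity × Velocity) × Config j =>
      (q.1.2, q.2) := by fun_prop
  have hTπ : MeasurableSet {q : (ProbabilityMeasure Velocity × Velocity) × Config j |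
      (q.1.2, q.2) ∈ T} := hπ hT
  let T' : Set (Config (j + 1)) := {v | (v 0, fun i : Fin j => v i.succ) ∈ T}
  have hsplit : Measurable fun v : Config (j + 1) => (v 0, fun i : Fin j => v i.succ) := by fun_prop
  have hT' : MeasurableSet T' := hsplit hT
  have hT'' : MeasurableSet {v : Config (j + 1) | v + Pi.single 0 t ∈ T'} := by
    have : Measurable fun v : Config (j + 1) => v + Pi.single 0 t := by fun_prop
    exact this hT'
  have e0 : coupling θ₀ j {q | (q.1.2, q.2) ∈ T} =
      mixture (ν : Measure (ProbabilityMeasure Velocity)) (j + 1) T' := by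
    rw [← lintegral_indicator_one hT', lintegral_mixture_succ _ _ (measurable_one.indicator hT'),
      ← lintegral_indicator_one hTπ, lintegral_coupling _ (measurable_one.indicator hTπ)]
    rfl
  have e1 : coupling θ₁ j {q | (q.1.2, q.2) ∈ T} =
      mixture (ν : Measure (ProbabilityMeasure Velocity)) (j + 1) {v | v + Pi.single 0 t ∈ T'} := by
    have hmm : Measurable fun y : ProbabilityMeasure Velocity × Velocity =>
        ∫⁻ w, {q : (ProbabilityMeasure Velocity × Velocity) × Config j |
          (q.1.2, q.2) ∈ T}.indicator (fun _ => (1 : ℝ≥0∞)) (y, w) ∂(tensorPower j y.1) :=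
      (measurable_const.indicator hTπ).lintegral_kernel_prod_right'
        (κ := (tensorKernel j).comap Prod.fst measurable_fst)
    rw [← lintegral_indicator_one hT'', lintegral_mixture_succ _ _ (measurable_one.indicator hT''),
      ← lintegral_indicator_one hTπ, lintegral_coupling _ (measurable_one.indicator hTπ)]
    refine (lintegral_map hmm hτ).trans ?_
    refine lintegral_congr fun y => lintegral_congr fun w => ?_
    simp only [indicator, mem_ofPred_eq, T', translateVelocity]
    congr 1
    simp
  have f0 : coupling θ₀ j (Prod.fst ⁻¹' E) = θ₀ E :=
    (measurePreserving_fst_coupling (θ := θ₀) j).measure_preimage hE.nullMeasurableSet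
  have f1 : coupling θ₁ j (Prod.fst ⁻¹' E) = θ₀ (translateVelocity t ⁻¹' E) := by
    rw [(measurePreserving_fst_coupling (θ := θ₁) j).measure_preimage hE.nullMeasurableSet,
      Measure.map_apply hτ hE]
  set D : Set ((ProbabilityMeasure Velocity × Velocity) × Config j) :=
    {q | ¬(q.1 ∈ E ↔ (q.1.2, q.2) ∈ T)}
  have s0 : Prod.fst ⁻¹' E ⊆ {q | (q.1.2, q.2) ∈ T} ∪ D := by
    intro q hq
    simp only [mem_union, mem_ofPred_eq, D]
    have : q.1 ∈ E := hq
    tauto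
  have s1 : {q : (ProbabilityMeasure Velocity × Velocity) × Config j | (q.1.2, q.2) ∈ T} ⊆
      Prod.fst ⁻¹' E ∪ D := by
    intro q hq
    simp only [mem_union, mem_ofPred_eq, D, mem_preimage] at hq ⊢
    tauto
  calc θ₀ E = coupling θ₀ j (Prod.fst ⁻¹' E) := f0.symm
    _ ≤ coupling θ₀ j {q | (q.1.2, q.2) ∈ T} + coupling θ₀ j D :=
        (measure_mono s0).trans (measure_union_le _ _)
    _ ≤ (coupling θ₁ j {q | (q.1.2, q.2) ∈ T} + ENNReal.ofReal (3 * ‖t‖) * (A + 1)) + ε / 2 := by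
        rw [e0, e1]
        gcongr
        · exact mixture_le_translate_add ν (hA j) t hT'
        · exact le_self_add.trans hle
    _ ≤ ((θ₀ (translateVelocity t ⁻¹' E) + ε / 2) +
          ENNReal.ofReal (3 * ‖t‖) * (A + 1)) + ε / 2 := by
        gcongr
        refine (measure_mono s1).trans ((measure_union_le _ _).trans ?_)
        rw [f1]
        gcongr
        exact le_add_self.trans hle
    _ = _ := by
        conv_rhs => rw [← ENNReal.add_halves (ε : ℝ≥0∞)]
        ring

/-- If `E` is null for `ν ⊗ dv`, Fubini shows that almost every translate of `E` is null for the
joint law. Such translations can be chosen arbitrarily small, and the translation estimate forces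
`E` itself to be null. -/
theorem compProd_velocityKernel_absolutelyContinuous
    (ν : ProbabilityMeasure (ProbabilityMeasure Velocity))
    {A : ℝ≥0∞} (hAt : A ≠ ⊤) (hA : ∀ j, fisherInformation
      (mixture (ν : Measure (ProbabilityMeasure Velocity)) (j + 1)) < A) :
    (ν : Measure (ProbabilityMeasure Velocity)) ⊗ₘ velocityKernel ≪
      (ν : Measure (ProbabilityMeasure Velocity)).prod volume := by
  refine Measure.AbsolutelyContinuous.mk fun E hE hnull => ?_
  set θ₀ := (ν : Measure (ProbabilityMeasure Velocity)) ⊗ₘ velocityKernel with hθ₀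
  have hm : MeasurableSet {q : Velocity × ProbabilityMeasure Velocity × Velocity |
      translateVelocity q.1 q.2 ∈ E} := by
    have : Measurable fun q : Velocity × ProbabilityMeasure Velocity × Velocity =>
      translateVelocity q.1 q.2 := by unfold translateVelocity; fun_prop
    exact this hE
  have hzero : (volume.prod θ₀) {q | translateVelocity q.1 q.2 ∈ E} = 0 := by
    rw [Measure.prod_apply_symm hm, lintegral_eq_zero_iff (measurable_measure_prodMk_right hm)]
    have h1 : ∀ᵐ ρ : ProbabilityMeasure Velocity ∂(ν : Measure (ProbabilityMeasure Velocity)),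
        volume (Prod.mk ρ ⁻¹' E) = 0 := Measure.measure_ae_null_of_prod_null hnull
    have h2 : ∀ᵐ y ∂θ₀, volume (Prod.mk y.1 ⁻¹' E) = 0 := by
      have : Measure.QuasiMeasurePreserving Prod.fst θ₀
          (ν : Measure (ProbabilityMeasure Velocity)) :=
        (⟨measurable_fst, Measure.fst_compProd _ _⟩ : MeasurePreserving _ _ _).quasiMeasurePreserving
      exact this.ae h1
    filter_upwards [h2] with y hy
    have : (fun t => (t, y)) ⁻¹' {q : Velocity × ProbabilityMeasure Velocity × Velocity |
        translateVelocity q.1 q.2 ∈ E} = (fun t => y.2 + t) ⁻¹' (Prod.mk y.1 ⁻¹' E) := rfl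
    rw [this, measure_preimage_add, hy]
    rfl
  have hae : ∀ᵐ t : Velocity, θ₀ (translateVelocity t ⁻¹' E) = 0 :=
    Measure.measure_ae_null_of_prod_null hzero
  have hAt' : A + 1 ≠ ⊤ := by simpa using hAt
  have hlim : Tendsto (fun n : ℕ => ENNReal.ofReal (3 * (1 / ((n : ℝ) + 1))) * (A + 1)) atTop
      (𝓝 0) := by
    have h1 := (tendsto_one_div_add_atTop_nhds_zero_nat (𝕜 := ℝ)).const_mul 3
    have h2 := ENNReal.Tendsto.mul_const (ENNReal.tendsto_ofReal h1) (Or.inr hAt')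
    simpa using h2
  refine le_antisymm (ge_of_tendsto' hlim fun n => ?_) zero_le
  have hr : (0 : ℝ) < 1 / ((n : ℝ) + 1) := Nat.one_div_pos_of_nat
  obtain ⟨t, ht0, ht⟩ : ∃ t : Velocity, θ₀ (translateVelocity t ⁻¹' E) = 0 ∧
      t ∈ Metric.ball (0 : Velocity) (1 / ((n : ℝ) + 1)) := by
    by_contra! hcon
    have h1 : Metric.ball (0 : Velocity) (1 / ((n : ℝ) + 1)) ⊆
        {t | ¬θ₀ (translateVelocity t ⁻¹' E) = 0} := fun t ht h => hcon t h ht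
    exact (Metric.measure_ball_pos volume (0 : Velocity) hr).ne' (measure_mono_null h1 hae)
  have := compProd_le_translate_add ν hA t hE
  rw [← hθ₀, ht0, zero_add] at this
  refine this.trans ?_
  gcongr
  exact (mem_ball_zero_iff.1 ht).le

/-- A jointly measurable version of the density of `ρ`. -/
theorem exists_joint_density (ν : ProbabilityMeasure (ProbabilityMeasure Velocity))
    {A : ℝ≥0∞} (hAt : A ≠ ⊤) (hA : ∀ j, fisherInformation
      (mixture (ν : Measure (ProbabilityMeasure Velocity)) (j + 1)) < A) :
    ∃ d : ProbabilityMeasure Velocity × Velocity → ℝ≥0, Measurable d ∧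
      ∀ᵐ ρ : ProbabilityMeasure Velocity ∂(ν : Measure (ProbabilityMeasure Velocity)),
        (ρ : Measure Velocity) = volume.withDensity fun v => (d (ρ, v) : ℝ≥0∞) := by
  -- Radon–Nikodym derivatives of kernels are taken against a finite kernel, so Lebesgue measure is
  -- replaced by an equivalent finite `γ`, whose own density is multiplied back in `d`.
  let γ : Measure Velocity := volume.toFinite
  have hγ : (volume : Measure Velocity) ≪ γ := absolutelyContinuous_toFinite _
  have hγ' : γ ≪ volume := toFinite_absolutelyContinuous _
  let η : Kernel (ProbabilityMeasure Velocity) Velocity := Kernel.const _ γ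
  have hac : ∀ᵐ ρ ∂(ν : Measure (ProbabilityMeasure Velocity)), velocityKernel ρ ≪ η ρ := by
    refine Measure.AbsolutelyContinuous.kernel_of_compProd
      (ν := (ν : Measure (ProbabilityMeasure Velocity))) ?_
    rw [Measure.compProd_const]
    exact (compProd_velocityKernel_absolutelyContinuous ν hAt hA).trans
      (Measure.AbsolutelyContinuous.rfl.prod hγ)
  let d : ProbabilityMeasure Velocity × Velocity → ℝ≥0 := fun y =>
    (γ.rnDeriv volume y.2 * velocityKernel.rnDeriv η y.1 y.2).toNNReal
  refine ⟨d, ?_, ?_⟩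
  · have h1 : Measurable fun y : ProbabilityMeasure Velocity × Velocity =>
        velocityKernel.rnDeriv η y.1 y.2 := Kernel.measurable_rnDeriv _ _
    have h2 := Measure.measurable_rnDeriv γ volume
    exact ((h2.comp measurable_snd).mul h1).ennreal_toNNReal
  · filter_upwards [hac] with ρ hρ
    have h1 := Kernel.withDensity_rnDeriv_eq hρ
    have hm : Measurable fun v => velocityKernel.rnDeriv η ρ v := Kernel.measurable_rnDeriv_right _ _ _
    rw [Kernel.withDensity_apply _ (Kernel.measurable_rnDeriv _ _)] at h1
    have h2 : (ρ : Measure Velocity) = volume.withDensity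
        (γ.rnDeriv volume * velocityKernel.rnDeriv η ρ) := by
      rw [withDensity_mul _ (Measure.measurable_rnDeriv γ volume) hm,
        Measure.withDensity_rnDeriv_eq γ volume hγ']
      exact h1.symm
    conv_lhs => rw [h2]
    refine withDensity_congr_ae ?_
    have hfin : ∫⁻ v, (γ.rnDeriv volume * velocityKernel.rnDeriv η ρ) v ≠ ⊤ := by
      rw [← setLIntegral_univ, ← withDensity_apply _ MeasurableSet.univ, ← h2]
      exact measure_ne_top _ _
    filter_upwards [ae_lt_top ((Measure.measurable_rnDeriv γ volume).mul hm) hfin] with v hv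
    exact (ENNReal.coe_toNNReal hv.ne).symm

/-! ### Entropy production of products and mixtures -/

theorem lintegral_config_prod {n : ℕ} {g : Fin n → Velocity → ℝ≥0∞} (hg : ∀ i, Measurable (g i)) :
    ∫⁻ v : Config n, ∏ i, g i (v i) = ∏ i, ∫⁻ x, g i x := by
  induction n with
  | zero => simp [volume_pi]
  | succ n ih =>
    have hm : Measurable fun v : Config (n + 1) => ∏ i, g i (v i) :=
      Finset.measurable_prod _ fun i _ => (hg i).comp (measurable_pi_apply i)
    have hm' : Measurable fun v : Config n => ∏ i, g (Fin.succ i) (v i) :=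
      Finset.measurable_prod _ fun i _ => (hg i.succ).comp (measurable_pi_apply i)
    have h1 := (measurePreserving_cons volume n).lintegral_comp hm
    rw [← volume_pi, ← volume_pi] at h1
    rw [← h1]
    simp only [Fin.prod_univ_succ, Fin.cons_zero, Fin.cons_succ]
    have h2 := lintegral_prod_mul (μ := (volume : Measure Velocity))
      (ν := (volume : Measure (Config n))) (hg 0).aemeasurable hm'.aemeasurable
    rw [h2, ih fun i => hg i.succ]

theorem tensorPower_eq_withDensity {ρ : ProbabilityMeasure Velocity} {f : Velocity → ℝ≥0∞}
    (hf : Measurable f) (h : (ρ : Measure Velocity) = volume.withDensity f) (n : ℕ) :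
    tensorPower n ρ = volume.withDensity fun v => ∏ i, f (v i) := by
  refine Measure.pi_eq fun s hs => ?_
  have hS : MeasurableSet (univ.pi s) := MeasurableSet.univ_pi hs
  rw [withDensity_apply _ hS, ← lintegral_indicator hS]
  have : ∀ v : Config n, (univ.pi s).indicator (fun v => ∏ i, f (v i)) v =
      ∏ i, (s i).indicator f (v i) := by
    intro v
    by_cases hv : v ∈ univ.pi s
    · rw [indicator_of_mem hv]
      exact Finset.prod_congr rfl fun i _ => (indicator_of_mem (hv i (mem_univ i)) f).symm
    · rw [indicator_of_notMem hv]
      simp only [Set.mem_pi, mem_univ, true_imp_iff, not_forall] at hv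
      obtain ⟨i, hi⟩ := hv
      exact (Finset.prod_eq_zero (Finset.mem_univ i) (indicator_of_notMem hi f)).symm
  simp_rw [this]
  rw [lintegral_config_prod fun i => hf.indicator (hs i)]
  refine Finset.prod_congr rfl fun i _ => ?_
  rw [h, withDensity_apply _ (hs i), lintegral_indicator (hs i)]

/-- The density of `ρ^{⊗ n}`, when `d (ρ, ·)` is a density of `ρ`. -/
def tensorDensity (d : ProbabilityMeasure Velocity × Velocity → ℝ≥0) {n : ℕ}
    (q : ProbabilityMeasure Velocity × Config n) : ℝ≥0 := ∏ i, d (q.1, q.2 i)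

/-- The density of `ρ ⊗ ρ` before the collision. -/
noncomputable def preDensity (d : ProbabilityMeasure Velocity × Velocity → ℝ≥0)
    (y : ProbabilityMeasure Velocity × CollisionCoord) : ℝ≥0 :=
  d (y.1, (pairPoint (y.2.1, y.2.2.2)).1) * d (y.1, (pairPoint (y.2.1, y.2.2.2)).2)

/-- The density of `ρ ⊗ ρ` after the collision. -/
noncomputable def postDensity (d : ProbabilityMeasure Velocity × Velocity → ℝ≥0)
    (y : ProbabilityMeasure Velocity × CollisionCoord) : ℝ≥0 :=
  d (y.1, (pairPoint y.2.2).1) * d (y.1, (pairPoint y.2.2).2)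

section JointDensity

variable {d : ProbabilityMeasure Velocity × Velocity → ℝ≥0}

theorem measurable_tensorDensity (hd : Measurable d) {n : ℕ} :
    Measurable (tensorDensity d (n := n)) := by
  unfold tensorDensity; fun_prop

theorem measurable_postDensity (hd : Measurable d) : Measurable (postDensity d) := by
  have := measurable_pairPoint
  unfold postDensity; fun_prop

theorem measurable_preDensity (hd : Measurable d) : Measurable (preDensity d) := by
  have := measurable_pairPoint
  unfold preDensity; fun_prop

theorem tensorDensity_preCollision {n : ℕ} (ρ : ProbabilityMeasure Velocity)
    (p : CollisionCoord × Config n) :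
    tensorDensity d (ρ, preCollision p) = tensorDensity d (ρ, p.2) * preDensity d (ρ, p.1) := by
  simp only [tensorDensity, preDensity, preCollision, consPair, Fin.prod_univ_succ, Fin.cons_zero,
    Fin.cons_succ]
  ring

theorem tensorDensity_postCollision {n : ℕ} (ρ : ProbabilityMeasure Velocity)
    (p : CollisionCoord × Config n) :
    tensorDensity d (ρ, postCollision p) = tensorDensity d (ρ, p.2) * postDensity d (ρ, p.1) := by
  simp only [tensorDensity, postDensity, postCollision, consPair, Fin.prod_univ_succ,
    Fin.cons_zero, Fin.cons_succ]
  ring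

theorem tensorPower_eq_withDensity_tensorDensity (hd : Measurable d)
    {ρ : ProbabilityMeasure Velocity}
    (h : (ρ : Measure Velocity) = volume.withDensity fun v => (d (ρ, v) : ℝ≥0∞)) (n : ℕ) :
    tensorPower n ρ = volume.withDensity fun v => (tensorDensity d (ρ, v) : ℝ≥0∞) := by
  rw [tensorPower_eq_withDensity (by fun_prop) h]
  simp [tensorDensity]

theorem lintegral_tensorDensity (hd : Measurable d) {ρ : ProbabilityMeasure Velocity}
    (h : (ρ : Measure Velocity) = volume.withDensity fun v => (d (ρ, v) : ℝ≥0∞)) (n : ℕ) :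
    ∫⁻ v : Config n, (tensorDensity d (ρ, v) : ℝ≥0∞) = 1 := by
  rw [← setLIntegral_univ, ← withDensity_apply _ MeasurableSet.univ,
    ← tensorPower_eq_withDensity_tensorDensity hd h, measure_univ]

/-- The entropy production of `ρ ⊗ ρ` in terms of the density. -/
noncomputable def pairProduction (d : ProbabilityMeasure Velocity × Velocity → ℝ≥0)
    (b : CollisionCoord → ℝ≥0∞) (ρ : ProbabilityMeasure Velocity) : ℝ≥0∞ :=
  ∫⁻ x, sqrtDiff (preDensity d (ρ, x)) (postDensity d (ρ, x)) * b x ∂collisionMeasure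

theorem measurable_pairProduction_integrand (hd : Measurable d) {b : CollisionCoord → ℝ≥0∞}
    (hb : Measurable b) : Measurable fun y : ProbabilityMeasure Velocity × CollisionCoord =>
      sqrtDiff (preDensity d y) (postDensity d y) * b y.2 :=
  (measurable_sqrtDiff_comp (measurable_preDensity hd).coe_nnreal_real
    (measurable_postDensity hd).coe_nnreal_real).mul (hb.comp measurable_snd)

theorem measurable_pairProduction (hd : Measurable d) {b : CollisionCoord → ℝ≥0∞}
    (hb : Measurable b) : Measurable (pairProduction d b) :=
  (measurable_pairProduction_integrand hd hb).lintegral_prod_right'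

/-- The spectators contribute the same factor before and after the collision; homogeneity pulls it
out, and it integrates to `1`. Hence the value does not depend on `n`. -/
theorem production_tensorDensity (hd : Measurable d) {b : CollisionCoord → ℝ≥0∞}
    (hb : Measurable b) {ρ : ProbabilityMeasure Velocity}
    (h : (ρ : Measure Velocity) = volume.withDensity fun v => (d (ρ, v) : ℝ≥0∞)) (n : ℕ) :
    production b (fun v : Config (n + 2) => (tensorDensity d (ρ, v) : ℝ)) =
      pairProduction d b ρ := by
  have hm : Measurable fun v : Config (n + 2) => (tensorDensity d (ρ, v) : ℝ) :=
    ((measurable_tensorDensity hd).comp measurable_prodMk_left).coe_nnreal_real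
  have hm' : Measurable fun v : Config n => (tensorDensity d (ρ, v) : ℝ≥0∞) :=
    ((measurable_tensorDensity hd).comp measurable_prodMk_left).coe_nnreal_ennreal
  rw [production, lintegral_prod _ (measurable_production_integrand hb hm).aemeasurable]
  refine lintegral_congr fun x => ?_
  have : ∀ w : Config n, sqrtDiff (tensorDensity d (ρ, preCollision (x, w)))
      (tensorDensity d (ρ, postCollision (x, w))) * b x = tensorDensity d (ρ, w) *
        (sqrtDiff (preDensity d (ρ, x)) (postDensity d (ρ, x)) * b x) := by
    intro w
    rw [tensorDensity_preCollision, tensorDensity_postCollision, NNReal.coe_mul, NNReal.coe_mul,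
      sqrtDiff_mul (NNReal.coe_nonneg _), ENNReal.ofReal_coe_nnreal, mul_assoc]
  simp_rw [this]
  rw [lintegral_mul_const _ hm', lintegral_tensorDensity hd h, one_mul]

theorem entropyProduction_tensorPower_two (hd : Measurable d) {B : ℝ → ℝ → ℝ≥0∞}
    (hB : Measurable (Function.uncurry B)) {ρ : ProbabilityMeasure Velocity}
    (h : (ρ : Measure Velocity) = volume.withDensity fun v => (d (ρ, v) : ℝ≥0∞)) :
    entropyProduction B (tensorPower 2 ρ) = pairProduction d (collisionWeight B) ρ := by
  have hm : Measurable fun v : Config 2 => (tensorDensity d (ρ, v) : ℝ≥0∞) :=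
    ((measurable_tensorDensity hd).comp measurable_prodMk_left).coe_nnreal_ennreal
  rw [tensorPower_eq_withDensity_tensorDensity hd h, entropyProduction_withDensity hB hm,
    ← production_tensorDensity hd (measurable_collisionWeight hB) h 0]
  rfl

section Mixture

variable {ν : Measure (ProbabilityMeasure Velocity)}

/-- The duality needs finite total mass, so `b` is truncated at a level `M`, by monotone
convergence. -/
theorem exists_truncation_lt (hd : Measurable d) {b : CollisionCoord → ℝ≥0∞} (hb : Measurable b)
    {C : ℝ≥0∞} (hC : C < ∫⁻ ρ, pairProduction d b ρ ∂ν) :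
    ∃ (β : CollisionCoord → ℝ≥0) (M : ℝ≥0), Measurable β ∧ (∀ x, β x ≤ M) ∧
      (∀ x, (β x : ℝ≥0∞) ≤ b x) ∧
      C < ∫⁻ y, sqrtDiff (β y.2 * preDensity d y) (β y.2 * postDensity d y)
        ∂(ν.prod collisionMeasure) := by
  let β : ℕ → CollisionCoord → ℝ≥0 := fun M x => (min (b x) (M : ℝ≥0∞)).toNNReal
  have hβ : ∀ M x, (β M x : ℝ≥0∞) = min (b x) M := fun M x =>
    ENNReal.coe_toNNReal (ne_top_of_le_ne_top (ENNReal.natCast_ne_top M) (min_le_right _ _))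
  have hβm : ∀ M, Measurable (β M) := fun M => (hb.min measurable_const).ennreal_toNNReal
  have hβmono : Monotone fun (M : ℕ) (y : ProbabilityMeasure Velocity × CollisionCoord) =>
      sqrtDiff (preDensity d y) (postDensity d y) * (β M y.2 : ℝ≥0∞) := by
    intro M M' hM y
    simp only [hβ]
    gcongr
  have hsup : ∀ x, ⨆ M, (β M x : ℝ≥0∞) = b x := by
    intro x
    simp_rw [hβ]
    rw [← inf_iSup_eq, ENNReal.iSup_natCast, inf_top_eq]
  have hm : ∀ M, Measurable fun y : ProbabilityMeasure Velocity × CollisionCoord =>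
      sqrtDiff (preDensity d y) (postDensity d y) * (β M y.2 : ℝ≥0∞) := fun M =>
    measurable_pairProduction_integrand hd (hβm M).coe_nnreal_ennreal
  unfold pairProduction at hC
  rw [← lintegral_prod _ (measurable_pairProduction_integrand hd hb).aemeasurable] at hC
  have e : ∫⁻ y, sqrtDiff (preDensity d y) (postDensity d y) * b y.2 ∂(ν.prod collisionMeasure) =
      ⨆ M, ∫⁻ y, sqrtDiff (preDensity d y) (postDensity d y) * (β M y.2 : ℝ≥0∞)
        ∂(ν.prod collisionMeasure) := by
    rw [← lintegral_iSup hm hβmono]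
    refine lintegral_congr fun y => ?_
    rw [← ENNReal.mul_iSup, hsup]
  rw [e, lt_iSup_iff] at hC
  obtain ⟨M, hM⟩ := hC
  refine ⟨β M, M, hβm M, fun x => ?_, fun x => (hβ M x).le.trans (min_le_left _ _), ?_⟩
  · have := (hβ M x).le.trans (min_le_right _ _)
    exact_mod_cast this
  · refine hM.trans_eq (lintegral_congr fun y => ?_)
    rw [sqrtDiff_mul (NNReal.coe_nonneg _), ENNReal.ofReal_coe_nnreal, mul_comm]

variable [IsProbabilityMeasure ν]

/-- The density of `ν^n`. -/
noncomputable def mixtureDensity (d : ProbabilityMeasure Velocity × Velocity → ℝ≥0)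
    (ν : Measure (ProbabilityMeasure Velocity)) {n : ℕ} (v : Config n) : ℝ≥0∞ :=
  ∫⁻ ρ, tensorDensity d (ρ, v) ∂ν

theorem measurable_mixtureDensity (hd : Measurable d) {n : ℕ} :
    Measurable (mixtureDensity d ν (n := n)) :=
  (measurable_tensorDensity hd).coe_nnreal_ennreal.lintegral_prod_left'

theorem mixture_eq_withDensity (hd : Measurable d)
    (h : ∀ᵐ ρ : ProbabilityMeasure Velocity ∂ν,
      (ρ : Measure Velocity) = volume.withDensity fun v => (d (ρ, v) : ℝ≥0∞)) (n : ℕ) :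
    mixture ν n = volume.withDensity (mixtureDensity d ν) := by
  ext s hs
  have hm : Measurable fun q : ProbabilityMeasure Velocity × Config n =>
    (tensorDensity d q : ℝ≥0∞) := (measurable_tensorDensity hd).coe_nnreal_ennreal
  rw [mixture_apply _ _ hs, withDensity_apply _ hs]
  unfold mixtureDensity
  rw [← lintegral_lintegral_swap hm.aemeasurable]
  refine lintegral_congr_ae ?_
  filter_upwards [h] with ρ hρ
  rw [tensorPower_eq_withDensity_tensorDensity hd hρ, withDensity_apply _ hs]

theorem lintegral_mixtureDensity (hd : Measurable d)
    (h : ∀ᵐ ρ : ProbabilityMeasure Velocity ∂ν,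
      (ρ : Measure Velocity) = volume.withDensity fun v => (d (ρ, v) : ℝ≥0∞)) (n : ℕ) :
    ∫⁻ v : Config n, mixtureDensity d ν v = 1 := by
  rw [← setLIntegral_univ, ← withDensity_apply _ MeasurableSet.univ,
    ← mixture_eq_withDensity hd h, mixture_apply _ _ MeasurableSet.univ]
  simp

theorem entropyProduction_mixture_eq (hd : Measurable d)
    (h : ∀ᵐ ρ : ProbabilityMeasure Velocity ∂ν,
      (ρ : Measure Velocity) = volume.withDensity fun v => (d (ρ, v) : ℝ≥0∞))
    {B : ℝ → ℝ → ℝ≥0∞} (hB : Measurable (Function.uncurry B)) (n : ℕ) :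
    entropyProduction B (mixture ν (n + 2)) =
      production (collisionWeight B) fun v : Config (n + 2) => (mixtureDensity d ν v).toReal := by
  rw [mixture_eq_withDensity hd h, entropyProduction_withDensity hB (measurable_mixtureDensity hd)]

/-- The upper bound, valid for every `n`: convexity with `ρ` as the parameter. -/
theorem production_mixtureDensity_le (hd : Measurable d)
    (h : ∀ᵐ ρ : ProbabilityMeasure Velocity ∂ν,
      (ρ : Measure Velocity) = volume.withDensity fun v => (d (ρ, v) : ℝ≥0∞))
    {b : CollisionCoord → ℝ≥0∞} (hb : Measurable b) (n : ℕ) :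
    production b (fun v : Config (n + 2) => (mixtureDensity d ν v).toReal) ≤
      ∫⁻ ρ, pairProduction d b ρ ∂ν := by
  have hle := production_lintegral_le (l := ν) hb (n := n) (f := fun q => (tensorDensity d q : ℝ))
    (measurable_tensorDensity hd).coe_nnreal_real (fun q => NNReal.coe_nonneg _) (by
      simp only [ENNReal.ofReal_coe_nnreal]
      exact ne_of_eq_of_ne (lintegral_mixtureDensity hd h (n + 2)) ENNReal.one_ne_top)
  simp only [ENNReal.ofReal_coe_nnreal] at hle
  refine hle.trans_eq (lintegral_congr_ae ?_)
  filter_upwards [h] with ρ hρ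
  exact production_tensorDensity hd hb hρ n

/-- After Tonelli, the spectator factor `tensorDensity d (ρ, w) dw` is the law of a sample of `ρ`.
This is how spectators become a source of information about `ρ`. -/
theorem lintegral_mul_mixture (hd : Measurable d)
    (h : ∀ᵐ ρ : ProbabilityMeasure Velocity ∂ν,
      (ρ : Measure Velocity) = volume.withDensity fun v => (d (ρ, v) : ℝ≥0∞)) {j : ℕ}
    {H : CollisionCoord × Config j → ℝ≥0∞} (hH : Measurable H)
    {c : ProbabilityMeasure Velocity × CollisionCoord → ℝ≥0} (hc : Measurable c) :
    ∫⁻ p : CollisionCoord × Config j, H p *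
        ∫⁻ ρ, (tensorDensity d (ρ, p.2) * c (ρ, p.1) : ℝ≥0) ∂ν ∂(collisionMeasure.prod volume) =
      ∫⁻ y, (∫⁻ w, H (y.2, w) * c y ∂(tensorPower j y.1)) ∂(ν.prod collisionMeasure) := by
  have ht := measurable_tensorDensity hd (n := j)
  have hm1 : Measurable fun q : (CollisionCoord × Config j) × ProbabilityMeasure Velocity =>
      ((tensorDensity d (q.2, q.1.2) * c (q.2, q.1.1) : ℝ≥0) : ℝ≥0∞) := by fun_prop
  have hm2 : Measurable fun q : (CollisionCoord × Config j) × ProbabilityMeasure Velocity =>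
      H q.1 * ((tensorDensity d (q.2, q.1.2) * c (q.2, q.1.1) : ℝ≥0) : ℝ≥0∞) := by fun_prop
  have hm3 : Measurable fun q : (ProbabilityMeasure Velocity × CollisionCoord) × Config j =>
      H (q.1.2, q.2) * (c q.1 : ℝ≥0∞) := by fun_prop
  have hm4 : Measurable fun y : ProbabilityMeasure Velocity × CollisionCoord =>
      ∫⁻ w, H (y.2, w) * c y ∂(tensorPower j y.1) :=
    hm3.lintegral_kernel_prod_right' (κ := (tensorKernel j).comap Prod.fst measurable_fst)
  have e1 : ∀ p : CollisionCoord × Config j, H p *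
        ∫⁻ ρ, (tensorDensity d (ρ, p.2) * c (ρ, p.1) : ℝ≥0) ∂ν =
      ∫⁻ ρ, H p * (tensorDensity d (ρ, p.2) * c (ρ, p.1) : ℝ≥0) ∂ν := fun p =>
    (lintegral_const_mul _ (hm1.comp measurable_prodMk_left)).symm
  simp_rw [e1]
  rw [lintegral_lintegral_swap hm2.aemeasurable, lintegral_prod _ hm4.aemeasurable]
  refine lintegral_congr_ae ?_
  filter_upwards [h] with ρ hρ
  have hm5 : Measurable fun p : CollisionCoord × Config j =>
      H p * ((tensorDensity d (ρ, p.2) * c (ρ, p.1) : ℝ≥0) : ℝ≥0∞) :=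
    hm2.comp measurable_prodMk_right
  rw [lintegral_prod _ hm5.aemeasurable]
  refine lintegral_congr fun x => ?_
  have hm6 : Measurable fun w : Config j => (tensorDensity d (ρ, w) : ℝ≥0∞) := by fun_prop
  have hm7 : Measurable fun w : Config j => H (x, w) * (c (ρ, x) : ℝ≥0∞) := by fun_prop
  rw [tensorPower_eq_withDensity_tensorDensity hd hρ,
    lintegral_withDensity_eq_lintegral_mul _ hm6 hm7]
  refine lintegral_congr fun w => ?_
  simp only [Pi.mul_apply, ENNReal.coe_mul]
  ring

/-- Since `expPair` is linear in the densities and `v` does not involve `ρ`, the dual functional of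
the mixture is an exact average over `ρ` and a sample of it. -/
theorem lintegral_expPair_mixture (hd : Measurable d)
    (h : ∀ᵐ ρ : ProbabilityMeasure Velocity ∂ν,
      (ρ : Measure Velocity) = volume.withDensity fun v => (d (ρ, v) : ℝ≥0∞)) {j : ℕ}
    {β : CollisionCoord → ℝ≥0} (hβ : Measurable β) {v : CollisionCoord × Config j → ℝ}
    (hv : Measurable v) :
    ∫⁻ p : CollisionCoord × Config j,
        expPair (v p) (β p.1 * (mixtureDensity d ν (preCollision p)).toReal)
          (β p.1 * (mixtureDensity d ν (postCollision p)).toReal)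
        ∂(collisionMeasure.prod volume) =
      ∫⁻ y, (∫⁻ w, expPair (v (y.2, w)) (β y.2 * preDensity d y) (β y.2 * postDensity d y)
        ∂(tensorPower j y.1)) ∂(ν.prod collisionMeasure) := by
  have hpre := measurable_preDensity hd
  have hpost := measurable_postDensity hd
  have ht := measurable_tensorDensity hd (n := j)
  have hsplit : ∀ (s : ℝ) {a b : ℝ}, 0 ≤ a → 0 ≤ b → expPair s a b =
      ENNReal.ofReal (Real.exp s) * ENNReal.ofReal a +
        ENNReal.ofReal (Real.exp (-s)) * ENNReal.ofReal b := by
    intro s a b ha hb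
    rw [expPair, ENNReal.ofReal_add (by positivity) (by positivity),
      ENNReal.ofReal_mul (Real.exp_pos _).le, ENNReal.ofReal_mul (Real.exp_pos _).le]
  let H : ℝ → CollisionCoord × Config j → ℝ≥0∞ := fun s p =>
    ENNReal.ofReal (Real.exp (s * v p)) * β p.1
  have hH : ∀ s, Measurable (H s) := fun s => by unfold H; fun_prop
  have hfin : ∀ᵐ v : Config (j + 2), mixtureDensity d ν v < ⊤ :=
    ae_lt_top (measurable_mixtureDensity hd)
      (ne_of_eq_of_ne (lintegral_mixtureDensity hd h _) ENNReal.one_ne_top)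
  have k1 := lintegral_mul_mixture hd h (hH 1) hpre
  have k2 := lintegral_mul_mixture hd h (hH (-1)) hpost
  have hl1 : Measurable fun p : CollisionCoord × Config j => H 1 p *
      ∫⁻ ρ, (tensorDensity d (ρ, p.2) * preDensity d (ρ, p.1) : ℝ≥0) ∂ν := by
    refine (hH 1).mul ?_
    have : Measurable fun q : (CollisionCoord × Config j) × ProbabilityMeasure Velocity =>
      ((tensorDensity d (q.2, q.1.2) * preDensity d (q.2, q.1.1) : ℝ≥0) : ℝ≥0∞) := by fun_prop
    exact this.lintegral_prod_right'
  have hr0 : Measurable fun q : (ProbabilityMeasure Velocity × CollisionCoord) × Config j =>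
      H 1 (q.1.2, q.2) * (preDensity d q.1 : ℝ≥0∞) := by
    have := hH 1
    fun_prop
  have hr1 : Measurable fun y : ProbabilityMeasure Velocity × CollisionCoord =>
      ∫⁻ w, H 1 (y.2, w) * preDensity d y ∂(tensorPower j y.1) :=
    hr0.lintegral_kernel_prod_right' (κ := (tensorKernel j).comap Prod.fst measurable_fst)
  calc _ = ∫⁻ p : CollisionCoord × Config j, (H 1 p *
          (∫⁻ ρ, (tensorDensity d (ρ, p.2) * preDensity d (ρ, p.1) : ℝ≥0) ∂ν) + H (-1) p *
          (∫⁻ ρ, (tensorDensity d (ρ, p.2) * postDensity d (ρ, p.1) : ℝ≥0) ∂ν))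
          ∂(collisionMeasure.prod volume) := by
        refine lintegral_congr_ae ?_
        filter_upwards [(quasiMeasurePreserving_preCollision j).ae hfin,
          (quasiMeasurePreserving_postCollision j).ae hfin] with p h1 h2
        rw [hsplit _ (by positivity) (by positivity), ENNReal.ofReal_mul (NNReal.coe_nonneg _),
          ENNReal.ofReal_mul (NNReal.coe_nonneg _), ENNReal.ofReal_toReal h1.ne,
          ENNReal.ofReal_toReal h2.ne, ENNReal.ofReal_coe_nnreal]
        simp only [H, mixtureDensity, tensorDensity_preCollision, tensorDensity_postCollision,
          one_mul, neg_one_mul, mul_assoc]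
    _ = _ := by
        rw [lintegral_add_left hl1, k1, k2, ← lintegral_add_left hr1]
        refine lintegral_congr fun y => ?_
        have hr2 : Measurable fun w : Config j => H 1 (y.2, w) * (preDensity d y : ℝ≥0∞) := by
          have := hH 1
          fun_prop
        rw [← lintegral_add_left hr2]
        refine lintegral_congr fun w => ?_
        rw [hsplit _ (mul_nonneg (NNReal.coe_nonneg _) (NNReal.coe_nonneg _))
          (mul_nonneg (NNReal.coe_nonneg _) (NNReal.coe_nonneg _)), ENNReal.ofReal_mul (NNReal.coe_nonneg _),
          ENNReal.ofReal_mul (NNReal.coe_nonneg _), ENNReal.ofReal_coe_nnreal,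
          ENNReal.ofReal_coe_nnreal, ENNReal.ofReal_coe_nnreal]
        simp only [H, one_mul, neg_one_mul, mul_assoc]

theorem lintegral_postDensity (hd : Measurable d)
    (h : ∀ᵐ ρ : ProbabilityMeasure Velocity ∂ν,
      (ρ : Measure Velocity) = volume.withDensity fun v => (d (ρ, v) : ℝ≥0∞)) :
    ∫⁻ y, (postDensity d y : ℝ≥0∞) ∂(ν.prod collisionMeasure) = sphereMeasure univ := by
  have hpost := measurable_postDensity hd
  have hpp := measurable_pairPoint
  rw [lintegral_prod _ hpost.coe_nnreal_ennreal.aemeasurable]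
  have : ∀ᵐ ρ ∂ν, ∫⁻ x, (postDensity d (ρ, x) : ℝ≥0∞) ∂collisionMeasure = sphereMeasure univ := by
    filter_upwards [h] with ρ hρ
    have hone : ∫⁻ v, (d (ρ, v) : ℝ≥0∞) = 1 := by
      rw [← setLIntegral_univ, ← withDensity_apply _ MeasurableSet.univ, ← hρ, measure_univ]
    have hm : Measurable fun v => (d (ρ, v) : ℝ≥0∞) := by fun_prop
    have hg : Measurable fun z : Velocity × Velocity => (d (ρ, z.1) : ℝ≥0∞) * d (ρ, z.2) := by
      fun_prop
    have hmm : Measurable fun x : CollisionCoord => (postDensity d (ρ, x) : ℝ≥0∞) := by fun_prop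
    rw [collisionMeasure, lintegral_prod _ hmm.aemeasurable]
    have hin : ∀ σ : Sphere, ∫⁻ x, (postDensity d (ρ, (σ, x)) : ℝ≥0∞) ∂pairMeasure = 1 := by
      intro σ
      have h1 := measurePreserving_pairPoint.lintegral_comp hg
      rw [lintegral_prod_mul hm.aemeasurable hm.aemeasurable, hone, one_mul] at h1
      rw [← h1]
      refine lintegral_congr fun x => ?_
      simp [postDensity]
    simp_rw [hin]
    simp
  rw [lintegral_congr_ae this]
  simp

theorem lintegral_preDensity (hd : Measurable d)
    (h : ∀ᵐ ρ : ProbabilityMeasure Velocity ∂ν,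
      (ρ : Measure Velocity) = volume.withDensity fun v => (d (ρ, v) : ℝ≥0∞)) :
    ∫⁻ y, (preDensity d y : ℝ≥0∞) ∂(ν.prod collisionMeasure) = sphereMeasure univ := by
  rw [← lintegral_postDensity hd h]
  have hmp := (MeasurePreserving.id ν).prod measurePreserving_swapDirections
  rw [← hmp.lintegral_comp (measurable_postDensity hd).coe_nnreal_ennreal]
  rfl

theorem lintegral_weighted_density_ne_top (hd : Measurable d)
    (h : ∀ᵐ ρ : ProbabilityMeasure Velocity ∂ν,
      (ρ : Measure Velocity) = volume.withDensity fun v => (d (ρ, v) : ℝ≥0∞))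
    {β : CollisionCoord → ℝ≥0} {M : ℝ≥0} (hβM : ∀ x, β x ≤ M) :
    ∫⁻ y : ProbabilityMeasure Velocity × CollisionCoord,
      ENNReal.ofReal (β y.2 * preDensity d y + β y.2 * postDensity d y)
        ∂(ν.prod collisionMeasure) ≠ ⊤ := by
  have hpre := measurable_preDensity hd
  have hpost := measurable_postDensity hd
  have hle : ∫⁻ y : ProbabilityMeasure Velocity × CollisionCoord,
      ENNReal.ofReal (β y.2 * preDensity d y + β y.2 * postDensity d y)
        ∂(ν.prod collisionMeasure) ≤ ∫⁻ y : ProbabilityMeasure Velocity × CollisionCoord,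
      M * ((preDensity d y : ℝ≥0∞) + postDensity d y) ∂(ν.prod collisionMeasure) := by
    refine lintegral_mono fun y => ?_
    rw [← mul_add, ← NNReal.coe_add, ← NNReal.coe_mul, ENNReal.ofReal_coe_nnreal,
      ENNReal.coe_mul, ENNReal.coe_add]
    gcongr
    exact hβM _
  refine ne_top_of_le_ne_top ?_ hle
  rw [lintegral_const_mul _ (by fun_prop), lintegral_add_left (by fun_prop),
    lintegral_preDensity hd h, lintegral_postDensity hd h]
  exact ENNReal.mul_ne_top ENNReal.coe_ne_top
    (ENNReal.add_ne_top.2 ⟨measure_ne_top _ _, measure_ne_top _ _⟩)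

/-- The lower bound. A near-optimal `u(ρ, x)` is approximated by `v(x, w)` with `w` a sample of `ρ`;
used as a dual function for the mixture, `v` loses at most the slack `η`. -/
theorem eventually_lt_production_mixtureDensity (hd : Measurable d)
    (h : ∀ᵐ ρ : ProbabilityMeasure Velocity ∂ν,
      (ρ : Measure Velocity) = volume.withDensity fun v => (d (ρ, v) : ℝ≥0∞))
    {b : CollisionCoord → ℝ≥0∞} (hb : Measurable b) {C : ℝ≥0∞}
    (hC : C < ∫⁻ ρ, pairProduction d b ρ ∂ν) :
    ∀ᶠ j in atTop,
      C < production b (fun v : Config (j + 2) => (mixtureDensity d ν v).toReal) := by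
  obtain ⟨β, M, hβ, hβM, hβb, hlt⟩ := exists_truncation_lt hd hb hC
  have hpre := measurable_preDensity hd
  have hpost := measurable_postDensity hd
  let a₁ : ProbabilityMeasure Velocity × CollisionCoord → ℝ := fun y => β y.2 * preDensity d y
  let a₂ : ProbabilityMeasure Velocity × CollisionCoord → ℝ := fun y => β y.2 * postDensity d y
  have ha₁ : Measurable a₁ := by unfold a₁; fun_prop
  have ha₂ : Measurable a₂ := by unfold a₂; fun_prop
  have ha₁0 : ∀ y, 0 ≤ a₁ y := fun y => by unfold a₁; positivity
  have ha₂0 : ∀ y, 0 ≤ a₂ y := fun y => by unfold a₂; positivity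
  have hfin : ∫⁻ y, ENNReal.ofReal (a₁ y + a₂ y) ∂(ν.prod collisionMeasure) ≠ ⊤ :=
    lintegral_weighted_density_ne_top hd h hβM
  obtain ⟨K, u, hK, hu, huK, hlt'⟩ := exists_dual_lt ha₁ ha₂ ha₁0 ha₂0 hfin hlt
  -- The weight `a₁ + a₂` is that of the error in `expPair_le_add`; the tolerance `e^{-K} η` chosen
  -- below compensates its factor `e^K`.
  let θ := (ν.prod collisionMeasure).withDensity fun y => ENNReal.ofReal (a₁ y + a₂ y)
  have : IsFiniteMeasure θ := isFiniteMeasure_withDensity hfin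
  have hm : Measurable fun y => ENNReal.ofReal (a₁ y + a₂ y) := by fun_prop
  obtain ⟨η, hη, hηlt⟩ := ENNReal.lt_iff_exists_add_pos_lt.1 hlt'
  have hε : ENNReal.ofReal (Real.exp (-K)) * (η : ℝ≥0∞) ≠ 0 :=
    mul_ne_zero (by simpa using Real.exp_pos _) (by simpa using hη.ne')
  filter_upwards [eventually_exists_sample_approx (θ := θ) hu huK hε] with j ⟨v, hv, hvK, hle⟩
  have hf := measurable_mixtureDensity (ν := ν) hd (n := j + 2)
  have hpreC := measurable_preCollision (n := j)
  have hpostC := measurable_postCollision (n := j)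
  -- The dual identity at `v = 0` shows that the total mass is the same for the mixture as for the
  -- pair densities.
  have hT : ∫⁻ p : CollisionCoord × Config j,
      ENNReal.ofReal (β p.1 * (mixtureDensity d ν (preCollision p)).toReal +
        β p.1 * (mixtureDensity d ν (postCollision p)).toReal) ∂(collisionMeasure.prod volume) =
      ∫⁻ y, ENNReal.ofReal (a₁ y + a₂ y) ∂(ν.prod collisionMeasure) := by
    have := lintegral_expPair_mixture hd h hβ (j := j) (v := fun _ => 0) measurable_const
    simp only [expPair, neg_zero, Real.exp_zero, one_mul, lintegral_const, measure_univ,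
      mul_one] at this
    exact this
  have hdual := lintegral_add_le_sqrtDiff_add_expPair (μ := collisionMeasure.prod volume)
    (a := fun p : CollisionCoord × Config j =>
      β p.1 * (mixtureDensity d ν (preCollision p)).toReal)
    (b := fun p : CollisionCoord × Config j =>
      β p.1 * (mixtureDensity d ν (postCollision p)).toReal)
    (by fun_prop) (by fun_prop) (fun p => by positivity) (fun p => by positivity) v
  rw [hT, lintegral_expPair_mixture hd h hβ hv] at hdual
  have hdist : Measurable fun q : (ProbabilityMeasure Velocity × CollisionCoord) × Config j =>
      ENNReal.ofReal |u q.1 - v (q.1.2, q.2)| := by fun_prop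
  have hdist' : Measurable fun y : ProbabilityMeasure Velocity × CollisionCoord =>
      ∫⁻ w, ENNReal.ofReal |u y - v (y.2, w)| ∂(tensorPower j y.1) :=
    hdist.lintegral_kernel_prod_right' (κ := (tensorKernel j).comap Prod.fst measurable_fst)
  have hmd : Measurable fun y : ProbabilityMeasure Velocity × CollisionCoord =>
      ENNReal.ofReal (a₁ y + a₂ y) *
        ∫⁻ w, ENNReal.ofReal |u y - v (y.2, w)| ∂(tensorPower j y.1) := hm.mul hdist'
  have hexp : ∫⁻ y, (∫⁻ w, expPair (v (y.2, w)) (a₁ y) (a₂ y) ∂(tensorPower j y.1))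
      ∂(ν.prod collisionMeasure) ≤
      ∫⁻ y, expPair (u y) (a₁ y) (a₂ y) ∂(ν.prod collisionMeasure) + η := by
    calc _ ≤ ∫⁻ y, (expPair (u y) (a₁ y) (a₂ y) + ENNReal.ofReal (Real.exp K) *
            (ENNReal.ofReal (a₁ y + a₂ y) *
              ∫⁻ w, ENNReal.ofReal |u y - v (y.2, w)| ∂(tensorPower j y.1)))
            ∂(ν.prod collisionMeasure) := by
          refine lintegral_mono fun y => ?_
          have hdy : Measurable fun w => ENNReal.ofReal |u y - v (y.2, w)| :=
            hdist.comp measurable_prodMk_left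
          refine (lintegral_mono fun w =>
            expPair_le_add (u := u y) (hvK _) (ha₁0 y) (ha₂0 y)).trans_eq ?_
          rw [lintegral_add_left measurable_const, lintegral_const_mul _ (hdy.const_mul _),
            lintegral_const_mul _ hdy]
          simp
      _ = ∫⁻ y, expPair (u y) (a₁ y) (a₂ y) ∂(ν.prod collisionMeasure) +
            ENNReal.ofReal (Real.exp K) *
              ∫⁻ q, ENNReal.ofReal |u q.1 - v (q.1.2, q.2)| ∂(coupling θ j) := by
          rw [lintegral_add_left (measurable_expPair hu ha₁ ha₂),
            lintegral_const_mul _ hmd, lintegral_coupling _ hdist,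
            lintegral_withDensity_eq_lintegral_mul _ hm hdist']
          rfl
      _ ≤ ∫⁻ y, expPair (u y) (a₁ y) (a₂ y) ∂(ν.prod collisionMeasure) +
            ENNReal.ofReal (Real.exp K) * (ENNReal.ofReal (Real.exp (-K)) * η) := by gcongr
      _ = _ := by
          rw [← mul_assoc, ← ENNReal.ofReal_mul (Real.exp_pos K).le, ← Real.exp_add]
          simp
  have hS : ∫⁻ p : CollisionCoord × Config j,
      sqrtDiff (β p.1 * (mixtureDensity d ν (preCollision p)).toReal)
        (β p.1 * (mixtureDensity d ν (postCollision p)).toReal) ∂(collisionMeasure.prod volume) ≤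
      production b (fun v : Config (j + 2) => (mixtureDensity d ν v).toReal) := by
    refine lintegral_mono fun p => ?_
    rw [sqrtDiff_mul (NNReal.coe_nonneg _), ENNReal.ofReal_coe_nnreal, mul_comm]
    gcongr
    exact hβb _
  rw [add_assoc] at hηlt
  exact lt_of_add_lt_add_right (hηlt.trans_le (hdual.trans (add_le_add hS hexp)))

end Mixture

end JointDensity

/-! ### Affinity in infinite dimension -/

theorem ae_absolutelyContinuous_and_tendsto_entropyProduction {B : ℝ → ℝ → ℝ≥0∞}
    (hB : Measurable (Function.uncurry B))
    (ν : ProbabilityMeasure (ProbabilityMeasure Velocity))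
    (hI : (⨆ j : ℕ, fisherInformation
      (mixture (ν : Measure (ProbabilityMeasure Velocity)) (j + 1))) < ⊤) :
    (∀ᵐ ρ : ProbabilityMeasure Velocity ∂(ν : Measure (ProbabilityMeasure Velocity)),
      (ρ : Measure Velocity) ≪ volume) ∧
    AEMeasurable (fun ρ : ProbabilityMeasure Velocity => entropyProduction B (tensorPower 2 ρ))
      (ν : Measure (ProbabilityMeasure Velocity)) ∧
    Tendsto (fun n : ℕ => entropyProduction B
        (mixture (ν : Measure (ProbabilityMeasure Velocity)) (n + 2))) atTop
      (𝓝 (∫⁻ ρ, entropyProduction B (tensorPower 2 ρ)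
        ∂(ν : Measure (ProbabilityMeasure Velocity)))) := by
  obtain ⟨A, hIA, hAt⟩ := exists_between hI
  obtain ⟨d, hd, h⟩ := exists_joint_density ν hAt.ne fun j =>
    (le_iSup (fun j : ℕ => fisherInformation
      (mixture (ν : Measure (ProbabilityMeasure Velocity)) (j + 1))) j).trans_lt hIA
  have hb := measurable_collisionWeight hB
  have hpair : (fun ρ : ProbabilityMeasure Velocity => entropyProduction B (tensorPower 2 ρ))
      =ᵐ[(ν : Measure (ProbabilityMeasure Velocity))] pairProduction d (collisionWeight B) := by
    filter_upwards [h] with ρ hρ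
    exact entropyProduction_tensorPower_two hd hB hρ
  refine ⟨?_, ⟨_, measurable_pairProduction hd hb, hpair⟩, ?_⟩
  · filter_upwards [h] with ρ hρ
    rw [hρ]
    exact withDensity_absolutelyContinuous _ _
  · rw [lintegral_congr_ae hpair]
    simp_rw [entropyProduction_mixture_eq hd h hB]
    refine tendsto_order.2 ⟨fun C hC => eventually_lt_production_mixtureDensity hd h hb hC,
      fun C hC => Eventually.of_forall fun n =>
        (production_mixtureDensity_le hd h hb n).trans_lt hC⟩

end Kac

theorem mainTheorem7
    (B : ℝ → ℝ → ℝ≥0∞)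
    (hB : LowerSemicontinuousOn (Function.uncurry B) (Ici (0 : ℝ) ×ˢ Icc (-1 : ℝ) 1)) :
    -- lower semicontinuity on `𝒫(ℝ³ᴺ)`, `N = n + 2`
    (∀ (n : ℕ) (F : ℕ → ProbabilityMeasure (Kac.Config (n + 2)))
        (F' : ProbabilityMeasure (Kac.Config (n + 2))),
        (∀ k, (F k : Measure (Kac.Config (n + 2))) ≪ volume) →
        (F' : Measure (Kac.Config (n + 2))) ≪ volume →
        Tendsto F atTop (𝓝 F') →
        Kac.entropyProduction B (F' : Measure (Kac.Config (n + 2))) ≤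
          liminf (fun k => Kac.entropyProduction B (F k : Measure (Kac.Config (n + 2)))) atTop) ∧
    -- superadditivity, `j = m + 2 ≤ N = n + 2`
    (∀ (m n : ℕ) (h : m + 2 ≤ n + 2) (F : ProbabilityMeasure (Kac.Config (n + 2))),
        (F : Measure (Kac.Config (n + 2))) ≪ volume →
        Kac.entropyProduction B (Kac.firstMarginal h (F : Measure (Kac.Config (n + 2)))) ≤
          Kac.entropyProduction B (F : Measure (Kac.Config (n + 2)))) ∧
    -- affinity in infinite dimension
    (∀ ν : ProbabilityMeasure (ProbabilityMeasure Kac.Velocity),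
        (⨆ j : ℕ, Kac.fisherInformation
          (Kac.mixture (ν : Measure (ProbabilityMeasure Kac.Velocity)) (j + 1))) < ⊤ →
        (∫⁻ v, ‖v 0‖ₑ ^ 2
          ∂(Kac.mixture (ν : Measure (ProbabilityMeasure Kac.Velocity)) 1)) < ⊤ →
        (∀ᵐ ρ : ProbabilityMeasure Kac.Velocity ∂(ν : Measure (ProbabilityMeasure Kac.Velocity)),
          (ρ : Measure Kac.Velocity) ≪ volume) ∧
        AEMeasurable
          (fun ρ : ProbabilityMeasure Kac.Velocity =>
            Kac.entropyProduction B (Kac.tensorPower 2 ρ))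
          (ν : Measure (ProbabilityMeasure Kac.Velocity)) ∧
        Tendsto
          (fun n : ℕ => Kac.entropyProduction B
            (Kac.mixture (ν : Measure (ProbabilityMeasure Kac.Velocity)) (n + 2)))
          atTop
          (𝓝 (∫⁻ ρ, Kac.entropyProduction B (Kac.tensorPower 2 ρ)
            ∂(ν : Measure (ProbabilityMeasure Kac.Velocity))))) := by
  refine ⟨fun n F F' hF hF' hlim => ?_, fun m n h F hF => ?_, fun ν hI _ => ?_⟩
  · have := Kac.entropyProduction_le_liminf (Kac.lowerSemicontinuous_extendKernel hB) hF hF' hlim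
    simpa only [Kac.entropyProduction_extendKernel] using this
  · have := Kac.entropyProduction_firstMarginal_le
      (Kac.lowerSemicontinuous_extendKernel hB).measurable h F hF
    simpa only [Kac.entropyProduction_extendKernel] using this
  · have := Kac.ae_absolutelyContinuous_and_tendsto_entropyProduction
      (Kac.lowerSemicontinuous_extendKernel hB).measurable ν hI
    simpa only [Kac.entropyProduction_extendKernel] using this
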